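/- A *matching multicut* of a finite simple graph $G$ is a partition of $V(G)$ into non-empty parts such that every vertex has at most one neighbour outside its own part. *Matching Multicut* asks, given $G$ and an integer $\ell\ge 0$, whether $G$ has a matching multicut on at least $\ell$ parts. A *nice tree decomposition* of $G$ is a tree decomposition $(T,\{X_t\})$ with $T$ rooted at a node with empty bag, in which every node $t$ is either a leaf with $X_t=\emptyset$, an introduce node (exactly one child $s$, and $X_t=X_s\cup\{v\}$ with $v\notin X_s$), a forget node (exactly one child $s$, and $X_t=X_s\setminus\{v\}$ with $v\in X_s$), or a join node (exactly two children $s_1,s_2$, and $X_{s_1}=X_{s_2}=X_t$). Its width is $\max_t|X_t|-1$. The machine model is a random access machine with unit cost whose only arithmetic operations are addition and truncated subtraction. The input $I$ is a list of numbers consisting of a list of the edges of $G$, the nice tree decomposition (the parent and the bag of each node), and $\ell$; $|I|$ is the length of this list. **Theorem.** There is an algorithm $\mathcal A$ that, given a graph $G$ on $n\ge 1$ vertices, a nice tree decomposition of $G$ of width $k$, and $\ell$, computes the maximum number of parts of a matching multicut of $G$ and decides whether $G$ has a matching multicut on at least $\ell$ parts, such that: 1. If the decomposition has $O(kn)$ nodes,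 then $\mathcal A$ runs in time $2^{O(k\log k)}\,n$. Precisely: for every $c$ there is a $C$ such that, whenever the decomposition has at most $c(k+1)n$ nodes, $\mathcal A$ halts after at most $C\cdot 2^{C k\log_2 k}\cdot n$ steps (with $k\log_2 k=0$ for $k=0$). 2. Matching Multicut with a given nice tree decomposition is fixed-parameter tractable with respect to the width: there are a computable function $f$ and a constant $d$ such that $\mathcal A$ always halts after at most $f(k)\cdot|I|^d$ steps. 3. Consequently it is fixed-parameter tractable by treewidth when a decomposition of optimal, or boundedly larger, width is given: for every computable function $g$ there are a computable function $f$ and a constant $d$ such that, whenever $k\le g(\mathrm{tw}(G))$, $\mathcal A$ halts after at most $f(\mathrm{tw}(G))\cdot|I|^d$ steps. -/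

import Mathlib

namespace MatchingMulticut

/-! ### Matching multicuts -/

/-- A partition of the vertex set (into non-empty parts) is a matching multicut of `G` if every
vertex has at most one neighbour outside its own part. -/
def IsMatchingMulticut {V : Type*} [Fintype V] [DecidableEq V] (G : SimpleGraph V)
    (P : Finpartition (Finset.univ : Finset V)) : Prop :=
  ∀ A ∈ P.parts, ∀ v ∈ A, (G.neighborSet v \ (A : Set V)).ncard ≤ 1

/-- The numbers of parts of the matching multicuts of `G`. -/
def partCounts {V : Type*} [Fintype V] [DecidableEq V] (G : SimpleGraph V) : Set ℕ :=
  {m | ∃ P : Finpartition (Finset.univ : Finset V), IsMatchingMulticut G P ∧ P.parts.card = m}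

/-- The decision problem: does `G` admit a matching multicut on at least `l` parts? -/
def HasMatchingMulticut {V : Type*} [Fintype V] [DecidableEq V] (G : SimpleGraph V)
    (l : ℕ) : Prop :=
  ∃ P : Finpartition (Finset.univ : Finset V), IsMatchingMulticut G P ∧ l ≤ P.parts.card

/-! ### Tree decompositions -/

/-- `(T, X)` is a tree decomposition of `G`. (`Connected` includes that the set of nodes whose bag
contains `v` is non-empty.) -/
structure IsTreeDecomposition {V I : Type*} (G : SimpleGraph V) (T : SimpleGraph I)
    (X : I → Finset V) : Prop where
  isTree : T.IsTree
  edge_mem : ∀ u v, G.Adj u v → ∃ t, u ∈ X t ∧ v ∈ X t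
  subtree : ∀ v, (T.induce {t | v ∈ X t}).Connected

/-- The width of a decomposition: the largest size of a bag, minus one. -/
def width {V I : Type*} [Fintype I] (X : I → Finset V) : ℕ :=
  (Finset.univ.sup fun t => (X t).card) - 1

/-- The treewidth: the least width of a tree decomposition. -/
noncomputable def treewidth {V : Type*} (G : SimpleGraph V) : ℕ :=
  sInf {k | ∃ (N : ℕ) (T : SimpleGraph (Fin N)) (X : Fin N → Finset V),
    IsTreeDecomposition G T X ∧ width X = k}

/-- In the tree `T` rooted at `r`, the node `s` is a child of the node `t`. -/
def IsChild {I : Type*} (T : SimpleGraph I) (r t s : I) : Prop :=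
  T.Adj t s ∧ T.dist r s = T.dist r t + 1

section nodes

variable {V I : Type*} [DecidableEq V] (T : SimpleGraph I) (r : I) (X : I → Finset V) (t : I)

def IsLeafNode : Prop :=
  (∀ s, ¬ IsChild T r t s) ∧ X t = ∅

def IsIntroduceNode : Prop :=
  ∃ s v, (∀ s', IsChild T r t s' ↔ s' = s) ∧ v ∉ X s ∧ X t = insert v (X s)

def IsForgetNode : Prop :=
  ∃ s v, (∀ s', IsChild T r t s' ↔ s' = s) ∧ v ∈ X s ∧ X t = (X s).erase v

def IsJoinNode : Prop :=
  ∃ s₁ s₂, s₁ ≠ s₂ ∧ (∀ s', IsChild T r t s' ↔ s' = s₁ ∨ s' = s₂) ∧ X s₁ = X t ∧ X s₂ = X t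

end nodes

/-- `(T, X)`, with `T` rooted at `r`, is a nice tree decomposition of `G`. -/
structure IsNiceTreeDecomposition {V I : Type*} [DecidableEq V] (G : SimpleGraph V)
    (T : SimpleGraph I) (r : I) (X : I → Finset V) : Prop where
  isTreeDecomposition : IsTreeDecomposition G T X
  root_bag : X r = ∅
  node : ∀ t, IsLeafNode T r X t ∨ IsIntroduceNode T r X t ∨ IsForgetNode T r X t ∨
    IsJoinNode T r X t

/-! ### Random access machines with unit cost -/

/-- A configuration of the random access machine: registers and an addressable memory. -/
structure Store where
  reg : ℕ → ℕ
  mem : ℕ → ℕ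

/-- Structured programs of the random access machine. The only arithmetic operations are addition
and truncated subtraction; `load` and `store` address the memory indirectly. -/
inductive Prog where
  | const (d c : ℕ)
  | copy (d a : ℕ)
  | add (d a b : ℕ)
  | sub (d a b : ℕ)
  | load (d a : ℕ)
  | store (a b : ℕ)
  | seq (p q : Prog)
  | cond (a : ℕ) (p q : Prog)
  | loop (a : ℕ) (p : Prog)

/-- Set register `d` to the value `x`. -/
def Store.setReg (σ : Store) (d x : ℕ) : Store := ⟨Function.update σ.reg d x, σ.mem⟩

/-- Set memory cell `i` to the value `x`. -/
def Store.setMem (σ : Store) (i x : ℕ) : Store := ⟨σ.reg, Function.update σ.mem i x⟩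

/-- `Runs p σ m τ`: the program `p`, started in `σ`, halts in `τ` after exactly `m` steps. Every
elementary instruction and every evaluation of a test costs one step. `cond a p q` runs `p` if
register `a` is non-zero and `q` otherwise; `loop a p` runs `p` while register `a` is non-zero. -/
inductive Runs : Prog → Store → ℕ → Store → Prop
  | const (σ d c) : Runs (.const d c) σ 1 (σ.setReg d c)
  | copy (σ d a) : Runs (.copy d a) σ 1 (σ.setReg d (σ.reg a))
  | add (σ d a b) : Runs (.add d a b) σ 1 (σ.setReg d (σ.reg a + σ.reg b))
  | sub (σ d a b) : Runs (.sub d a b) σ 1 (σ.setReg d (σ.reg a - σ.reg b))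
  | load (σ d a) : Runs (.load d a) σ 1 (σ.setReg d (σ.mem (σ.reg a)))
  | store (σ a b) : Runs (.store a b) σ 1 (σ.setMem (σ.reg a) (σ.reg b))
  | seq {p q σ τ υ m₁ m₂} (h₁ : Runs p σ m₁ τ) (h₂ : Runs q τ m₂ υ) :
      Runs (.seq p q) σ (m₁ + m₂) υ
  | cond_true {a p q σ τ m} (h : σ.reg a ≠ 0) (h₁ : Runs p σ m τ) :
      Runs (.cond a p q) σ (m + 1) τ
  | cond_false {a p q σ τ m} (h : σ.reg a = 0) (h₁ : Runs q σ m τ) :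
      Runs (.cond a p q) σ (m + 1) τ
  | loop_done {a p σ} (h : σ.reg a = 0) : Runs (.loop a p) σ 1 σ
  | loop_step {a p σ τ υ m₁ m₂} (h : σ.reg a ≠ 0) (h₁ : Runs p σ m₁ τ)
      (h₂ : Runs (.loop a p) τ m₂ υ) : Runs (.loop a p) σ (m₁ + m₂ + 1) υ

/-- The initial configuration: the input word occupies the first memory cells, and all other
cells and all registers are zero. -/
def initStore (input : List ℕ) : Store := ⟨fun _ => 0, fun i => input.getD i 0⟩

/-! ### Instances -/

/-- `input` is a list of numbers that describes the graph `G`, the decomposition `(T, X)` with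
root `r`, and the number `l`: a header, then every edge of `G` once, and then for each node its
parent (the root is its own parent), the size of its bag, and the elements of its bag. The edges
and the elements of each bag may be listed in any order. -/
def Encodes {n N : ℕ} (G : SimpleGraph (Fin n)) (T : SimpleGraph (Fin N)) (r : Fin N)
    (X : Fin N → Finset (Fin n)) (l : ℕ) (input : List ℕ) : Prop :=
  ∃ (E : List (Fin n × Fin n)) (par : Fin N → Fin N) (B : Fin N → List (Fin n)),
    (E.map fun e => s(e.1, e.2)).Nodup ∧
    (∀ z, z ∈ (E.map fun e => s(e.1, e.2)) ↔ z ∈ G.edgeSet) ∧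
    par r = r ∧ (∀ t, t ≠ r → IsChild T r (par t) t) ∧
    (∀ t, (B t).Nodup ∧ (B t).toFinset = X t) ∧
    input = [n, N, E.length, (r : ℕ), l] ++
      E.flatMap (fun e => [(e.1 : ℕ), (e.2 : ℕ)]) ++
      (List.finRange N).flatMap
        (fun t => (par t : ℕ) :: (B t).length :: (B t).map fun v => (v : ℕ))

/-- Started on `input`, the program `p` halts within at most `b` steps; register `0` then holds
the maximum number of parts of a matching multicut of `G`, and register `1` holds the answer
(`1` for yes, `0` for no) to the question whether `G` has a matching multicut on at least `l`
parts. -/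
def SolvesWithin (p : Prog) (input : List ℕ) {n : ℕ} (G : SimpleGraph (Fin n)) (l : ℕ)
    (b : ℝ) : Prop :=
  ∃ (m : ℕ) (τ : Store), Runs p (initStore input) m τ ∧ (m : ℝ) ≤ b ∧
    IsGreatest (partCounts G) (τ.reg 0) ∧
    (HasMatchingMulticut G l → τ.reg 1 = 1) ∧ (¬ HasMatchingMulticut G l → τ.reg 1 = 0)

end MatchingMulticut

/-!
The algorithm is dynamic programming over the decomposition, but it proceeds by contracting nodes
into their parents. A node `t` carries the set `U` of vertices of all bags contracted into it so far
and a table for the *partial multicuts* of `G[U]` with boundary the bag of `t`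
(`PartialMulticut`): labellings of `U` in which the interior vertices already satisfy the degree
condition. Towards the rest of the graph such a labelling matters only through its *state*, i.e.
the labels on the bag and, for every vertex of the bag, the number of its interior neighbours
outside its part; the table stores the maximum number of parts that avoid the bag. If `k` bounds the
bag sizes, `K = k + 2` labels and degrees suffice, so there are `K ^ k * K ^ k = 2 ^ O(k log k)`
states. Initially the tables are those of the bare bags (`tableValid_init`), and contracting `s`
into its parent combines all pairs of states of the two nodes (`tableValid_glue`). Leaf, introduce,
forget and join nodes need no separate treatment: all that is used is that the two sides of the tree
edge meet in the common vertices of the two bags only (`separates_contractedBag`). The combinatorial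
core is the equivalence between partial multicuts of a glued graph and pairs of compatible partial
multicuts, `PartialMulticut.glue` and `PartialMulticut.split`. When only the root is left, its bag
is empty and its partial multicuts are the matching multicuts of `G` (`partialMulticut_univ`).

A node may be contracted as soon as its counter of uncontracted children is zero. A pointer runs
through the nodes; whenever it meets such a node, the contraction is carried out and repeated at the
parent, as long as this brings the counter of the parent to zero. As every round either contracts a
node or advances the pointer, `2 N` rounds suffice for `N` nodes (`run_main`); the root counts as
its own child and is therefore never contracted.

The machine program is obtained from a small language of expressions and statements with bounded
loops only (`Expr`, `Stmt`). Its semantics is a total function, and its running time is bounded by a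
function of the registers that hold loop counts, which a well-formed statement never changes;
`Expr.comp_runs` and `Stmt.comp_runs` transfer both to the compiled programs. Multiplication,
division and powers, which the machine lacks, are computed by bounded loops of length at most the
number of states. Every statement contains at most one loop over nodes, edges or vertices, and every
other loop is bounded in terms of the number of states (`Stmt.linear`). The total time is thus a
power of the number of states times the number of nodes (`exists_solvesWithin`), as the numbers of
vertices and edges are at most that of nodes times `k` and `k ^ 2`. All three parts of the theorem
follow by elementary estimates.
-/

namespace MatchingMulticut

open Function

/-! ### A loop language and its compilation to random access machine programs -/

/-- Expressions over registers and a read-only memory. `letE v a b` evaluates `b` with register `v`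
holding the value of `a`. `fold i a c init body` iterates `body` as often as register `c` says,
with the index in register `i` and the accumulator, which starts as `init`, in register `a`. Both
binders leave the registers as they found them. -/
inductive Expr where
  | var (i : ℕ)
  | num (c : ℕ)
  | add (a b : Expr)
  | sub (a b : Expr)
  | load (a : Expr)
  | ite (c a b : Expr)
  | letE (v : ℕ) (a b : Expr)
  | fold (i a c : ℕ) (init body : Expr)

namespace Expr

/-- The value of an expression in the registers `ρ` and the memory `μ`. -/
def eval : Expr → (ℕ → ℕ) → (ℕ → ℕ) → ℕ
  | var i, ρ, _ => ρ i
  | num c, _, _ => c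
  | add a b, ρ, μ => a.eval ρ μ + b.eval ρ μ
  | sub a b, ρ, μ => a.eval ρ μ - b.eval ρ μ
  | load a, ρ, μ => μ (a.eval ρ μ)
  | ite c a b, ρ, μ => if c.eval ρ μ = 0 then b.eval ρ μ else a.eval ρ μ
  | letE v a b, ρ, μ => b.eval (update ρ v (a.eval ρ μ)) μ
  | fold i a c init body, ρ, μ =>
      Nat.rec (init.eval ρ μ) (fun j s => body.eval (update (update ρ i j) a s) μ) (ρ c)

/-- Well-formedness: all registers are below `d`, loop counts sit in registers below `g`, and only
registers from `g` on are bound. -/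
def wf (g d : ℕ) : Expr → Bool
  | var i => i < d
  | num _ => true
  | add a b => a.wf g d && b.wf g d
  | sub a b => a.wf g d && b.wf g d
  | load a => a.wf g d
  | ite c a b => c.wf g d && a.wf g d && b.wf g d
  | letE v a b => decide (g ≤ v) && decide (v < d) && a.wf g d && b.wf g d
  | fold i a c init body => decide (c < g) && decide (g ≤ i) && decide (i < d) && decide (g ≤ a) &&
      decide (a < d) && decide (i ≠ a) && init.wf g d && body.wf g d

/-- A bound for the running time of the compiled expression. As no loop count is ever rebound, it
depends only on the registers at the start. -/
def time : Expr → (ℕ → ℕ) → ℕ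
  | var _, _ => 1
  | num _, _ => 1
  | add a b, ρ => a.time ρ + b.time ρ + 1
  | sub a b, ρ => a.time ρ + b.time ρ + 1
  | load a, ρ => a.time ρ + 1
  | ite c a b, ρ => c.time ρ + a.time ρ + b.time ρ + 1
  | letE _ a b, ρ => a.time ρ + b.time ρ + 4
  | fold _ _ c init body, ρ => init.time ρ + ρ c * (body.time ρ + 5) + 9

/-- Compilation: the value ends up in register `d`; only registers from `d` on change. -/
def comp : Expr → ℕ → Prog
  | var i, d => .copy d i
  | num c, d => .const d c
  | add a b, d => .seq (a.comp d) (.seq (b.comp (d + 1)) (.add d d (d + 1)))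
  | sub a b, d => .seq (a.comp d) (.seq (b.comp (d + 1)) (.sub d d (d + 1)))
  | load a, d => .seq (a.comp d) (.load d d)
  | ite c a b, d => .seq (c.comp d) (.cond d (a.comp d) (b.comp d))
  | letE v a b, d => .seq (a.comp d) (.seq (.copy (d + 1) v) (.seq (.copy v d)
      (.seq (b.comp (d + 2)) (.seq (.copy v (d + 1)) (.copy d (d + 2))))))
  | fold i a c init body, d => .seq (init.comp d) (.seq (.copy (d + 1) i) (.seq (.copy (d + 2) a)
      (.seq (.copy (d + 3) c) (.seq (.copy a d) (.seq (.const i 0)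
      (.seq (.loop (d + 3) (.seq (body.comp (d + 4)) (.seq (.copy a (d + 4))
        (.seq (.const (d + 4) 1) (.seq (.add i i (d + 4)) (.sub (d + 3) (d + 3) (d + 4)))))))
      (.seq (.copy d a) (.seq (.copy i (d + 1)) (.copy a (d + 2))))))))))

theorem wf_mono {g d d' : ℕ} (h : d ≤ d') (e : Expr) (he : e.wf g d = true) :
    e.wf g d' = true := by
  induction e <;> simp only [wf, Bool.and_eq_true, decide_eq_true_eq] at * <;> grind

theorem eval_congr {g d : ℕ} (e : Expr) (he : e.wf g d = true) {ρ ρ' : ℕ → ℕ} (μ : ℕ → ℕ)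
    (h : ∀ i < d, ρ i = ρ' i) : e.eval ρ μ = e.eval ρ' μ := by
  induction e generalizing ρ ρ' with
  | var i => simp only [wf, decide_eq_true_eq] at he; exact h i he
  | num c => rfl
  | add a b iha ihb | sub a b iha ihb =>
    simp only [wf, Bool.and_eq_true] at he
    simp only [eval, iha he.1 h, ihb he.2 h]
  | load a iha => simp only [eval, iha he h]
  | ite c a b ihc iha ihb =>
    simp only [wf, Bool.and_eq_true] at he
    simp only [eval, ihc he.1.1 h, iha he.1.2 h, ihb he.2 h]
  | letE v a b iha ihb =>
    simp only [wf, Bool.and_eq_true, decide_eq_true_eq] at he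
    simp only [eval, iha he.1.2 h]
    exact ihb he.2 fun i hi => by simp only [update_apply]; split <;> simp [h i hi]
  | fold i a c init body ihi ihb =>
    simp only [wf, Bool.and_eq_true, decide_eq_true_eq] at he
    obtain ⟨⟨⟨⟨⟨⟨⟨hc, hi⟩, hid⟩, ha⟩, had⟩, hia⟩, h1⟩, h2⟩ := he
    simp only [eval, ihi h1 h, h c (by omega)]
    congr 1
    funext j s
    exact ihb h2 fun i hi => by simp only [update_apply]; grind

theorem time_congr {g d : ℕ} (e : Expr) (he : e.wf g d = true) {ρ ρ' : ℕ → ℕ}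
    (h : ∀ i < g, ρ i = ρ' i) : e.time ρ = e.time ρ' := by
  induction e <;> simp only [wf, Bool.and_eq_true, decide_eq_true_eq] at he <;>
    simp only [time] <;> grind

end Expr

@[simp] theorem Store.setReg_reg (σ : Store) (d x i : ℕ) :
    (σ.setReg d x).reg i = if i = d then x else σ.reg i := by
  simp [Store.setReg, update_apply]

@[simp] theorem Store.setReg_mem (σ : Store) (d x : ℕ) : (σ.setReg d x).mem = σ.mem := rfl

theorem Expr.comp_runs {g : ℕ} (e : Expr) : ∀ (d : ℕ), g ≤ d → e.wf g d = true → ∀ σ : Store,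
    ∃ m τ, Runs (e.comp d) σ m τ ∧ m ≤ e.time σ.reg ∧ τ.reg d = e.eval σ.reg σ.mem ∧
      τ.mem = σ.mem ∧ ∀ i < d, τ.reg i = σ.reg i := by
  induction e with
  | var i =>
    intro d hg he σ
    exact ⟨1, _, .copy σ d i, le_rfl, by simp [eval], rfl, fun j hj => by simp [hj.ne]⟩
  | num c =>
    intro d hg he σ
    exact ⟨1, _, .const σ d c, le_rfl, by simp [eval], rfl, fun j hj => by simp [hj.ne]⟩
  | add a b iha ihb | sub a b iha ihb =>
    intro d hg he σ
    simp only [wf, Bool.and_eq_true] at he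
    obtain ⟨m₁, τ₁, r₁, t₁, v₁, e₁, p₁⟩ := iha d hg he.1 σ
    obtain ⟨m₂, τ₂, r₂, t₂, v₂, e₂, p₂⟩ :=
      ihb (d + 1) (by omega) (wf_mono (by omega) _ he.2) τ₁
    rw [eval_congr b he.2 _ p₁, e₁] at v₂
    rw [time_congr b he.2 fun i hi => p₁ i (by omega)] at t₂
    refine ⟨_, _, .seq r₁ (.seq r₂ (by first | exact .add _ _ _ _ | exact .sub _ _ _ _)), ?_, ?_,
      by simp [e₂, e₁], fun j hj => ?_⟩
    · simp only [time]; omega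
    · simp [eval, p₂ d (by omega), v₁, v₂]
    · simp [hj.ne, p₂ j (by omega), p₁ j hj]
  | load a iha =>
    intro d hg he σ
    obtain ⟨m₁, τ₁, r₁, t₁, v₁, e₁, p₁⟩ := iha d hg he σ
    exact ⟨_, _, .seq r₁ (.load _ _ _), by simp only [time]; omega, by simp [eval, v₁, e₁],
      by simp [e₁], fun j hj => by simp [hj.ne, p₁ j hj]⟩
  | ite c a b ihc iha ihb =>
    intro d hg he σ
    simp only [wf, Bool.and_eq_true] at he
    obtain ⟨m₁, τ₁, r₁, t₁, v₁, e₁, p₁⟩ := ihc d hg he.1.1 σ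
    by_cases hc : c.eval σ.reg σ.mem = 0
    · obtain ⟨m₂, τ₂, r₂, t₂, v₂, e₂, p₂⟩ := ihb d hg he.2 τ₁
      rw [eval_congr b he.2 _ p₁, e₁] at v₂
      rw [time_congr b he.2 fun i hi => p₁ i (by omega)] at t₂
      exact ⟨_, _, .seq r₁ (.cond_false (by rw [v₁, hc]) r₂), by simp only [time]; omega,
        by simp [eval, hc, v₂], by rw [e₂, e₁], fun j hj => by rw [p₂ j hj, p₁ j hj]⟩
    · obtain ⟨m₂, τ₂, r₂, t₂, v₂, e₂, p₂⟩ := iha d hg he.1.2 τ₁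
      rw [eval_congr a he.1.2 _ p₁, e₁] at v₂
      rw [time_congr a he.1.2 fun i hi => p₁ i (by omega)] at t₂
      exact ⟨_, _, .seq r₁ (.cond_true (by rwa [v₁]) r₂), by simp only [time]; omega,
        by simp [eval, hc, v₂], by rw [e₂, e₁], fun j hj => by rw [p₂ j hj, p₁ j hj]⟩
  | letE v a b iha ihb =>
    intro d hg he σ
    simp only [wf, Bool.and_eq_true, decide_eq_true_eq] at he
    obtain ⟨⟨⟨hv, hvd⟩, ha⟩, hb⟩ := he
    obtain ⟨m₁, τ₁, r₁, t₁, v₁, e₁, p₁⟩ := iha d hg ha σ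
    obtain ⟨m₂, τ₂, r₂, t₂, v₂, e₂, p₂⟩ := ihb (d + 2) (by omega) (wf_mono (by omega) _ hb)
      ((τ₁.setReg (d + 1) (τ₁.reg v)).setReg v ((τ₁.setReg (d + 1) (τ₁.reg v)).reg d))
    rw [eval_congr b hb (ρ' := update σ.reg v (a.eval σ.reg σ.mem)) _ (fun i hi => by
      simp only [Store.setReg_reg, update_apply]; grind), Store.setReg_mem, Store.setReg_mem,
      e₁] at v₂
    rw [time_congr b hb (ρ' := σ.reg) (fun i hi => by
      simp only [Store.setReg_reg]; grind)] at t₂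
    refine ⟨_, _, .seq r₁ (.seq (.copy _ _ _) (.seq (.copy _ _ _) (.seq r₂ (.seq (.copy _ _ _)
      (.copy _ _ _))))), ?_, ?_, by simp [e₂, e₁], fun j hj => ?_⟩
    · simp only [time]; omega
    · simp only [Store.setReg_reg, eval]; grind
    · have := p₂ j (by omega)
      have := p₂ (d + 1) (by omega)
      simp only [Store.setReg_reg] at *; grind
  | fold i a c init body ihi ihb =>
    intro d hg he σ
    simp only [wf, Bool.and_eq_true, decide_eq_true_eq] at he
    obtain ⟨⟨⟨⟨⟨⟨⟨hc, hi⟩, hid⟩, ha⟩, had⟩, hia⟩, h1⟩, h2⟩ := he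
    obtain ⟨m₁, τ₁, r₁, t₁, v₁, e₁, p₁⟩ := ihi d hg h1 σ
    obtain ⟨F, hF0, hFs, hFe⟩ : ∃ F : ℕ → ℕ, F 0 = init.eval σ.reg σ.mem ∧
        (∀ j, F (j + 1) = body.eval (update (update σ.reg i j) a (F j)) σ.mem) ∧
        F (σ.reg c) = (fold i a c init body).eval σ.reg σ.mem :=
      ⟨fun k => Nat.rec (init.eval σ.reg σ.mem)
        (fun j s => body.eval (update (update σ.reg i j) a s) σ.mem) k, rfl, fun _ => rfl, rfl⟩
    -- The loop, started with `k` rounds to go.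
    have key : ∀ k j (τ : Store), τ.reg (d + 3) = k → τ.reg i = j → τ.reg a = F j →
        τ.mem = σ.mem → (∀ q < d, q ≠ i → q ≠ a → τ.reg q = σ.reg q) →
        ∃ m υ, Runs (.loop (d + 3) (.seq (body.comp (d + 4)) (.seq (.copy a (d + 4))
          (.seq (.const (d + 4) 1) (.seq (.add i i (d + 4)) (.sub (d + 3) (d + 3) (d + 4)))))))
          τ m υ ∧ m ≤ k * (body.time σ.reg + 5) + 1 ∧ υ.reg a = F (j + k) ∧ υ.mem = σ.mem ∧
          (∀ q < d, q ≠ i → q ≠ a → υ.reg q = σ.reg q) ∧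
          υ.reg (d + 1) = τ.reg (d + 1) ∧ υ.reg (d + 2) = τ.reg (d + 2) := by
      intro k
      induction k with
      | zero =>
        intro j τ hk hj hF' hm hq
        exact ⟨1, τ, .loop_done hk, by omega, by simpa using hF', hm, hq, rfl, rfl⟩
      | succ k ih =>
        intro j τ hk hj hF' hm hq
        obtain ⟨m₂, τ₂, r₂, t₂, v₂, e₂, p₂⟩ :=
          ihb (d + 4) (by omega) (wf_mono (by omega) _ h2) τ
        rw [eval_congr body h2 (ρ' := update (update σ.reg i j) a (F j)) _ (fun q hq => by
          simp only [update_apply]; grind), hm] at v₂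
        rw [time_congr body h2 (ρ' := σ.reg) (fun q hq => by grind)] at t₂
        obtain ⟨τ₃, hτ₃, s₂⟩ : ∃ τ₃, τ₃ = _ ∧ Runs _ _ _ τ₃ :=
          ⟨_, rfl, Runs.seq r₂ (.seq (.copy τ₂ a (d + 4)) (.seq (.const _ (d + 4) 1)
            (.seq (.add _ i i (d + 4)) (.sub _ (d + 3) (d + 3) (d + 4)))))⟩
        have q1 := p₂ (d + 1) (by omega)
        have q2 := p₂ (d + 2) (by omega)
        have q3 := p₂ (d + 3) (by omega)
        have qi := p₂ i (by omega)
        have hF₁ := hFs j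
        obtain ⟨m₃, υ, r₃, t₃, v₃, e₃, w₃, x₃, y₃⟩ := ih (j + 1) τ₃
          (by clear ih ihi ihb; simp only [hτ₃, Store.setReg_reg]; grind)
          (by clear ih ihi ihb; simp only [hτ₃, Store.setReg_reg]; grind)
          (by clear ih ihi ihb; simp only [hτ₃, Store.setReg_reg]; grind)
          (by simp [hτ₃, e₂, hm]) (fun q hq' hqi hqa => by
            clear ih ihi ihb
            have := p₂ q (by omega)
            have := hq q hq' hqi hqa
            simp only [hτ₃, Store.setReg_reg]; grind)
        refine ⟨_, υ, .loop_step (by omega) s₂ r₃, ?_, ?_, e₃, w₃, ?_, ?_⟩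
        · rw [Nat.succ_mul]; omega
        · rw [v₃]; congr 1; omega
        · rw [x₃]; simp only [hτ₃, Store.setReg_reg]; grind
        · rw [y₃]; simp only [hτ₃, Store.setReg_reg]; grind
    obtain ⟨υ, hυ, -⟩ : ∃ υ, υ = _ ∧ Runs _ _ _ υ := ⟨_, rfl, .seq (.copy τ₁ (d + 1) i)
      (.seq (.copy _ (d + 2) a) (.seq (.copy _ (d + 3) c) (.seq (.copy _ a d) (.const _ i 0))))⟩
    have pi := p₁ i hid
    have pa := p₁ a had
    have pc := p₁ c (by omega)
    obtain ⟨m₂, ω, r₂, t₂, v₂, e₂, w₂, x₂, y₂⟩ := key (σ.reg c) 0 υ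
      (by clear key ihi ihb; simp only [hυ, Store.setReg_reg]; grind)
      (by clear key ihi ihb; simp only [hυ, Store.setReg_reg]; grind)
      (by clear key ihi ihb; simp only [hυ, Store.setReg_reg]; grind) (by simp [hυ, e₁])
      (fun q hq hqi hqa => by
        clear key ihi ihb
        have := p₁ q hq
        simp only [hυ, Store.setReg_reg]; grind)
    clear key ihi ihb
    have h1 : ω.reg (d + 1) = σ.reg i := by
      rw [x₂]; simp only [hυ, Store.setReg_reg]; grind
    have h2 : ω.reg (d + 2) = σ.reg a := by
      rw [y₂]; simp only [hυ, Store.setReg_reg]; grind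
    subst hυ
    refine ⟨_, _, .seq r₁ (.seq (.copy τ₁ (d + 1) i) (.seq (.copy _ (d + 2) a)
      (.seq (.copy _ (d + 3) c) (.seq (.copy _ a d) (.seq (.const _ i 0) (.seq r₂
      (.seq (.copy _ _ _) (.seq (.copy _ _ _) (.copy _ _ _))))))))), ?_, ?_, by simp [e₂], ?_⟩
    · simp only [time]; omega
    · rw [← hFe]
      rw [Nat.zero_add] at v₂
      simp only [Store.setReg_reg]; grind
    · intro q hq
      have := w₂ q hq
      simp only [Store.setReg_reg]; grind

end MatchingMulticut

namespace MatchingMulticut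

open Function

/-- Statements of the loop language: assignment to a register, writing the value of the second
expression to the address given by the first, sequencing, case distinction, and repetition as often
as a register says at the start. -/
inductive Stmt where
  | set (r : ℕ) (e : Expr)
  | put (a e : Expr)
  | seq (s t : Stmt)
  | ite (c : Expr) (s t : Stmt)
  | rep (c : ℕ) (s : Stmt)

namespace Stmt

/-- The effect of a statement on registers and memory. -/
def run : Stmt → (ℕ → ℕ) × (ℕ → ℕ) → (ℕ → ℕ) × (ℕ → ℕ)
  | set r e, st => (update st.1 r (e.eval st.1 st.2), st.2)
  | put a e, st => (st.1, update st.2 (a.eval st.1 st.2) (e.eval st.1 st.2))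
  | seq s t, st => t.run (s.run st)
  | ite c s t, st => if c.eval st.1 st.2 = 0 then t.run st else s.run st
  | rep c s, st => s.run^[st.1 c] st

/-- Well-formedness: registers below `g`, which hold the loop counts, are never assigned. -/
def wf (g d : ℕ) : Stmt → Bool
  | set r e => decide (g ≤ r) && decide (r < d) && e.wf g d
  | put a e => a.wf g d && e.wf g d
  | seq s t => s.wf g d && t.wf g d
  | ite c s t => c.wf g d && s.wf g d && t.wf g d
  | rep c s => decide (c < g) && s.wf g d

/-- A bound for the running time of a well-formed statement. -/
def time : Stmt → (ℕ → ℕ) → ℕ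
  | set _ e, ρ => e.time ρ + 1
  | put a e, ρ => a.time ρ + e.time ρ + 1
  | seq s t, ρ => s.time ρ + t.time ρ
  | ite c s t, ρ => c.time ρ + s.time ρ + t.time ρ + 1
  | rep c s, ρ => ρ c * (s.time ρ + 3) + 2

/-- Compilation: registers from `d` on serve as scratch space. -/
def comp : Stmt → ℕ → Prog
  | set r e, d => .seq (e.comp d) (.copy r d)
  | put a e, d => .seq (a.comp d) (.seq (e.comp (d + 1)) (.store d (d + 1)))
  | seq s t, d => .seq (s.comp d) (t.comp d)
  | ite c s t, d => .seq (c.comp d) (.cond d (s.comp d) (t.comp d))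
  | rep c s, d => .seq (.copy d c) (.loop d (.seq (s.comp (d + 1)) (.seq (.const (d + 1) 1)
      (.sub d d (d + 1)))))

theorem time_congr {g d : ℕ} (s : Stmt) (hs : s.wf g d = true) {ρ ρ' : ℕ → ℕ}
    (h : ∀ i < g, ρ i = ρ' i) : s.time ρ = s.time ρ' := by
  induction s with
  | set r e =>
    simp only [wf, Bool.and_eq_true] at hs
    simp only [time, e.time_congr hs.2 h]
  | put a e =>
    simp only [wf, Bool.and_eq_true] at hs
    simp only [time, e.time_congr hs.2 h, a.time_congr hs.1 h]
  | seq s t ihs iht =>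
    simp only [wf, Bool.and_eq_true] at hs
    simp only [time, ihs hs.1, iht hs.2]
  | ite c s t ihs iht =>
    simp only [wf, Bool.and_eq_true] at hs
    simp only [time, ihs hs.1.2, iht hs.2, c.time_congr hs.1.1 h]
  | rep c s ih =>
    simp only [wf, Bool.and_eq_true, decide_eq_true_eq] at hs
    simp only [time, ih hs.2, h c hs.1]

theorem run_of_lt {g d : ℕ} (s : Stmt) (hs : s.wf g d = true) (st : (ℕ → ℕ) × (ℕ → ℕ)) {i : ℕ}
    (hi : i < g) : (s.run st).1 i = st.1 i := by
  induction s generalizing st with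
  | set r e =>
    simp only [wf, Bool.and_eq_true, decide_eq_true_eq] at hs
    simp only [run, update_apply]; split <;> [omega; rfl]
  | put a e => rfl
  | seq s t ihs iht =>
    simp only [wf, Bool.and_eq_true] at hs
    simp only [run, ihs hs.1, iht hs.2]
  | ite c s t ihs iht =>
    simp only [wf, Bool.and_eq_true] at hs
    simp only [run]; split <;> simp only [ihs hs.1.2, iht hs.2]
  | rep c s ih =>
    simp only [wf, Bool.and_eq_true] at hs
    simp only [run]
    generalize st.1 c = k
    induction k with
    | zero => rfl
    | succ k ihk => rw [iterate_succ_apply', ih hs.2, ihk]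

end Stmt

/-- A store represents a state of the loop language if it agrees with it on the memory and on the
registers below `D`. -/
def Store.Represents (σ : Store) (D : ℕ) (st : (ℕ → ℕ) × (ℕ → ℕ)) : Prop :=
  (∀ i < D, σ.reg i = st.1 i) ∧ σ.mem = st.2

theorem Expr.comp_runs' {g D d : ℕ} (e : Expr) (hg : g ≤ D) (hd : D ≤ d) (he : e.wf g D = true)
    {σ : Store} {st : (ℕ → ℕ) × (ℕ → ℕ)} (h : σ.Represents D st) :
    ∃ m τ, Runs (e.comp d) σ m τ ∧ m ≤ e.time st.1 ∧ τ.reg d = e.eval st.1 st.2 ∧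
      τ.Represents D st ∧ ∀ i < d, τ.reg i = σ.reg i := by
  obtain ⟨m, τ, r, t, v, e', p⟩ := e.comp_runs d (hg.trans hd) (e.wf_mono hd he) σ
  rw [e.eval_congr he _ h.1, h.2] at v
  rw [e.time_congr he fun i hi => h.1 i (by omega)] at t
  exact ⟨m, τ, r, t, v, ⟨fun i hi => by rw [p i (by omega), h.1 i hi], by rw [e', h.2]⟩, p⟩

theorem Stmt.comp_set_runs {g D d : ℕ} (r : ℕ) (e : Expr) (hg : g ≤ D) (hd : D ≤ d) (hr : r < D)
    (he : e.wf g D = true) {σ : Store} {st : (ℕ → ℕ) × (ℕ → ℕ)} (h : σ.Represents D st) :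
    ∃ m τ, Runs ((set r e).comp d) σ m τ ∧ m ≤ (set r e).time st.1 ∧
      τ.Represents D ((set r e).run st) ∧ ∀ i, D ≤ i → i < d → τ.reg i = σ.reg i := by
  obtain ⟨m₁, τ₁, r₁, t₁, v₁, e₁, p₁⟩ := e.comp_runs' hg hd he h
  refine ⟨_, _, .seq r₁ (.copy _ _ _), by simp only [time]; omega, ⟨fun i hi => ?_, e₁.2⟩,
    fun i hi hid => ?_⟩
  · simp only [Store.setReg_reg, run, update_apply, v₁]; split <;> [rfl; exact e₁.1 i hi]
  · simp only [Store.setReg_reg]; rw [if_neg (by omega), p₁ i hid]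

theorem Stmt.comp_runs {g D : ℕ} (hg : g ≤ D) (s : Stmt) : ∀ (d : ℕ), D ≤ d → s.wf g D = true →
    ∀ (σ : Store) (st : (ℕ → ℕ) × (ℕ → ℕ)), σ.Represents D st →
    ∃ m τ, Runs (s.comp d) σ m τ ∧ m ≤ s.time st.1 ∧ τ.Represents D (s.run st) ∧
      ∀ i, D ≤ i → i < d → τ.reg i = σ.reg i := by
  induction s with
  | set r e =>
    intro d hd hs σ st h
    simp only [wf, Bool.and_eq_true, decide_eq_true_eq] at hs
    exact comp_set_runs r e hg hd hs.1.2 hs.2 h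
  | put a e =>
    intro d hd hs σ st h
    simp only [wf, Bool.and_eq_true] at hs
    obtain ⟨m₁, τ₁, r₁, t₁, v₁, e₁, p₁⟩ := a.comp_runs' hg hd hs.1 h
    obtain ⟨m₂, τ₂, r₂, t₂, v₂, e₂, p₂⟩ := e.comp_runs' (d := d + 1) hg (by omega) hs.2 e₁
    refine ⟨_, _, .seq r₁ (.seq r₂ (.store _ _ _)), by simp only [time]; omega,
      ⟨fun i hi => e₂.1 i hi, ?_⟩, fun i hi hid => ?_⟩
    · simp only [Store.setMem, run, v₂, p₂ d (by omega), v₁, e₂.2]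
    · simp only [Store.setMem]; rw [p₂ i (by omega), p₁ i hid]
  | seq s t ihs iht =>
    intro d hd hs σ st h
    simp only [wf, Bool.and_eq_true] at hs
    obtain ⟨m₁, τ₁, r₁, t₁, e₁, p₁⟩ := ihs d hd hs.1 σ st h
    obtain ⟨m₂, τ₂, r₂, t₂, e₂, p₂⟩ := iht d hd hs.2 τ₁ _ e₁
    rw [t.time_congr (ρ' := st.1) hs.2 fun i hi => s.run_of_lt hs.1 st hi] at t₂
    exact ⟨_, _, .seq r₁ r₂, by simp only [time]; omega, e₂,
      fun i hi hid => by rw [p₂ i hi hid, p₁ i hi hid]⟩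
  | ite c s t ihs iht =>
    intro d hd hs σ st h
    simp only [wf, Bool.and_eq_true] at hs
    obtain ⟨m₁, τ₁, r₁, t₁, v₁, e₁, p₁⟩ := c.comp_runs' hg hd hs.1.1 h
    by_cases hc : c.eval st.1 st.2 = 0
    · obtain ⟨m₂, τ₂, r₂, t₂, e₂, p₂⟩ := iht d hd hs.2 τ₁ _ e₁
      exact ⟨_, _, .seq r₁ (.cond_false (by rw [v₁, hc]) r₂), by simp only [time]; omega,
        by simpa [run, hc] using e₂, fun i hi hid => by rw [p₂ i hi hid, p₁ i hid]⟩
    · obtain ⟨m₂, τ₂, r₂, t₂, e₂, p₂⟩ := ihs d hd hs.1.2 τ₁ _ e₁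
      exact ⟨_, _, .seq r₁ (.cond_true (by rwa [v₁]) r₂), by simp only [time]; omega,
        by simpa [run, hc] using e₂, fun i hi hid => by rw [p₂ i hi hid, p₁ i hid]⟩
  | rep c s ih =>
    intro d hd hs σ st h
    simp only [wf, Bool.and_eq_true, decide_eq_true_eq] at hs
    have key : ∀ k (τ : Store) (tt : (ℕ → ℕ) × (ℕ → ℕ)), τ.reg d = k → τ.Represents D tt →
        s.time tt.1 = s.time st.1 →
        ∃ m υ, Runs (.loop d (.seq (s.comp (d + 1)) (.seq (.const (d + 1) 1)
          (.sub d d (d + 1))))) τ m υ ∧ m ≤ k * (s.time st.1 + 3) + 1 ∧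
          υ.Represents D (s.run^[k] tt) ∧ ∀ i, D ≤ i → i < d → υ.reg i = τ.reg i := by
      intro k
      induction k with
      | zero =>
        intro τ tt hk hr ht
        exact ⟨1, τ, .loop_done hk, by omega, hr, fun _ _ _ => rfl⟩
      | succ k ihk =>
        intro τ tt hk hr ht
        obtain ⟨m₁, τ₁, r₁, t₁, e₁, p₁⟩ := ih (d + 1) (by omega) hs.2 τ tt hr
        have hd₁ := p₁ d hd (by omega)
        obtain ⟨m₂, τ₂, r₂, t₂, e₂, p₂⟩ := ihk ((τ₁.setReg (d + 1) 1).setReg d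
          ((τ₁.setReg (d + 1) 1).reg d - (τ₁.setReg (d + 1) 1).reg (d + 1))) (s.run tt)
          (by simp; omega)
          ⟨fun i hi => by simp only [Store.setReg_reg]; rw [if_neg (by omega), if_neg (by omega),
            e₁.1 i hi], e₁.2⟩
          (by rw [← ht]; exact s.time_congr hs.2 fun i hi => s.run_of_lt hs.2 tt hi)
        refine ⟨_, _, .loop_step (by omega) (.seq r₁ (.seq (.const _ _ _) (.sub _ _ _ _))) r₂, ?_,
          e₂, fun i hi hid => ?_⟩
        · rw [Nat.succ_mul]; omega
        · rw [p₂ i hi hid]; simp only [Store.setReg_reg]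
          rw [if_neg (by omega), if_neg (by omega), p₁ i hi (by omega)]
    obtain ⟨m, υ, r, t, e, p⟩ := key (st.1 c) (σ.setReg d (σ.reg c)) st
      (by simp [h.1 c (by omega)])
      ⟨fun i hi => by simp only [Store.setReg_reg]; rw [if_neg (by omega), h.1 i hi], h.2⟩ rfl
    exact ⟨_, υ, .seq (.copy _ _ _) r, by simp only [time]; omega, e,
      fun i hi hid => by rw [p i hi hid]; simp only [Store.setReg_reg]; rw [if_neg (by omega)]⟩

/-! ### Derived expressions and time bounds -/

namespace Expr

/-- The register `a` does not occur in the expression. -/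
def fresh (a : ℕ) : Expr → Bool
  | var i => i ≠ a
  | num _ => true
  | add e f => e.fresh a && f.fresh a
  | sub e f => e.fresh a && f.fresh a
  | load e => e.fresh a
  | ite c e f => c.fresh a && e.fresh a && f.fresh a
  | letE v e f => decide (v ≠ a) && e.fresh a && f.fresh a
  | fold i b c init body => decide (i ≠ a) && decide (b ≠ a) && decide (c ≠ a) &&
      init.fresh a && body.fresh a

theorem eval_update_of_fresh {a : ℕ} (e : Expr) (he : e.fresh a = true) (ρ μ : ℕ → ℕ) (x : ℕ) :
    e.eval (update ρ a x) μ = e.eval ρ μ := by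
  induction e generalizing ρ with
  | var i => simp only [fresh, decide_eq_true_eq] at he; simp [eval, he]
  | num c => rfl
  | add e f ihe ihf | sub e f ihe ihf =>
    simp only [fresh, Bool.and_eq_true] at he
    simp only [eval, ihe he.1, ihf he.2]
  | load e ihe => simp only [eval, ihe he]
  | ite c e f ihc ihe ihf =>
    simp only [fresh, Bool.and_eq_true] at he
    simp only [eval, ihc he.1.1, ihe he.1.2, ihf he.2]
  | letE v e f ihe ihf =>
    simp only [fresh, Bool.and_eq_true, decide_eq_true_eq] at he
    simp only [eval, ihe he.1.2, update_comm (Ne.symm he.1.1), ihf he.2]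
  | fold i b c init body ihi ihb =>
    simp only [fresh, Bool.and_eq_true, decide_eq_true_eq] at he
    obtain ⟨⟨⟨⟨hi, hb⟩, hc⟩, h1⟩, h2⟩ := he
    simp only [eval, ihi h1, update_of_ne hc]
    congr 1
    funext j s
    rw [update_comm (Ne.symm hi), update_comm (Ne.symm hb), ihb h2]

/-- The sum of `body` over the values of register `i` below the value of register `c`; register
`i + 20` is the accumulator. -/
def sum (i c : ℕ) (body : Expr) : Expr := fold i (i + 20) c (num 0) (add (var (i + 20)) body)

/-- The maximum of `body` over the values of register `i` below the value of register `c`; register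
`i + 20` is the accumulator. -/
def sup (i c : ℕ) (body : Expr) : Expr :=
  fold i (i + 20) c (num 0) (ite (sub body (var (i + 20))) body (var (i + 20)))

theorem eval_sum {i c : ℕ} {body : Expr} (h : body.fresh (i + 20) = true) (ρ μ : ℕ → ℕ) :
    (sum i c body).eval ρ μ = ∑ j ∈ Finset.range (ρ c), body.eval (update ρ i j) μ := by
  simp only [sum, eval]
  generalize ρ c = k
  induction k with
  | zero => rfl
  | succ k ih => rw [Finset.sum_range_succ, ← ih]; simp [eval_update_of_fresh body h]

theorem eval_sup {i c : ℕ} {body : Expr} (h : body.fresh (i + 20) = true) (ρ μ : ℕ → ℕ) :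
    (sup i c body).eval ρ μ = (Finset.range (ρ c)).sup fun j => body.eval (update ρ i j) μ := by
  simp only [sup, eval]
  generalize ρ c = k
  induction k with
  | zero => rfl
  | succ k ih =>
    rw [Finset.range_add_one, Finset.sup_insert, ← ih]
    simp only [eval_update_of_fresh body h, update_self]
    generalize body.eval (update ρ i k) μ = x
    generalize (Nat.rec 0 _ k : ℕ) = y
    show _ = max x y
    split_ifs with h' <;> omega

/-- All loop counts of the expression sit in registers below `b`. -/
def countsLT (b : ℕ) : Expr → Bool
  | var _ => true
  | num _ => true
  | add e f => e.countsLT b && f.countsLT b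
  | sub e f => e.countsLT b && f.countsLT b
  | load e => e.countsLT b
  | ite c e f => c.countsLT b && e.countsLT b && f.countsLT b
  | letE _ e f => e.countsLT b && f.countsLT b
  | fold _ _ c init body => decide (c < b) && init.countsLT b && body.countsLT b

theorem add_le_mul_pow {M c₁ d₁ c₂ d₂ x y : ℕ} (hM : 1 ≤ M) (hx : x ≤ c₁ * M ^ d₁)
    (hy : y ≤ c₂ * M ^ d₂) : x + y ≤ (c₁ + c₂) * M ^ (d₁ + d₂) := by
  have h1 : M ^ d₁ ≤ M ^ (d₁ + d₂) := Nat.pow_le_pow_right hM (by omega)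
  have h2 : M ^ d₂ ≤ M ^ (d₁ + d₂) := Nat.pow_le_pow_right hM (by omega)
  rw [Nat.add_mul]
  exact Nat.add_le_add (hx.trans (Nat.mul_le_mul_left _ h1))
    (hy.trans (Nat.mul_le_mul_left _ h2))

/-- If all loop counts are at most `M`, the running time is polynomial in `M`. -/
theorem exists_time_le {b : ℕ} (e : Expr) (he : e.countsLT b = true) :
    ∃ c d : ℕ, ∀ (ρ : ℕ → ℕ) (M : ℕ), 1 ≤ M → (∀ i < b, ρ i ≤ M) → e.time ρ ≤ c * M ^ d := by
  have const : ∀ {M : ℕ} (a : ℕ), 1 ≤ M → a ≤ a * M ^ 0 := fun a _ => by simp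
  induction e with
  | var i => exact ⟨1, 0, fun ρ M hM h => by simp [time]⟩
  | num c => exact ⟨1, 0, fun ρ M hM h => by simp [time]⟩
  | add e f ihe ihf | sub e f ihe ihf =>
    simp only [countsLT, Bool.and_eq_true] at he
    obtain ⟨c₁, d₁, h₁⟩ := ihe he.1
    obtain ⟨c₂, d₂, h₂⟩ := ihf he.2
    exact ⟨_, _, fun ρ M hM h => add_le_mul_pow hM (add_le_mul_pow hM (h₁ ρ M hM h)
      (h₂ ρ M hM h)) (const 1 hM)⟩
  | load e ihe =>
    obtain ⟨c₁, d₁, h₁⟩ := ihe he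
    exact ⟨_, _, fun ρ M hM h => add_le_mul_pow hM (h₁ ρ M hM h) (const 1 hM)⟩
  | ite c e f ihc ihe ihf =>
    simp only [countsLT, Bool.and_eq_true] at he
    obtain ⟨c₀, d₀, h₀⟩ := ihc he.1.1
    obtain ⟨c₁, d₁, h₁⟩ := ihe he.1.2
    obtain ⟨c₂, d₂, h₂⟩ := ihf he.2
    exact ⟨_, _, fun ρ M hM h => add_le_mul_pow hM (add_le_mul_pow hM (add_le_mul_pow hM
      (h₀ ρ M hM h) (h₁ ρ M hM h))
      (h₂ ρ M hM h)) (const 1 hM)⟩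
  | letE v e f ihe ihf =>
    simp only [countsLT, Bool.and_eq_true] at he
    obtain ⟨c₁, d₁, h₁⟩ := ihe he.1
    obtain ⟨c₂, d₂, h₂⟩ := ihf he.2
    exact ⟨_, _, fun ρ M hM h => add_le_mul_pow hM (add_le_mul_pow hM (h₁ ρ M hM h)
      (h₂ ρ M hM h)) (const 4 hM)⟩
  | fold i a c init body ihi ihb =>
    simp only [countsLT, Bool.and_eq_true, decide_eq_true_eq] at he
    obtain ⟨c₁, d₁, h₁⟩ := ihi he.1.2
    obtain ⟨c₂, d₂, h₂⟩ := ihb he.2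
    refine ⟨_, _, fun ρ M hM h => add_le_mul_pow hM (add_le_mul_pow hM (h₁ ρ M hM h)
      (c₂ := c₂ + 5) (d₂ := d₂ + 0 + 1) ?_) (const 9 hM)⟩
    rw [pow_succ, ← mul_assoc, mul_comm]
    exact Nat.mul_le_mul (add_le_mul_pow hM (h₂ ρ M hM h) (const 5 hM)) (h c he.1.1)

end Expr

end MatchingMulticut

namespace MatchingMulticut

open Function Finset

/-! ### Partial multicuts and how they glue -/

section gluing

variable {V : Type*} (G : SimpleGraph V) [DecidableRel G.Adj]

/-- The number of neighbours of `u` inside `S` whose label under `h` differs from that of `u`. -/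
def cutDeg (h : V → ℕ) (S : Finset V) (u : V) : ℕ :=
  #{w ∈ S | G.Adj u w ∧ h u ≠ h w}

variable {G}

theorem cutDeg_congr {h h' : V → ℕ} {S : Finset V} {u : V}
    (e : ∀ w ∈ S, G.Adj u w → (h u ≠ h w ↔ h' u ≠ h' w)) : cutDeg G h S u = cutDeg G h' S u := by
  unfold cutDeg
  congr 1
  ext w
  simp only [mem_filter]
  constructor
  · rintro ⟨a, b, c⟩; exact ⟨a, b, (e w a b).1 c⟩
  · rintro ⟨a, b, c⟩; exact ⟨a, b, (e w a b).2 c⟩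

theorem cutDeg_of_subset {h : V → ℕ} {S S' : Finset V} (hS : S ⊆ S') {u : V}
    (e : ∀ w ∈ S', G.Adj u w → w ∈ S) : cutDeg G h S' u = cutDeg G h S u := by
  unfold cutDeg
  congr 1
  ext w
  simp only [mem_filter]
  constructor
  · rintro ⟨a, b, c⟩; exact ⟨e w a b, b, c⟩
  · rintro ⟨a, b, c⟩; exact ⟨hS a, b, c⟩

variable [DecidableEq V]

variable (G)

/-- A partial multicut of `G[U]` with boundary `X`: there is a labelling of the vertices (its parts
are the label classes) that is `f` on `X`, in which every vertex of `U \ X` has at most one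
neighbour in `U` outside its part, every `u ∈ X` has exactly `d u` neighbours in `U \ X` outside
its part, and exactly `m` parts do not meet `X`. -/
def PartialMulticut (U X : Finset V) (f d : V → ℕ) (m : ℕ) : Prop :=
  ∃ h : V → ℕ, (∀ v ∈ X, h v = f v) ∧ (∀ u ∈ U \ X, cutDeg G h U u ≤ 1) ∧
    (∀ u ∈ X, cutDeg G h (U \ X) u = d u) ∧ #(U.image h \ X.image h) = m

/-- The compatibility of boundary data `(fy, dy)` on the bag `Y` with `(fz, dz)` on the bag `X` when
the part of the graph behind `Y` is merged into the part behind `X`; the result has boundary data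
`(fx, dx)`. The vertices of `Y \ X` become interior. -/
structure Glues (Y X : Finset V) (fx dx fy dy fz dz : V → ℕ) : Prop where
  colour : ∀ v ∈ X, fx v = fz v
  colour_inter : ∀ v ∈ X, v ∈ Y → fy v = fx v
  forgotten : ∀ v ∈ Y, v ∉ X → dy v + cutDeg G fy Y v ≤ 1
  degree : ∀ v ∈ X, dx v = dz v + if v ∈ Y then dy v + cutDeg G fy (Y \ X) v else 0

/-- The number of parts that meet `Y` but not `X ∩ Y`. -/
def closedParts (Y X : Finset V) (fy : V → ℕ) : ℕ := #(Y.image fy \ (Y ∩ X).image fy)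

variable {G}

theorem cutDeg_union {h : V → ℕ} {S S' : Finset V} (hS : Disjoint S S') (u : V) :
    cutDeg G h (S ∪ S') u = cutDeg G h S u + cutDeg G h S' u := by
  unfold cutDeg
  rw [filter_union, card_union_of_disjoint (disjoint_filter_filter hS)]

/-- Two vertex sets with bags `Y ⊆ A` and `X ⊆ B` such that the part behind `Y` touches the rest
only in `Y ∩ X`. -/
structure Separates (G : SimpleGraph V) (A Y B X : Finset V) : Prop where
  left : Y ⊆ A
  right : X ⊆ B
  inter : ∀ v ∈ A, v ∈ B → v ∈ Y ∧ v ∈ X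
  edge : ∀ u ∈ A, ∀ w ∈ B, G.Adj u w → (u ∈ Y ∧ u ∈ X) ∨ (w ∈ Y ∧ w ∈ X)

variable {A Y B X : Finset V}

/-- How the number of cut edges from a boundary vertex to the interior is composed: besides the
interiors of the two sides, the vertices of `Y \ X` become interior. -/
theorem Separates.cutDeg_boundary (hs : Separates G A Y B X) (h : V → ℕ) {u : V} (hu : u ∈ X) :
    cutDeg G h ((A ∪ B) \ X) u = cutDeg G h (B \ X) u +
      if u ∈ Y then cutDeg G h (A \ Y) u + cutDeg G h (Y \ X) u else 0 := by
  have e : (A ∪ B) \ X = (B \ X) ∪ ((A \ Y) ∪ (Y \ X)) := by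
    ext v
    have := hs.inter v
    have := @hs.left v
    have := @hs.right v
    simp only [mem_sdiff, mem_union]
    tauto
  have d1 : Disjoint (B \ X) ((A \ Y) ∪ (Y \ X)) := by
    rw [disjoint_left]
    intro v
    have := hs.inter v
    have := @hs.left v
    simp only [mem_sdiff, mem_union]
    tauto
  have d2 : Disjoint (A \ Y) (Y \ X) := by
    rw [disjoint_left]
    intro v
    simp only [mem_sdiff]
    tauto
  rw [e, cutDeg_union d1, cutDeg_union d2]
  split_ifs with huY
  · rfl
  · have : cutDeg G h (A \ Y ∪ Y \ X) u = 0 := by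
      rw [cutDeg_of_subset (empty_subset _)]
      · simp [cutDeg]
      · intro w hw hadj
        have h1 := hs.edge w (by
          have := @hs.left w
          simp only [mem_sdiff, mem_union] at hw; tauto) u (hs.right hu) hadj.symm
        simp only [mem_sdiff, mem_union] at hw
        tauto
    rw [← cutDeg_union d2, this]

theorem Separates.cutDeg_left (hs : Separates G A Y B X) (h : V → ℕ) {u : V} (hu : u ∈ A)
    (huX : u ∉ X) : cutDeg G h (A ∪ B) u = cutDeg G h A u :=
  cutDeg_of_subset subset_union_left fun w hw hadj => by
    have := hs.edge u hu w
    have := @hs.left w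
    simp only [mem_union] at hw
    tauto

theorem Separates.cutDeg_right (hs : Separates G A Y B X) (h : V → ℕ) {u : V} (hu : u ∈ B)
    (huX : u ∉ X) : cutDeg G h (A ∪ B) u = cutDeg G h B u :=
  cutDeg_of_subset subset_union_right fun w hw hadj => by
    have h1 := hs.edge w
    have := @hs.right w
    simp only [mem_union] at hw
    rcases hw with hw | hw
    · have := h1 hw u hu hadj.symm
      tauto
    · exact hw

theorem cutDeg_add_boundary (hY : Y ⊆ A) (h : V → ℕ) (u : V) :
    cutDeg G h A u = cutDeg G h (A \ Y) u + cutDeg G h Y u := by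
  rw [← cutDeg_union sdiff_disjoint, sdiff_union_of_subset hY]

/-- An injection of the labels that fixes those in `F` and sends the others to numbers that are
above `M` and congruent to `e` modulo `2`. -/
def spread (F : Finset ℕ) (M e c : ℕ) : ℕ := if c ∈ F then c else 2 * (M + c) + e

theorem spread_injective {F : Finset ℕ} {M : ℕ} (hF : ∀ c ∈ F, c < M) (e : ℕ) :
    Injective (spread F M e) := by
  intro a b hab
  simp only [spread] at hab
  split_ifs at hab with ha hb hb
  · exact hab
  · have := hF a ha; omega
  · have := hF b hb; omega
  · omega

/-- Gluing two partial multicuts along compatible boundary data. Labels that do not occur on the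
common boundary are renamed apart. -/
theorem PartialMulticut.glue (hs : Separates G A Y B X) {fx dx fy dy fz dz : V → ℕ} {my mz : ℕ}
    (hy : PartialMulticut G A Y fy dy my) (hz : PartialMulticut G B X fz dz mz)
    (hg : Glues G Y X fx dx fy dy fz dz) :
    PartialMulticut G (A ∪ B) X fx dx (my + mz + closedParts Y X fy) := by
  obtain ⟨a, ha1, ha2, ha3, ha4⟩ := hy
  obtain ⟨b, hb1, hb2, hb3, hb4⟩ := hz
  -- labels off the common boundary become odd on the side of `A` and even on the side of `B`
  set FA := (Y ∩ X).image a with hFA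
  set FB := X.image b with hFB
  obtain ⟨M, hM⟩ : ∃ M, ∀ c ∈ FA ∪ FB, c < M :=
    ⟨(FA ∪ FB).sup id + 1, fun c hc => Nat.lt_succ_of_le (le_sup (f := id) hc)⟩
  have iA := spread_injective (F := FA) (M := M) (fun c hc => hM c (mem_union_left _ hc)) 1
  have iB := spread_injective (F := FB) (M := M) (fun c hc => hM c (mem_union_right _ hc)) 0
  set h : V → ℕ := fun v => if v ∈ B then spread FB M 0 (b v) else spread FA M 1 (a v) with hh
  have agree : ∀ v ∈ Y, v ∈ X → a v = b v := fun v hvY hvX => by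
    rw [ha1 v hvY, hb1 v hvX, hg.colour_inter v hvX hvY, hg.colour v hvX]
  have hX : ∀ v ∈ X, h v = b v := fun v hv => by
    simp only [hh, if_pos (hs.right hv), spread, if_pos (mem_image_of_mem b hv), hFB]
  have hB : ∀ v ∈ B, h v = spread FB M 0 (b v) := fun v hv => if_pos hv
  have hA : ∀ v ∈ A, h v = spread FA M 1 (a v) := fun v hv => by
    by_cases hvB : v ∈ B
    · obtain ⟨hvY, hvX⟩ := hs.inter v hv hvB
      rw [hX v hvX, spread, if_pos (mem_image_of_mem a (mem_inter.2 ⟨hvY, hvX⟩)), agree v hvY hvX]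
    · exact if_neg hvB
  have cA : ∀ S ⊆ A, ∀ u ∈ A, cutDeg G h S u = cutDeg G a S u := fun S hS u hu =>
    cutDeg_congr fun w hw _ => by rw [hA u hu, hA w (hS hw), iA.ne_iff]
  have cB : ∀ S ⊆ B, ∀ u ∈ B, cutDeg G h S u = cutDeg G b S u := fun S hS u hu =>
    cutDeg_congr fun w hw _ => by rw [hB u hu, hB w (hS hw), iB.ne_iff]
  have cY : ∀ S ⊆ Y, ∀ u ∈ Y, cutDeg G a S u = cutDeg G fy S u := fun S hS u hu =>
    cutDeg_congr fun w hw _ => by rw [ha1 u hu, ha1 w (hS hw)]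
  refine ⟨h, fun v hv => ?_, fun u hu => ?_, fun u hu => ?_, ?_⟩
  · rw [hX v hv, hb1 v hv, hg.colour v hv]
  · simp only [mem_sdiff, mem_union] at hu
    obtain ⟨hu | hu, huX⟩ := hu
    · rw [hs.cutDeg_left h hu huX, cA A subset_rfl u hu]
      by_cases huY : u ∈ Y
      · rw [cutDeg_add_boundary hs.left, ha3 u huY, cY Y subset_rfl u huY]
        exact hg.forgotten u huY huX
      · exact ha2 u (mem_sdiff.2 ⟨hu, huY⟩)
    · rw [hs.cutDeg_right h hu huX, cB B subset_rfl u hu]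
      exact hb2 u (mem_sdiff.2 ⟨hu, huX⟩)
  · rw [hs.cutDeg_boundary h hu, hg.degree u hu, cB _ sdiff_subset u (hs.right hu), hb3 u hu]
    split_ifs with huY
    · rw [cA _ sdiff_subset u (hs.left huY), ha3 u huY,
        cA _ (sdiff_subset.trans hs.left) u (hs.left huY), cY _ sdiff_subset u huY]
    · rfl
  · have e : (A ∪ B).image h \ X.image h =
        (A.image a \ FA).image (spread FA M 1) ∪ (B.image b \ FB).image (spread FB M 0) := by
      have hXi : X.image h = FB := image_congr hX
      rw [hXi, image_union, union_sdiff_distrib]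
      congr 1
      · ext c
        simp only [mem_sdiff, mem_image]
        constructor
        · rintro ⟨⟨v, hv, rfl⟩, hc⟩
          refine ⟨a v, ⟨⟨v, hv, rfl⟩, fun hav => hc ?_⟩, (hA v hv).symm⟩
          rw [hA v hv, spread, if_pos hav]
          obtain ⟨w, hw, hwv⟩ := mem_image.1 hav
          rw [mem_inter] at hw
          rw [← hwv, agree w hw.1 hw.2]
          exact mem_image_of_mem b hw.2
        · rintro ⟨c', ⟨⟨v, hv, rfl⟩, hc⟩, rfl⟩
          refine ⟨⟨v, hv, hA v hv⟩, fun hc' => ?_⟩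
          have := hM _ (mem_union_right FA hc')
          rw [spread, if_neg hc] at this
          omega
      · ext c
        simp only [mem_sdiff, mem_image]
        constructor
        · rintro ⟨⟨v, hv, rfl⟩, hc⟩
          refine ⟨b v, ⟨⟨v, hv, rfl⟩, fun hbv => hc ?_⟩, (hB v hv).symm⟩
          rwa [hB v hv, spread, if_pos hbv]
        · rintro ⟨c', ⟨⟨v, hv, rfl⟩, hc⟩, rfl⟩
          refine ⟨⟨v, hv, hB v hv⟩, fun hc' => ?_⟩
          have := hM _ (mem_union_right FA hc')
          rw [spread, if_neg hc] at this
          omega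
    rw [e, card_union_of_disjoint, card_image_of_injective _ iA, card_image_of_injective _ iB, hb4]
    · have e2 : A.image a \ FA = (A.image a \ Y.image a) ∪ (Y.image a \ FA) := by
        have h1 : Y.image a ⊆ A.image a := image_subset_image hs.left
        have h2 : FA ⊆ Y.image a := image_subset_image inter_subset_left
        ext c
        have := @h1 c
        have := @h2 c
        simp only [mem_sdiff, mem_union]
        tauto
      have e3 : #(Y.image a \ FA) = closedParts Y X fy := by
        rw [closedParts, hFA, image_congr (g := fy) (s := Y) fun v hv => ha1 v hv,
          image_congr (g := fy) (s := Y ∩ X) fun v hv => ha1 v (mem_inter.1 hv).1]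
      rw [e2, card_union_of_disjoint, ha4, e3]
      · omega
      · rw [disjoint_left]
        intro c
        simp only [mem_sdiff]
        tauto
    · rw [disjoint_left]
      intro c hc hc'
      obtain ⟨c₁, h₁, rfl⟩ := mem_image.1 hc
      obtain ⟨c₂, h₂, h₃⟩ := mem_image.1 hc'
      rw [spread, spread, if_neg (mem_sdiff.1 h₁).2, if_neg (mem_sdiff.1 h₂).2] at h₃
      omega

/-- Finitely many labels `L` can be renamed to numbers below `K`, if they are at most `K` many, in
such a way that a given set `F` of labels below `K` is fixed. -/
theorem exists_rename {F L : Finset ℕ} {K : ℕ} (hFL : F ⊆ L) (hF : ∀ c ∈ F, c < K) (hL : #L ≤ K) :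
    ∃ π : ℕ → ℕ, Injective π ∧ (∀ c ∈ F, π c = c) ∧ ∀ c ∈ L, π c < K := by
  have hF' : F ⊆ range K := fun c hc => mem_range.2 (hF c hc)
  have hc : ((L \ F : Finset ℕ) : Set ℕ).encard ≤ ((range K \ F : Finset ℕ) : Set ℕ).encard := by
    rw [Set.encard_coe_eq_coe_finsetCard, Set.encard_coe_eq_coe_finsetCard,
      card_sdiff_of_subset hFL, card_sdiff_of_subset hF', card_range]
    exact_mod_cast Nat.sub_le_sub_right hL _
  obtain ⟨g, hg1, hg2⟩ := (finite_toSet (L \ F)).exists_injOn_of_encard_le hc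
  have hg : ∀ c ∈ L, c ∉ F → g c < K ∧ g c ∉ F := fun c h1 h2 => by
    have : g c ∈ range K \ F := hg1 (mem_coe.2 (mem_sdiff.2 ⟨h1, h2⟩))
    simpa using this
  have hgi : ∀ c ∈ L, c ∉ F → ∀ c' ∈ L, c' ∉ F → g c = g c' → c = c' := fun c h1 h2 c' h1' h2' h =>
    hg2 (mem_coe.2 (mem_sdiff.2 ⟨h1, h2⟩)) (mem_coe.2 (mem_sdiff.2 ⟨h1', h2'⟩)) h
  refine ⟨fun c => if c ∈ F then c else if c ∈ L then g c else K + c, ?_, ?_, ?_⟩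
  · intro c c' h
    have := hF c
    have := hF c'
    have := hg c
    have := hg c'
    have := hgi c
    simp only at h
    split_ifs at h <;> grind
  · intro c hc
    exact if_pos hc
  · intro c hc
    simp only [if_pos hc]
    split_ifs with h
    · exact hF c h
    · exact (hg c hc h).1

/-- A partial multicut of a glued graph arises by gluing, with labels below `K` on the bags. The
inequality accounts for parts that meet both sides, but not in the boundary. -/
theorem PartialMulticut.split (hs : Separates G A Y B X) {fx dx : V → ℕ} {m K : ℕ}
    (hx : PartialMulticut G (A ∪ B) X fx dx m) (hK : ∀ v ∈ X, fx v < K) (hY : #Y ≤ K) :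
    ∃ (fy dy dz : V → ℕ) (my mz : ℕ), PartialMulticut G A Y fy dy my ∧
      PartialMulticut G B X fx dz mz ∧ Glues G Y X fx dx fy dy fx dz ∧
      m ≤ my + mz + closedParts Y X fy ∧ (∀ v ∈ Y, fy v < K) ∧
      (∀ v ∈ Y, dy v ≤ 1 ∨ v ∈ X ∧ dy v ≤ dx v) ∧ ∀ v ∈ X, dz v ≤ dx v := by
  obtain ⟨h, h1, h2, h3, h4⟩ := hx
  obtain ⟨π, iπ, fπ, rπ⟩ := exists_rename (F := (Y ∩ X).image h) (L := Y.image h) (K := K)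
    (image_subset_image inter_subset_left) (fun c hc => by
      obtain ⟨v, hv, rfl⟩ := mem_image.1 hc
      rw [h1 v (mem_inter.1 hv).2]; exact hK v (mem_inter.1 hv).2) (card_image_le.trans hY)
  have cπ : ∀ S u, cutDeg G (fun v => π (h v)) S u = cutDeg G h S u := fun S u =>
    cutDeg_congr fun w _ _ => iπ.ne_iff
  have hd : ∀ v ∈ X, dx v = cutDeg G h (B \ X) v +
      if v ∈ Y then cutDeg G h (A \ Y) v + cutDeg G h (Y \ X) v else 0 := fun v hv => by
    rw [← hs.cutDeg_boundary h hv, h3 v hv]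
  have forg : ∀ v ∈ Y, v ∉ X → cutDeg G h (A \ Y) v + cutDeg G h Y v ≤ 1 := fun v hv hvX => by
    rw [← cutDeg_add_boundary hs.left, ← hs.cutDeg_left h (hs.left hv) hvX]
    exact h2 v (mem_sdiff.2 ⟨mem_union_left _ (hs.left hv), hvX⟩)
  refine ⟨fun v => π (h v), cutDeg G h (A \ Y), cutDeg G h (B \ X),
    #(A.image (fun v => π (h v)) \ Y.image fun v => π (h v)), #(B.image h \ X.image h),
    ⟨fun v => π (h v), fun _ _ => rfl, fun u hu => ?_, fun u _ => cπ _ u, rfl⟩,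
    ⟨h, h1, fun u hu => ?_, fun _ _ => rfl, rfl⟩, ⟨fun _ _ => rfl, fun v hvX hvY => ?_,
      fun v hv hvX => ?_, fun v hv => ?_⟩, ?_, fun v hv => rπ _ (mem_image_of_mem h hv),
      fun v hv => ?_, fun v hv => ?_⟩
  · rw [cπ]
    rw [mem_sdiff] at hu
    have huX : u ∉ X := fun hX => hu.2 (hs.inter u hu.1 (hs.right hX)).1
    rw [← hs.cutDeg_left h hu.1 huX]
    exact h2 u (mem_sdiff.2 ⟨mem_union_left _ hu.1, huX⟩)
  · rw [mem_sdiff] at hu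
    rw [← hs.cutDeg_right h hu.1 hu.2]
    exact h2 u (mem_sdiff.2 ⟨mem_union_right _ hu.1, hu.2⟩)
  · rw [fπ _ (mem_image_of_mem h (mem_inter.2 ⟨hvY, hvX⟩)), h1 v hvX]
  · rw [cπ]; exact forg v hv hvX
  · rw [cπ]; exact hd v hv
  · rw [← h4]
    have e1 : ∀ S : Finset V, S.image (fun v => π (h v)) = (S.image h).image π := fun S => by
      rw [image_image]; rfl
    rw [closedParts, e1, e1, e1, ← image_sdiff _ _ iπ, ← image_sdiff _ _ iπ,
      card_image_of_injective _ iπ, card_image_of_injective _ iπ]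
    refine le_trans (card_le_card (t := (A.image h \ Y.image h ∪ B.image h \ X.image h) ∪
      (Y.image h \ (Y ∩ X).image h)) ?_) ((card_union_le _ _).trans
        (Nat.add_le_add_right (card_union_le _ _) _))
    intro c
    have : c ∈ (Y ∩ X).image h → c ∈ X.image h :=
      fun hc => image_subset_image inter_subset_right hc
    simp only [image_union, mem_sdiff, mem_union]
    tauto
  · by_cases hvX : v ∈ X
    · refine Or.inr ⟨hvX, ?_⟩
      rw [hd v hvX, if_pos hv]
      omega
    · exact Or.inl ((Nat.le_add_right _ _).trans (forg v hv hvX))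
  · rw [hd v hv]
    exact Nat.le_add_right _ _

/-- Without interior vertices, all boundary data with zero degrees are feasible. -/
theorem partialMulticut_self {f d : V → ℕ} {m : ℕ} :
    PartialMulticut G X X f d m ↔ m = 0 ∧ ∀ v ∈ X, d v = 0 := by
  constructor
  · rintro ⟨h, h1, h2, h3, h4⟩
    exact ⟨by simpa using h4.symm, fun v hv => by rw [← h3 v hv]; simp [cutDeg]⟩
  · rintro ⟨rfl, hd⟩
    exact ⟨f, fun _ _ => rfl, by simp, fun u hu => by simp [cutDeg, hd u hu], by simp⟩

end gluing

section whole

variable {V : Type*} [Fintype V] [DecidableEq V] {G : SimpleGraph V} [DecidableRel G.Adj]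

/-- Partial multicuts with empty boundary that cover the whole graph are matching multicuts. -/
theorem partialMulticut_univ {f d : V → ℕ} {m : ℕ} :
    PartialMulticut G univ ∅ f d m ↔ m ∈ partCounts G := by
  have key : ∀ (P : Finpartition (univ : Finset V)) (h : V → ℕ),
      (∀ A ∈ P.parts, ∀ v ∈ A, ∀ w, h v = h w ↔ w ∈ A) →
      ((∀ u, cutDeg G h univ u ≤ 1) ↔ IsMatchingMulticut G P) ∧
        #(univ.image h) = #P.parts := by
    intro P h hP
    constructor
    · have e : ∀ A ∈ P.parts, ∀ v ∈ A, (G.neighborSet v \ (A : Set V)).ncard =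
          cutDeg G h univ v := fun A hA v hv => by
        rw [cutDeg, ← Set.ncard_coe_finset]
        congr 1
        ext w
        simp [hP A hA v hv w]
      constructor
      · intro hu A hA v hv
        rw [e A hA v hv]
        exact hu v
      · intro hm u
        obtain ⟨A, hA, hu⟩ := P.exists_mem (mem_univ u)
        rw [← e A hA u hu]
        exact hm A hA u hu
    · have e : P.parts = (univ.image h).image fun c => univ.filter fun w => h w = c := by
        ext A
        simp only [mem_image, mem_univ, true_and, exists_exists_eq_and]
        constructor
        · intro hA
          obtain ⟨v, hv⟩ := P.nonempty_of_mem_parts hA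
          exact ⟨v, by ext w; simp [← hP A hA v hv w, eq_comm]⟩
        · rintro ⟨v, rfl⟩
          obtain ⟨A, hA, hv⟩ := P.exists_mem (mem_univ v)
          convert hA using 1
          ext w; simp [← hP A hA v hv w, eq_comm]
      rw [e]
      refine (card_image_of_injOn ?_).symm
      intro c hc c' _ hcc
      obtain ⟨v, _, rfl⟩ := mem_image.1 hc
      have : v ∈ univ.filter fun w => h w = c' := by
        rw [← show _ = univ.filter fun w => h w = c' from hcc]; simp
      simpa using this
  constructor
  -- a labelling gives the partition into label classes; a partition is labelled by numbering its
  -- parts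
  · rintro ⟨h, -, h2, -, h4⟩
    classical
    have hP : ∀ A ∈ (Finpartition.ofSetoid (Setoid.ker h)).parts, ∀ v ∈ A, ∀ w,
        h v = h w ↔ w ∈ A := fun A hA v hv w => by
      rw [← Finpartition.part_eq_of_mem _ hA hv, Finpartition.mem_part_ofSetoid_iff_rel]
      rfl
    obtain ⟨k1, k2⟩ := key _ h hP
    exact ⟨_, k1.1 fun u => by simpa using h2 u (by simp), by rw [← k2, ← h4]; simp⟩
  · rintro ⟨P, hm, rfl⟩
    have hP : ∀ A ∈ P.parts, ∀ v ∈ A, ∀ w, ((Fintype.equivFin (Finset V) (P.part v) : Fin _) : ℕ) =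
        (Fintype.equivFin (Finset V) (P.part w) : Fin _) ↔ w ∈ A := fun A hA v hv w => by
      rw [Fin.val_inj, (Fintype.equivFin (Finset V)).injective.eq_iff, P.part_eq_of_mem hA hv,
        eq_comm, P.part_eq_iff_mem hA]
    obtain ⟨k1, k2⟩ := key P (fun v => (Fintype.equivFin (Finset V) (P.part v) : Fin _)) hP
    exact ⟨_, by simp, fun u _ => k1.2 hm u, by simp, by rw [← k2]; simp⟩

end whole

end MatchingMulticut

namespace MatchingMulticut

open Function Finset

/-! ### Contracting a rooted tree decomposition -/

section tree

variable {V I : Type*} {G : SimpleGraph V} {T : SimpleGraph I} {r : I} {X : I → Finset V}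
  {par : I → I}

/-- In a tree, a parent function reaches every edge. -/
theorem par_eq_or_par_eq_of_adj [Finite I] (hT : T.IsTree)
    (hpar : ∀ t, t ≠ r → IsChild T r (par t) t) {a b : I} (hab : T.Adj a b) :
    par a = b ∨ par b = a := by
  classical
  have := Fintype.ofFinite I
  have hsub : ((univ.erase r).image fun t => s(t, par t)) ⊆ T.edgeFinset := by
    intro e he
    obtain ⟨t, ht, rfl⟩ := mem_image.1 he
    rw [SimpleGraph.mem_edgeFinset, SimpleGraph.mem_edgeSet]
    exact (hpar t (ne_of_mem_erase ht)).1.symm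
  have hcard : #T.edgeFinset ≤ #((univ.erase r).image fun t => s(t, par t)) := by
    rw [card_image_of_injOn, card_erase_of_mem (mem_univ r), card_univ, ← hT.card_edgeFinset]
    · omega
    · intro t ht t' ht' h
      have h1 := (hpar t (ne_of_mem_erase ht)).2
      have h2 := (hpar t' (ne_of_mem_erase ht')).2
      rcases Sym2.eq_iff.1 h with h | h
      · exact h.1
      · rw [h.2] at h1; rw [← h.1] at h2; omega
  have he : s(a, b) ∈ (univ.erase r).image fun t => s(t, par t) := by
    rw [eq_of_subset_of_card_le hsub hcard, SimpleGraph.mem_edgeFinset]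
    exact hab
  obtain ⟨t, _, ht⟩ := mem_image.1 he
  rcases Sym2.eq_iff.1 ht with h | h
  · exact Or.inl (by rw [← h.1, h.2])
  · exact Or.inr (by rw [← h.1, h.2])

/-- If a vertex occurs both in a bag below `s` and in a bag not below `s`, it occurs in the bags of
`s` and of its parent. -/
theorem mem_bag_of_mem_of_mem [Finite I] (hX : IsTreeDecomposition G T X)
    (hpar : ∀ t, t ≠ r → IsChild T r (par t) t) {s a b : I} {v : V}
    (ha : ∃ i, par^[i] a = s) (hb : ¬ ∃ i, par^[i] b = s) (hva : v ∈ X a) (hvb : v ∈ X b) :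
    v ∈ X s ∧ v ∈ X (par s) := by
  obtain ⟨p⟩ := (hX.subtree v).preconnected ⟨a, hva⟩ ⟨b, hvb⟩
  obtain ⟨d, -, hd1, hd2⟩ := p.exists_boundary_dart {c | ∃ i, par^[i] (c : I) = s} ha hb
  obtain ⟨⟨⟨c, hc⟩, ⟨e, he⟩⟩, hadj⟩ := d
  simp only [Set.mem_ofPred_eq] at hd1 hd2 hc he
  have hadj' : T.Adj c e := hadj
  rcases par_eq_or_par_eq_of_adj hX.isTree hpar hadj' with h | h
  · obtain ⟨i, hi⟩ := hd1
    rcases i with _ | i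
    · obtain rfl : c = s := hi
      exact ⟨hc, h ▸ he⟩
    · rw [iterate_succ_apply, h] at hi
      exact absurd ⟨i, hi⟩ hd2
  · obtain ⟨i, hi⟩ := hd1
    exact absurd ⟨i + 1, by rw [iterate_succ_apply, h, hi]⟩ hd2

/-- The node `w` has been contracted into `t` if the path from `w` to `t` leads through nodes of the
set `P` of contracted nodes. -/
def ContractedTo (par : I → I) (P : Finset I) (t w : I) : Prop :=
  ∃ i, par^[i] w = t ∧ ∀ j < i, par^[j] w ∈ P

open Classical in
/-- The union of the bags that have been contracted into the bag of `t`. -/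
noncomputable def contractedBag [Fintype V] (X : I → Finset V) (par : I → I) (P : Finset I)
    (t : I) : Finset V :=
  univ.filter fun v => ∃ w, ContractedTo par P t w ∧ v ∈ X w

theorem mem_contractedBag [Fintype V] {P : Finset I} {t : I} {v : V} :
    v ∈ contractedBag X par P t ↔ ∃ w, ContractedTo par P t w ∧ v ∈ X w := by
  simp [contractedBag]

theorem contractedBag_empty [Fintype V] (t : I) : contractedBag X par ∅ t = X t := by
  ext v
  rw [mem_contractedBag]
  constructor
  · rintro ⟨w, ⟨i, hi, hP⟩, hv⟩
    rcases i with _ | i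
    · obtain rfl : w = t := hi
      exact hv
    · simpa using hP 0 (by omega)
  · exact fun hv => ⟨t, ⟨0, rfl, by simp⟩, hv⟩

theorem subset_contractedBag [Fintype V] (P : Finset I) (t : I) :
    X t ⊆ contractedBag X par P t :=
  fun _ hv => mem_contractedBag.2 ⟨t, ⟨0, rfl, by simp⟩, hv⟩

theorem contractedTo_insert [DecidableEq I] {P : Finset I} {s q w : I} (hs : par s ∉ insert s P) :
    ContractedTo par (insert s P) q w ↔
      ContractedTo par P q w ∨ (q = par s ∧ ContractedTo par P s w) := by
  constructor
  · rintro ⟨i, hi, hP⟩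
    by_cases h : ∃ j, j < i ∧ par^[j] w = s
    · obtain ⟨hj, hjs⟩ := Nat.find_spec h
      have hmin := fun {k} => @Nat.find_min _ _ h k
      set j := Nat.find h
      have hji : j + 1 = i := by
        by_contra hne
        refine hs ?_
        have := hP (j + 1) (by omega)
        rwa [iterate_succ_apply', hjs] at this
      refine Or.inr ⟨by rw [← hi, ← hji, iterate_succ_apply', hjs], j, hjs, fun k hk => ?_⟩
      refine (mem_insert.1 (hP k (by omega))).resolve_left fun hks => hmin hk ⟨by omega, hks⟩
    · exact Or.inl ⟨i, hi, fun j hj => (mem_insert.1 (hP j hj)).resolve_left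
        fun hjs => h ⟨j, hj, hjs⟩⟩
  · rintro (⟨i, hi, hP⟩ | ⟨rfl, i, hi, hP⟩)
    · exact ⟨i, hi, fun j hj => mem_insert_of_mem (hP j hj)⟩
    · refine ⟨i + 1, by rw [iterate_succ_apply', hi], fun j hj => ?_⟩
      rcases Nat.lt_succ_iff_lt_or_eq.1 hj with hj | rfl
      · exact mem_insert_of_mem (hP j hj)
      · rw [hi]; exact mem_insert_self _ _

theorem contractedBag_insert_par [Fintype V] [DecidableEq V] [DecidableEq I] {P : Finset I} {s : I}
    (hs : par s ∉ insert s P) : contractedBag X par (insert s P) (par s) =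
      contractedBag X par P s ∪ contractedBag X par P (par s) := by
  ext v
  simp only [mem_union, mem_contractedBag, contractedTo_insert hs, true_and]
  grind

theorem contractedBag_insert_of_ne [Fintype V] [DecidableEq I] {P : Finset I} {s q : I}
    (hs : par s ∉ insert s P) (hq : q ≠ par s) :
    contractedBag X par (insert s P) q = contractedBag X par P q := by
  ext v
  simp only [mem_contractedBag, contractedTo_insert hs, hq, false_and, or_false]

/-- The part of the graph contracted into `s` and the part contracted into the parent of `s` meet
only in the common vertices of the two bags. -/
theorem separates_contractedBag [Finite I] [Fintype V] [DecidableEq V]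
    (hX : IsTreeDecomposition G T X) (hpar : ∀ t, t ≠ r → IsChild T r (par t) t)
    (hr : par r = r) {P : Finset I} {s : I} (hs : s ∉ P) (hsr : s ≠ r) :
    Separates G (contractedBag X par P s) (X s) (contractedBag X par P (par s)) (X (par s)) := by
  have anti : ∀ i t, T.dist r (par^[i] t) ≤ T.dist r t := by
    intro i
    induction i with
    | zero => exact fun t => le_rfl
    | succ i ih =>
      intro t
      rw [iterate_succ_apply]
      refine (ih _).trans ?_
      by_cases ht : t = r
      · rw [ht, hr]
      · rw [(hpar t ht).2]; omega
  have below : ∀ {w}, ContractedTo par P s w → ∃ i, par^[i] w = s := fun ⟨i, hi, _⟩ => ⟨i, hi⟩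
  have above : ∀ {w}, ContractedTo par P (par s) w → ¬ ∃ i, par^[i] w = s := by
    rintro w ⟨i, hi, hP⟩ ⟨a, ha⟩
    rcases lt_or_ge a i with h | h
    · exact hs (ha ▸ hP a h)
    · have h1 : par^[a - i] (par s) = s := by
        rw [← hi, ← iterate_add_apply, Nat.sub_add_cancel h, ha]
      have := anti (a - i) (par s)
      rw [h1, (hpar s hsr).2] at this
      omega
  refine ⟨subset_contractedBag P s, subset_contractedBag P _, fun v hv hv' => ?_,
    fun u hu w hw hadj => ?_⟩
  · obtain ⟨a, ha, hva⟩ := mem_contractedBag.1 hv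
    obtain ⟨b, hb, hvb⟩ := mem_contractedBag.1 hv'
    exact mem_bag_of_mem_of_mem hX hpar (below ha) (above hb) hva hvb
  · obtain ⟨a, ha, hua⟩ := mem_contractedBag.1 hu
    obtain ⟨b, hb, hwb⟩ := mem_contractedBag.1 hw
    obtain ⟨c, huc, hwc⟩ := hX.edge_mem u w hadj
    by_cases hc : ∃ i, par^[i] c = s
    · exact Or.inr (mem_bag_of_mem_of_mem hX hpar hc (above hb) hwc hwb)
    · exact Or.inl (mem_bag_of_mem_of_mem hX hpar (below ha) hc hua huc)

/-- If all nodes but the root are contracted, the root carries the whole graph. -/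
theorem contractedBag_root [Fintype V] (hX : IsTreeDecomposition G T X)
    (hpar : ∀ t, t ≠ r → IsChild T r (par t) t) {P : Finset I} (hP : ∀ t, t ≠ r → t ∈ P) :
    contractedBag X par P r = univ := by
  have key : ∀ k w, T.dist r w = k → ContractedTo par P r w := by
    intro k
    induction k with
    | zero =>
      intro w hw
      obtain rfl : r = w := (hX.isTree.connected.dist_eq_zero_iff).1 hw
      exact ⟨0, rfl, by simp⟩
    | succ k ih =>
      intro w hw
      have hwr : w ≠ r := by rintro rfl; simp at hw
      obtain ⟨i, hi, hiP⟩ := ih (par w) (by have := (hpar w hwr).2; omega)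
      refine ⟨i + 1, hi, fun j hj => ?_⟩
      rcases j with _ | j
      · exact hP w hwr
      · exact hiP j (by omega)
  ext v
  obtain ⟨⟨w, hw⟩⟩ := (hX.subtree v).nonempty
  simp only [mem_univ, iff_true]
  exact mem_contractedBag.2 ⟨w, key _ w rfl, hw⟩

/-- If every node different from the root all of whose children lie in `P` itself lies in `P`, then
`P` contains all nodes but the root. -/
theorem mem_of_forall_children [Finite I] (hpar : ∀ t, t ≠ r → IsChild T r (par t) t)
    {P : Finset I} (hP : ∀ t, t ≠ r → (∀ s, s ≠ r → par s = t → s ∈ P) → t ∈ P) :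
    ∀ t, t ≠ r → t ∈ P := by
  classical
  have := Fintype.ofFinite I
  by_contra! h
  obtain ⟨t, ht, hmax⟩ := exists_max_image (univ.filter fun t => t ≠ r ∧ t ∉ P) (T.dist r)
    (by obtain ⟨t, ht⟩ := h; exact ⟨t, by simpa using ht⟩)
  simp only [mem_filter, mem_univ, true_and] at ht hmax
  refine ht.2 (hP t ht.1 fun s hs hst => ?_)
  by_contra hsP
  have := hmax s ⟨hs, hsP⟩
  have := (hpar s hs).2
  rw [hst] at this
  omega

end tree

end MatchingMulticut

namespace MatchingMulticut

open Function Finset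

/-! ### The expression for one table entry -/

namespace Expr

/-- `1` if the values are equal, `0` otherwise. -/
def eq (a b : Expr) : Expr := ite (add (sub a b) (sub b a)) (num 0) (num 1)

/-- Nonzero if and only if the values differ. -/
def neq (a b : Expr) : Expr := add (sub a b) (sub b a)

/-- The quotient of the registers `v` and `c`, by counting the positive multiples of the divisor up
to the dividend. -/
def div (v c : ℕ) : Expr :=
  sum 60 3 (ite (sub (sum 61 c (add (var 60) (num 1))) (var v)) (num 0) (num 1))

/-- The digit of the number in register `vx` at the position in register `vi`, to the base in
register `1`. -/
def digit (vx vi : ℕ) : Expr :=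
  letE 63 (fold 64 65 0 (var vx) (ite (sub (var vi) (var 64)) (div 65 1) (var 65)))
    (sub (var 63) (letE 62 (div 63 1) (sum 66 1 (var 62))))

/-- The digit of the quotient of the registers `vx` and `2`. -/
def highDigit (vx vi : ℕ) : Expr := letE 67 (div vx 2) (digit 67 vi)

/-- The sum over the indices below the value of register `g`, which is at most that of register
`0`. -/
def sumBelow (i g : ℕ) (body : Expr) : Expr := sum i 0 (ite (sub (var g) (var i)) body (num 0))

/-- The vertex at position `vj` of the bag of the child. -/
def childVertex (vj : ℕ) : Expr := load (add (add (var 18) (num 2)) (var vj))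

/-- The vertex at position `vi` of the bag of the parent. -/
def parentVertex (vi : ℕ) : Expr := load (add (add (var 19) (num 2)) (var vi))

/-- Does the vertex at position `vj` of the bag of the child occur in the bag of the parent? -/
def inParent (vj : ℕ) : Expr := sumBelow 33 23 (eq (parentVertex 33) (childVertex vj))

/-- `1` if the vertices at positions `vj` and `31` of the bag of the child are adjacent and have
different colours, `0` otherwise. -/
def cutEdge (vj : ℕ) : Expr := ite (eq (digit 27 vj) (digit 27 31)) (num 0)
  (load (add (load (add (var 14) (childVertex vj))) (childVertex 31)))

/-- The number of differently coloured neighbours in the bag of the child. -/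
def cutDegBag (vj : ℕ) : Expr := sumBelow 31 22 (cutEdge vj)

/-- The number of differently coloured neighbours in the bag of the child that are not in the bag
of the parent. -/
def cutDegForgotten (vj : ℕ) : Expr :=
  sumBelow 31 22 (ite (inParent 31) (num 0) (cutEdge vj))

/-- Nonzero if the condition on the vertices that become interior is violated. -/
def badForgotten : Expr := sumBelow 30 22 (ite (inParent 30) (num 0)
  (sub (add (highDigit 27 30) (cutDegBag 30)) (num 1)))

/-- Nonzero if the colourings of the two bags disagree on a common vertex. -/
def badInter : Expr := sumBelow 29 23 (sumBelow 30 22 (ite (eq (parentVertex 29) (childVertex 30))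
  (neq (digit 27 30) (digit 26 29)) (num 0)))

/-- Nonzero if the colour or the degree of a vertex of the bag of the parent is wrong. -/
def badParent : Expr := sumBelow 29 23 (add (neq (digit 26 29) (digit 28 29))
  (neq (highDigit 26 29) (add (highDigit 28 29) (sumBelow 30 22
    (ite (eq (parentVertex 29) (childVertex 30)) (add (highDigit 27 30) (cutDegForgotten 30))
      (num 0))))))

/-- The number of colours on the bag of the child that do not occur on the common vertices. -/
def gain : Expr := sum 32 1 (ite (sumBelow 30 22 (eq (digit 27 30) (var 32)))
  (ite (sumBelow 30 22 (ite (inParent 30) (eq (digit 27 30) (var 32)) (num 0))) (num 0) (num 1))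
  (num 0))

/-- The contribution of the entry `27` of the child and the entry `28` of the parent to the entry
`26` of the new table of the parent. -/
def contribution : Expr := ite (add badParent (add badInter badForgotten)) (num 0)
  (letE 34 (load (add (var 20) (var 27))) (letE 35 (load (add (var 21) (var 28)))
    (ite (var 34) (ite (var 35) (sub (add (add (var 34) (var 35)) gain) (num 1)) (num 0))
      (num 0))))

/-- The entry `26` of the new table of the parent. -/
def entry : Expr := sup 27 3 (sup 28 3 contribution)

theorem eval_neq_eq_zero (a b : Expr) (ρ μ : ℕ → ℕ) :
    (neq a b).eval ρ μ = 0 ↔ a.eval ρ μ = b.eval ρ μ := by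
  simp only [neq, eval]; omega

theorem eval_eq (a b : Expr) (ρ μ : ℕ → ℕ) :
    (eq a b).eval ρ μ = if a.eval ρ μ = b.eval ρ μ then 1 else 0 := by
  change (if (neq a b).eval ρ μ = 0 then 1 else 0) = _
  simp only [eval_neq_eq_zero]

theorem eval_div {v c : ℕ} (hv : v ∉ ({60, 61, 80, 81} : Finset ℕ)) (hc : c < 60) {ρ : ℕ → ℕ}
    (μ : ℕ → ℕ) (hx : ρ v ≤ ρ 3) (hq : 0 < ρ c) : (div v c).eval ρ μ = ρ v / ρ c := by
  simp only [mem_insert, mem_singleton, not_or] at hv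
  have h1 : fresh 80 (ite (sub (sum 61 c (add (var 60) (num 1))) (var v)) (num 0) (num 1)) := by
    simp [sum, fresh]; omega
  rw [div, eval_sum h1]
  have h2 : ∀ j, (ite (sub (sum 61 c (add (var 60) (num 1))) (var v)) (num 0) (num 1)).eval
      (update ρ 60 j) μ = if (j + 1) * ρ c ≤ ρ v then 1 else 0 := fun j => by
    simp only [eval, eval_sum (show fresh 81 (add (var 60) (num 1)) from rfl)]
    have : c ≠ 60 := by omega
    simp [hv, this, mul_comm]
    split_ifs <;> omega
  simp only [h2]
  rw [sum_boole, Nat.cast_id]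
  have : (range (ρ 3)).filter (fun j => (j + 1) * ρ c ≤ ρ v) = range (ρ v / ρ c) := by
    ext j
    rw [mem_filter, mem_range, mem_range, ← Nat.le_div_iff_mul_le hq]
    have := Nat.div_le_self (ρ v) (ρ c)
    omega
  rw [this, card_range]

/-- The registers that `digit` uses. -/
def digitRegs : Finset ℕ := {60, 61, 62, 63, 64, 65, 66, 80, 81, 86}

theorem eval_digit {vx vi : ℕ} (hi : vi ∉ digitRegs)
    {ρ : ℕ → ℕ} (μ : ℕ → ℕ) (hxS : ρ vx ≤ ρ 3) (hik : ρ vi ≤ ρ 0) (hK : 0 < ρ 1) :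
    (digit vx vi).eval ρ μ = ρ vx / ρ 1 ^ ρ vi % ρ 1 := by
  simp only [digitRegs, mem_insert, mem_singleton, not_or] at hi
  have h1 : ∀ k, (Nat.rec (ρ vx) (fun j s => (ite (sub (var vi) (var 64)) (div 65 1) (var 65)).eval
      (update (update ρ 64 j) 65 s) μ) k : ℕ) = ρ vx / ρ 1 ^ (min k (ρ vi)) := by
    intro k
    induction k with
    | zero => simp
    | succ k ih =>
      have h3 : ρ vx / ρ 1 ^ min k (ρ vi) ≤ ρ 3 := (Nat.div_le_self _ _).trans hxS
      simp only [ih]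
      simp only [eval]
      rw [eval_div (by decide) (by decide) _ (by simpa using h3) (by simpa using hK)]
      simp only [update_self, ne_eq, hi, not_false_eq_true, update_of_ne, Nat.reduceEqDiff]
      split_ifs with h
      · rw [min_eq_right (by omega), min_eq_right (by omega)]
      · rw [min_eq_left (by omega), min_eq_left (by omega), Nat.div_div_eq_div_mul, pow_succ]
  have h2 : (fold 64 65 0 (var vx) (ite (sub (var vi) (var 64)) (div 65 1) (var 65))).eval ρ μ =
      ρ vx / ρ 1 ^ ρ vi := (h1 (ρ 0)).trans (by rw [min_eq_right hik])
  rw [digit, eval, h2]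
  simp only [eval]
  rw [eval_sum (by rfl), eval_div (by decide) (by decide) _
    (by simpa using (Nat.div_le_self _ _).trans hxS) (by simpa using hK)]
  simp only [eval]
  simp
  rw [Nat.mod_eq_sub_mul_div]

theorem eval_highDigit {vx vi : ℕ} (hx : vx ∉ digitRegs) (hi : vi ∉ insert 67 digitRegs)
    {ρ : ℕ → ℕ} (μ : ℕ → ℕ) (hxS : ρ vx ≤ ρ 3) (hik : ρ vi ≤ ρ 0) (hK : 0 < ρ 1) (hH : 0 < ρ 2) :
    (highDigit vx vi).eval ρ μ = ρ vx / ρ 2 / ρ 1 ^ ρ vi % ρ 1 := by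
  rw [mem_insert, not_or] at hi
  simp only [digitRegs, mem_insert, mem_singleton, not_or] at hx
  rw [highDigit, eval, eval_div (by simp [hx]) (by decide) _ hxS hH, eval_digit hi.2]
  · simp [hi.1]
  · simpa using (Nat.div_le_self _ _).trans hxS
  · simpa [hi.1] using hik
  · simpa using hK

theorem eval_sumBelow {i g : ℕ} {body : Expr} (hb : body.fresh (i + 20) = true) (hg : g < 26)
    (hi : 26 ≤ i) {ρ : ℕ → ℕ} (μ : ℕ → ℕ) (h : ρ g ≤ ρ 0) :
    (sumBelow i g body).eval ρ μ = ∑ j ∈ range (ρ g), body.eval (update ρ i j) μ := by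
  rw [sumBelow, eval_sum]
  · have hne : g ≠ i := by omega
    rw [← sum_subset (range_subset_range.2 h)]
    · refine sum_congr rfl fun j hj => ?_
      rw [mem_range] at hj
      simp only [eval, update_self, update_of_ne hne]
      split <;> [omega; rfl]
    · intro j _ hj
      rw [mem_range] at hj
      simp only [eval, update_self, update_of_ne hne]
      split <;> [rfl; omega]
  · simp only [fresh, hb, Bool.and_eq_true, decide_eq_true_eq, and_true]
    omega

end Expr

/-- The colour of the vertex `v` in the state `x` of the bag that is listed in `B`. -/
def stateColour {n : ℕ} (K : ℕ) (B : List (Fin n)) (x : ℕ) (v : Fin n) : ℕ :=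
  x / K ^ B.idxOf v % K

/-- The number of interior neighbours outside the part of `v` in the state `x` of the bag that is
listed in `B`; `k` is the bound for the size of the bags. -/
def stateDegree {n : ℕ} (K k : ℕ) (B : List (Fin n)) (x : ℕ) (v : Fin n) : ℕ :=
  x / K ^ k / K ^ B.idxOf v % K

/-- The content of registers and memory while the node with bag `Y` is contracted into its parent,
whose bag is `X`. The tables of the two nodes are `tY` and `tX`. -/
structure PushContext {n : ℕ} (G : SimpleGraph (Fin n)) [DecidableRel G.Adj] (K k : ℕ)
    (Y X : List (Fin n)) (tY tX : ℕ → ℕ) (ρ μ : ℕ → ℕ) : Prop where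
  reg_zero : ρ 0 = k
  reg_one : ρ 1 = K
  reg_two : ρ 2 = K ^ k
  reg_three : ρ 3 = K ^ k * K ^ k
  length_child : ρ 22 = Y.length
  length_parent : ρ 23 = X.length
  child_le : Y.length ≤ k
  parent_le : X.length ≤ k
  pos : 0 < K
  child : ∀ (j : ℕ) (h : j < Y.length), μ (ρ 18 + 2 + j) = Y[j]
  parent : ∀ (j : ℕ) (h : j < X.length), μ (ρ 19 + 2 + j) = X[j]
  adj : ∀ u v : Fin n, μ (μ (ρ 14 + u) + v) = if G.Adj u v then 1 else 0
  table_child : ∀ y < K ^ k * K ^ k, μ (ρ 20 + y) = tY y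
  table_parent : ∀ z < K ^ k * K ^ k, μ (ρ 21 + z) = tX z

theorem PushContext.upd {n : ℕ} {G : SimpleGraph (Fin n)} [DecidableRel G.Adj] {K k : ℕ}
    {Y X : List (Fin n)} {tY tX ρ μ : ℕ → ℕ} (h : PushContext G K k Y X tY tX ρ μ) (i : ℕ)
    (hi : 26 ≤ i) (x : ℕ) : PushContext G K k Y X tY tX (Function.update ρ i x) μ := by
  have e : ∀ j < 26, Function.update ρ i x j = ρ j := fun j hj => update_of_ne (by omega) _ _
  constructor <;> (try rw [e _ (by omega)])
  exacts [h.1, h.2, h.3, h.4, h.5, h.6, h.7, h.8, h.9, h.10, h.11,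
    fun u v => by rw [← h.12 u v], fun y hy => h.13 y hy, h.14]

/-- A sum over the positions of a list without repetitions is a sum over its elements. -/
theorem sum_range_length {V : Type*} [DecidableEq V] {B : List V} (hB : B.Nodup) {g : ℕ → ℕ}
    {f : V → ℕ} (h : ∀ v ∈ B, g (B.idxOf v) = f v) :
    ∑ j ∈ range B.length, g j = ∑ v ∈ B.toFinset, f v := by
  refine (sum_bij' (fun v _ => B.idxOf v) (fun j hj => B[j]'(mem_range.1 hj)) ?_ ?_ ?_ ?_ ?_).symm
  · intro v hv; exact mem_range.2 (List.idxOf_lt_length_iff.2 (List.mem_toFinset.1 hv))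
  · intro j hj; exact List.mem_toFinset.2 (List.getElem_mem _)
  · intro v hv; simp
  · intro j hj; exact hB.idxOf_getElem _ _
  · intro v hv; exact (h v (List.mem_toFinset.1 hv)).symm

end MatchingMulticut

namespace MatchingMulticut

open Finset MatchingMulticut.Expr

/-! ### The value of a table entry -/

namespace PushContext

variable {n : ℕ} {G : SimpleGraph (Fin n)} [DecidableRel G.Adj] {K k : ℕ} {Y X : List (Fin n)}
  {tY tX ρ μ : ℕ → ℕ}

theorem eval_childVertex (c : PushContext G K k Y X tY tX ρ μ) {vj : ℕ} {v : Fin n} (hv : v ∈ Y)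
    (hj : ρ vj = Y.idxOf v) : (childVertex vj).eval ρ μ = v := by
  have h := c.child _ (List.idxOf_lt_length_iff.2 hv)
  simpa [childVertex, eval, hj] using h

theorem eval_parentVertex (c : PushContext G K k Y X tY tX ρ μ) {vi : ℕ} {v : Fin n} (hv : v ∈ X)
    (hi : ρ vi = X.idxOf v) : (parentVertex vi).eval ρ μ = v := by
  have h := c.parent _ (List.idxOf_lt_length_iff.2 hv)
  simpa [parentVertex, eval, hi] using h

theorem eval_sumBelow_child (c : PushContext G K k Y X tY tX ρ μ) (hY : Y.Nodup) {i : ℕ}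
    {body : Expr} (hb : body.fresh (i + 20) = true) (hi : 26 ≤ i) {f : Fin n → ℕ}
    (h : ∀ v ∈ Y, body.eval (Function.update ρ i (Y.idxOf v)) μ = f v) :
    (sumBelow i 22 body).eval ρ μ = ∑ v ∈ Y.toFinset, f v := by
  rw [eval_sumBelow hb (by omega) hi μ (by rw [c.length_child, c.reg_zero]; exact c.child_le),
    c.length_child]
  exact sum_range_length hY h

theorem eval_sumBelow_parent (c : PushContext G K k Y X tY tX ρ μ) (hX : X.Nodup) {i : ℕ}
    {body : Expr} (hb : body.fresh (i + 20) = true) (hi : 26 ≤ i) {f : Fin n → ℕ}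
    (h : ∀ v ∈ X, body.eval (Function.update ρ i (X.idxOf v)) μ = f v) :
    (sumBelow i 23 body).eval ρ μ = ∑ v ∈ X.toFinset, f v := by
  rw [eval_sumBelow hb (by omega) hi μ (by rw [c.length_parent, c.reg_zero]; exact c.parent_le),
    c.length_parent]
  exact sum_range_length hX h

theorem eval_inParent (c : PushContext G K k Y X tY tX ρ μ) (hX : X.Nodup) {vj : ℕ} {v : Fin n}
    (hv : v ∈ Y) (hj : ρ vj = Y.idxOf v) (h1 : vj ≠ 33) (h2 : vj ≠ 53) :
    (inParent vj).eval ρ μ = if v ∈ X then 1 else 0 := by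
  rw [inParent, c.eval_sumBelow_parent hX (f := fun w => if w = v then 1 else 0) _ (by omega)]
  · rw [sum_ite_eq']; simp
  · intro w hw
    rw [eval_eq, (c.upd 33 (by omega) (X.idxOf w)).eval_parentVertex hw (by simp),
      (c.upd 33 (by omega) (X.idxOf w)).eval_childVertex hv (by simp [h1, hj])]
    simp [Fin.val_inj]
  · simp [Expr.fresh, Expr.eq, parentVertex, childVertex, h2]

theorem eval_digit_child (c : PushContext G K k Y X tY tX ρ μ) {vx vj : ℕ} {v : Fin n} (hv : v ∈ Y)
    (hj : ρ vj = Y.idxOf v) (hd : vj ∉ digitRegs) (hx : ρ vx ≤ K ^ k * K ^ k) :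
    (digit vx vj).eval ρ μ = stateColour K Y (ρ vx) v := by
  have h1 := List.idxOf_lt_length_iff.2 hv
  have h2 := c.child_le
  rw [eval_digit hd μ (by rwa [c.reg_three]) (by rw [hj, c.reg_zero]; omega)
    (by rw [c.reg_one]; exact c.pos), c.reg_one, hj, stateColour]

theorem eval_digit_parent (c : PushContext G K k Y X tY tX ρ μ) {vx vi : ℕ} {v : Fin n}
    (hv : v ∈ X) (hi : ρ vi = X.idxOf v) (hd : vi ∉ digitRegs) (hx : ρ vx ≤ K ^ k * K ^ k) :
    (digit vx vi).eval ρ μ = stateColour K X (ρ vx) v := by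
  have h1 := List.idxOf_lt_length_iff.2 hv
  have h2 := c.parent_le
  rw [eval_digit hd μ (by rwa [c.reg_three]) (by rw [hi, c.reg_zero]; omega)
    (by rw [c.reg_one]; exact c.pos), c.reg_one, hi, stateColour]

theorem eval_highDigit_child (c : PushContext G K k Y X tY tX ρ μ) {vx vj : ℕ} {v : Fin n}
    (hv : v ∈ Y) (hj : ρ vj = Y.idxOf v) (hd : vj ∉ insert 67 digitRegs)
    (hd' : vx ∉ digitRegs) (hx : ρ vx ≤ K ^ k * K ^ k) :
    (highDigit vx vj).eval ρ μ = stateDegree K k Y (ρ vx) v := by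
  have h1 := List.idxOf_lt_length_iff.2 hv
  have h2 := c.child_le
  rw [eval_highDigit hd' hd μ (by rwa [c.reg_three]) (by rw [hj, c.reg_zero]; omega)
    (by rw [c.reg_one]; exact c.pos) (by rw [c.reg_two]; exact Nat.pow_pos c.pos), c.reg_one,
    c.reg_two, hj, stateDegree]

theorem eval_highDigit_parent (c : PushContext G K k Y X tY tX ρ μ) {vx vi : ℕ} {v : Fin n}
    (hv : v ∈ X) (hi : ρ vi = X.idxOf v) (hd : vi ∉ insert 67 digitRegs)
    (hd' : vx ∉ digitRegs) (hx : ρ vx ≤ K ^ k * K ^ k) :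
    (highDigit vx vi).eval ρ μ = stateDegree K k X (ρ vx) v := by
  have h1 := List.idxOf_lt_length_iff.2 hv
  have h2 := c.parent_le
  rw [eval_highDigit hd' hd μ (by rwa [c.reg_three]) (by rw [hi, c.reg_zero]; omega)
    (by rw [c.reg_one]; exact c.pos) (by rw [c.reg_two]; exact Nat.pow_pos c.pos), c.reg_one,
    c.reg_two, hi, stateDegree]

theorem eval_cutEdge (c : PushContext G K k Y X tY tX ρ μ) {v w : Fin n} (hv : v ∈ Y) (hw : w ∈ Y)
    (h30 : ρ 30 = Y.idxOf v) (h31 : ρ 31 = Y.idxOf w) (hy : ρ 27 ≤ K ^ k * K ^ k) :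
    (cutEdge 30).eval ρ μ = if G.Adj v w ∧ stateColour K Y (ρ 27) v ≠ stateColour K Y (ρ 27) w
      then 1 else 0 := by
  have e : (cutEdge 30).eval ρ μ = if (Expr.eq (digit 27 30) (digit 27 31)).eval ρ μ = 0 then
    μ (μ (ρ 14 + (childVertex 30).eval ρ μ) + (childVertex 31).eval ρ μ) else 0 := rfl
  rw [e, eval_eq, c.eval_digit_child hv h30 (by decide) hy,
    c.eval_digit_child hw h31 (by decide) hy,
    c.eval_childVertex hv h30, c.eval_childVertex hw h31, c.adj]
  by_cases h : stateColour K Y (ρ 27) v = stateColour K Y (ρ 27) w <;> simp [h]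

theorem eval_cutDegBag (c : PushContext G K k Y X tY tX ρ μ) (hY : Y.Nodup) {v : Fin n}
    (hv : v ∈ Y) (h30 : ρ 30 = Y.idxOf v) (hy : ρ 27 ≤ K ^ k * K ^ k) :
    (cutDegBag 30).eval ρ μ = cutDeg G (stateColour K Y (ρ 27)) Y.toFinset v := by
  rw [cutDegBag, c.eval_sumBelow_child hY (by rfl) (by omega) (fun w hw =>
    (c.upd 31 (by omega) (Y.idxOf w)).eval_cutEdge hv hw (by simpa using h30) (by simp)
      (by simpa using hy)),
    cutDeg, card_filter]
  simp

theorem eval_cutDegForgotten (c : PushContext G K k Y X tY tX ρ μ) (hY : Y.Nodup) (hX : X.Nodup)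
    {v : Fin n} (hv : v ∈ Y) (h30 : ρ 30 = Y.idxOf v) (hy : ρ 27 ≤ K ^ k * K ^ k) :
    (cutDegForgotten 30).eval ρ μ =
      cutDeg G (stateColour K Y (ρ 27)) (Y.toFinset \ X.toFinset) v := by
  rw [cutDegForgotten, c.eval_sumBelow_child hY (by rfl) (by omega) (f := fun w =>
    if w ∉ X then if G.Adj v w ∧ stateColour K Y (ρ 27) v ≠ stateColour K Y (ρ 27) w then 1 else 0
    else 0) (fun w hw => ?_)]
  · rw [cutDeg, card_filter, ← sum_filter]
    congr 1
    ext w; simp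
  · have c' := c.upd 31 (by omega) (Y.idxOf w)
    have e : ∀ ρ, (ite (inParent 31) (num 0) (cutEdge 30)).eval ρ μ =
      if (inParent 31).eval ρ μ = 0 then (cutEdge 30).eval ρ μ else 0 := fun _ => rfl
    rw [e, c'.eval_inParent hX hw (by simp) (by omega) (by omega),
      c'.eval_cutEdge hv hw (by simpa using h30) (by simp) (by simpa using hy)]
    by_cases h : w ∈ X <;> simp [h]

theorem eval_badForgotten (c : PushContext G K k Y X tY tX ρ μ) (hY : Y.Nodup) (hX : X.Nodup)
    (hy : ρ 27 ≤ K ^ k * K ^ k) : badForgotten.eval ρ μ = 0 ↔ ∀ v ∈ Y.toFinset, v ∉ X.toFinset →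
      stateDegree K k Y (ρ 27) v + cutDeg G (stateColour K Y (ρ 27)) Y.toFinset v ≤ 1 := by
  rw [badForgotten, c.eval_sumBelow_child hY (by rfl) (by omega) (f := fun v => if v ∈ X then 0 else
    stateDegree K k Y (ρ 27) v + cutDeg G (stateColour K Y (ρ 27)) Y.toFinset v - 1)
    (fun v hv => ?_)]
  · rw [sum_eq_zero_iff]
    refine forall₂_congr fun v hv => ?_
    by_cases h : v ∈ X <;> simp [h]
    omega
  · have c' := c.upd 30 (by omega) (Y.idxOf v)
    have e : ∀ ρ, (ite (inParent 30) (num 0) (sub (add (highDigit 27 30) (cutDegBag 30))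
      (num 1))).eval ρ μ = if (inParent 30).eval ρ μ = 0 then
      (highDigit 27 30).eval ρ μ + (cutDegBag 30).eval ρ μ - 1 else 0 := fun _ => rfl
    rw [e, c'.eval_inParent hX hv (by simp) (by omega) (by omega),
      c'.eval_cutDegBag hY hv (by simp) (by simpa using hy),
      c'.eval_highDigit_child hv (by simp) (by decide) (by decide) (by simpa using hy)]
    by_cases h : v ∈ X <;> simp [h]

theorem eval_badInter (c : PushContext G K k Y X tY tX ρ μ) (hY : Y.Nodup) (hX : X.Nodup)
    (hx : ρ 26 ≤ K ^ k * K ^ k) (hy : ρ 27 ≤ K ^ k * K ^ k) :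
    badInter.eval ρ μ = 0 ↔ ∀ v ∈ X.toFinset, v ∈ Y.toFinset →
      stateColour K Y (ρ 27) v = stateColour K X (ρ 26) v := by
  have key : ∀ v ∈ X, (sumBelow 30 22 (ite (Expr.eq (parentVertex 29) (childVertex 30))
      (neq (digit 27 30) (digit 26 29)) (num 0))).eval (Function.update ρ 29 (X.idxOf v)) μ = 0 ↔
      (v ∈ Y.toFinset → stateColour K Y (ρ 27) v = stateColour K X (ρ 26) v) := fun v hv => by
    have c' := c.upd 29 (by omega) (X.idxOf v)
    rw [c'.eval_sumBelow_child hY (by rfl) (by omega) (fun w _ => rfl), sum_eq_zero_iff]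
    have h : ∀ w ∈ Y, (ite (Expr.eq (parentVertex 29) (childVertex 30))
      (neq (digit 27 30) (digit 26 29)) (num 0)).eval
      (Function.update (Function.update ρ 29 (X.idxOf v)) 30 (Y.idxOf w)) μ = 0 ↔
      (v = w → stateColour K Y (ρ 27) w = stateColour K X (ρ 26) v) := fun w hw => by
      have c'' := c'.upd 30 (by omega) (Y.idxOf w)
      have e : ∀ ρ, (ite (Expr.eq (parentVertex 29) (childVertex 30))
        (neq (digit 27 30) (digit 26 29)) (num 0)).eval ρ μ =
        if (Expr.eq (parentVertex 29) (childVertex 30)).eval ρ μ = 0 then 0 else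
        (neq (digit 27 30) (digit 26 29)).eval ρ μ := fun _ => rfl
      rw [e, eval_eq, c''.eval_parentVertex hv (by simp), c''.eval_childVertex hw (by simp)]
      by_cases h : v = w
      · simp only [h, if_true, one_ne_zero, if_false, true_imp_iff]
        subst h
        rw [eval_neq_eq_zero, c''.eval_digit_child hw (by simp) (by decide) (by simpa using hy),
          c''.eval_digit_parent hv (by simp) (by decide) (by simpa using hx)]
        simp
      · simp [h, Fin.val_inj]
    constructor
    · intro H hvY
      exact (h v (List.mem_toFinset.1 hvY)).1 (H v hvY) rfl
    · intro H w hw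
      refine (h w (List.mem_toFinset.1 hw)).2 ?_
      rintro rfl
      exact H hw
  rw [badInter, c.eval_sumBelow_parent hX (by rfl) (by omega) (fun w _ => rfl), sum_eq_zero_iff]
  exact forall₂_congr fun v hv => key v (List.mem_toFinset.1 hv)

theorem eval_badParent (c : PushContext G K k Y X tY tX ρ μ) (hY : Y.Nodup) (hX : X.Nodup)
    (hx : ρ 26 ≤ K ^ k * K ^ k) (hy : ρ 27 ≤ K ^ k * K ^ k) (hz : ρ 28 ≤ K ^ k * K ^ k) :
    badParent.eval ρ μ = 0 ↔ ∀ v ∈ X.toFinset,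
      stateColour K X (ρ 26) v = stateColour K X (ρ 28) v ∧
      stateDegree K k X (ρ 26) v = stateDegree K k X (ρ 28) v + if v ∈ Y.toFinset then
        stateDegree K k Y (ρ 27) v +
          cutDeg G (stateColour K Y (ρ 27)) (Y.toFinset \ X.toFinset) v else 0 := by
  rw [badParent, c.eval_sumBelow_parent hX (by rfl) (by omega) (fun w _ => rfl), sum_eq_zero_iff]
  refine forall₂_congr fun v hv => ?_
  rw [List.mem_toFinset] at hv
  have c' := c.upd 29 (by omega) (X.idxOf v)
  have e : ∀ (a b : Expr) ρ, (add a b).eval ρ μ = a.eval ρ μ + b.eval ρ μ := fun _ _ _ => rfl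
  have h : ∀ w ∈ Y, (ite (Expr.eq (parentVertex 29) (childVertex 30))
      (add (highDigit 27 30) (cutDegForgotten 30)) (num 0)).eval
      (Function.update (Function.update ρ 29 (X.idxOf v)) 30 (Y.idxOf w)) μ =
      if v = w then stateDegree K k Y (ρ 27) w +
        cutDeg G (stateColour K Y (ρ 27)) (Y.toFinset \ X.toFinset) w else 0 := fun w hw => by
    have c'' := c'.upd 30 (by omega) (Y.idxOf w)
    have e' : ∀ ρ, (ite (Expr.eq (parentVertex 29) (childVertex 30))
      (add (highDigit 27 30) (cutDegForgotten 30)) (num 0)).eval ρ μ =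
      if (Expr.eq (parentVertex 29) (childVertex 30)).eval ρ μ = 0 then 0 else
        (highDigit 27 30).eval ρ μ + (cutDegForgotten 30).eval ρ μ := fun _ => rfl
    rw [e', eval_eq, c''.eval_parentVertex hv (by simp), c''.eval_childVertex hw (by simp),
      c''.eval_cutDegForgotten hY hX hw (by simp) (by simpa using hy),
      c''.eval_highDigit_child hw (by simp) (by decide) (by decide) (by simpa using hy)]
    by_cases h : v = w <;> simp [h, Fin.val_inj]
  rw [e, Nat.add_eq_zero_iff, eval_neq_eq_zero, eval_neq_eq_zero, e,
    c'.eval_sumBelow_child hY (by rfl) (by omega) h, sum_ite_eq,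
    c'.eval_digit_parent hv (by simp) (by decide) (by simpa using hx),
    c'.eval_digit_parent hv (by simp) (by decide) (by simpa using hz),
    c'.eval_highDigit_parent hv (by simp) (by decide) (by decide) (by simpa using hx),
    c'.eval_highDigit_parent hv (by simp) (by decide) (by decide) (by simpa using hz)]
  simp

theorem eval_gain (c : PushContext G K k Y X tY tX ρ μ) (hY : Y.Nodup) (hX : X.Nodup)
    (hy : ρ 27 ≤ K ^ k * K ^ k) :
    gain.eval ρ μ = closedParts Y.toFinset X.toFinset (stateColour K Y (ρ 27)) := by
  rw [gain, eval_sum (by rfl), c.reg_one]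
  have e : ∀ (a b : Expr) ρ, (ite a (ite b (num 0) (num 1)) (num 0)).eval ρ μ =
      if a.eval ρ μ = 0 then 0 else if b.eval ρ μ = 0 then 1 else 0 := fun _ _ _ => rfl
  have h1 : ∀ q, (sumBelow 30 22 (Expr.eq (digit 27 30) (var 32))).eval
      (Function.update ρ 32 q) μ = 0 ↔ q ∉ Y.toFinset.image (stateColour K Y (ρ 27)) := fun q => by
    have c' := c.upd 32 (by omega) q
    rw [c'.eval_sumBelow_child hY (by rfl) (by omega) (f := fun v =>
      if stateColour K Y (ρ 27) v = q then 1 else 0) (fun v hv => ?_), sum_eq_zero_iff]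
    · simp
    · rw [eval_eq, (c'.upd 30 (by omega) (Y.idxOf v)).eval_digit_child hv (by simp) (by decide)
        (by simpa using hy)]
      simp [eval]
  have h2 : ∀ q, (sumBelow 30 22 (ite (inParent 30) (Expr.eq (digit 27 30) (var 32))
      (num 0))).eval (Function.update ρ 32 q) μ = 0 ↔
      q ∉ (Y.toFinset ∩ X.toFinset).image (stateColour K Y (ρ 27)) := fun q => by
    have c' := c.upd 32 (by omega) q
    rw [c'.eval_sumBelow_child hY (by rfl) (by omega) (f := fun v =>
      if v ∈ X then if stateColour K Y (ρ 27) v = q then 1 else 0 else 0) (fun v hv => ?_),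
      sum_eq_zero_iff]
    · simp
    · have c'' := c'.upd 30 (by omega) (Y.idxOf v)
      have e : ∀ ρ, (ite (inParent 30) (Expr.eq (digit 27 30) (var 32)) (num 0)).eval ρ μ =
        if (inParent 30).eval ρ μ = 0 then 0 else
          (Expr.eq (digit 27 30) (var 32)).eval ρ μ := fun _ => rfl
      rw [e, eval_eq, c''.eval_inParent hX hv (by simp) (by omega) (by omega),
        c''.eval_digit_child hv (by simp) (by decide) (by simpa using hy)]
      by_cases h : v ∈ X <;> simp [h, eval]
  have h3 : ∀ q, (ite (sumBelow 30 22 (Expr.eq (digit 27 30) (var 32)))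
      (ite (sumBelow 30 22 (ite (inParent 30) (Expr.eq (digit 27 30) (var 32)) (num 0))) (num 0)
      (num 1)) (num 0)).eval (Function.update ρ 32 q) μ =
      if q ∈ Y.toFinset.image (stateColour K Y (ρ 27)) \
        (Y.toFinset ∩ X.toFinset).image (stateColour K Y (ρ 27)) then 1 else 0 := fun q => by
    rw [e]
    simp only [h1, h2, mem_sdiff]
    split_ifs <;> tauto
  simp only [h3]
  rw [closedParts, ← card_filter, filter_mem_eq_inter, inter_eq_right.2]
  intro q hq
  obtain ⟨v, _, rfl⟩ := mem_image.1 (mem_sdiff.1 hq).1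
  exact mem_range.2 (Nat.mod_lt _ c.pos)

end PushContext

section entry

variable {n : ℕ} (G : SimpleGraph (Fin n)) [DecidableRel G.Adj] (K k : ℕ) (Y X : List (Fin n))

/-- The states `y` and `z` of the bags `Y` and `X` combine to the state `x` of the bag `X`. -/
def StatesGlue (x y z : ℕ) : Prop :=
  Glues G Y.toFinset X.toFinset (stateColour K X x) (stateDegree K k X x) (stateColour K Y y)
    (stateDegree K k Y y) (stateColour K X z) (stateDegree K k X z)

open Classical in
/-- The contribution of the states `y` and `z` to the table entry of the state `x`. In tables, `0`
stands for infeasibility and `m + 1` for `m` parts. -/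
noncomputable def glueValue (tY tX : ℕ → ℕ) (x y z : ℕ) : ℕ :=
  if StatesGlue G K k Y X x y z ∧ tY y ≠ 0 ∧ tX z ≠ 0 then
    tY y + tX z + closedParts Y.toFinset X.toFinset (stateColour K Y y) - 1 else 0

/-- The table of a node after contracting a child into it. -/
noncomputable def glueTable (tY tX : ℕ → ℕ) (x : ℕ) : ℕ :=
  (range (K ^ k * K ^ k)).sup fun y => (range (K ^ k * K ^ k)).sup fun z =>
    glueValue G K k Y X tY tX x y z

variable {G K k Y X} {tY tX ρ μ : ℕ → ℕ}

theorem PushContext.eval_contribution (c : PushContext G K k Y X tY tX ρ μ) (hY : Y.Nodup)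
    (hX : X.Nodup) (hx : ρ 26 < K ^ k * K ^ k) (hy : ρ 27 < K ^ k * K ^ k)
    (hz : ρ 28 < K ^ k * K ^ k) :
    contribution.eval ρ μ = glueValue G K k Y X tY tX (ρ 26) (ρ 27) (ρ 28) := by
  have c' := (c.upd 34 (by omega) (tY (ρ 27))).upd 35 (by omega) (tX (ρ 28))
  have e : contribution.eval ρ μ = if badParent.eval ρ μ + (badInter.eval ρ μ +
      badForgotten.eval ρ μ) = 0 then
      (if μ (ρ 20 + ρ 27) = 0 then 0 else if μ (ρ 21 + ρ 28) = 0 then 0 else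
        μ (ρ 20 + ρ 27) + μ (ρ 21 + ρ 28) + gain.eval (Function.update (Function.update ρ 34
          (μ (ρ 20 + ρ 27))) 35 (μ (ρ 21 + ρ 28))) μ - 1) else 0 := rfl
  have hg : (badParent.eval ρ μ + (badInter.eval ρ μ + badForgotten.eval ρ μ) = 0) ↔
      StatesGlue G K k Y X (ρ 26) (ρ 27) (ρ 28) := by
    rw [Nat.add_eq_zero_iff, Nat.add_eq_zero_iff, c.eval_badParent hY hX hx.le hy.le hz.le,
      c.eval_badInter hY hX hx.le hy.le, c.eval_badForgotten hY hX hy.le]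
    constructor
    · rintro ⟨h1, h2, h3⟩
      exact ⟨fun v hv => (h1 v hv).1, h2, h3, fun v hv => (h1 v hv).2⟩
    · rintro ⟨h1, h2, h3, h4⟩
      exact ⟨fun v hv => ⟨h1 v hv, h4 v hv⟩, h2, h3⟩
  rw [e, c.table_child _ hy, c.table_parent _ hz, c'.eval_gain hY hX (by simpa using hy.le),
    glueValue]
  classical
  rw [if_congr hg rfl rfl]
  by_cases h1 : StatesGlue G K k Y X (ρ 26) (ρ 27) (ρ 28) <;> by_cases h2 : tY (ρ 27) = 0 <;>
    by_cases h3 : tX (ρ 28) = 0 <;> simp [h1, h2, h3]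

theorem PushContext.eval_entry (c : PushContext G K k Y X tY tX ρ μ) (hY : Y.Nodup)
    (hX : X.Nodup) (hx : ρ 26 < K ^ k * K ^ k) :
    entry.eval ρ μ = glueTable G K k Y X tY tX (ρ 26) := by
  rw [entry, eval_sup (by rfl), c.reg_three, glueTable]
  refine sup_congr rfl fun y hy => ?_
  have c' := c.upd 27 (by omega) y
  rw [eval_sup (by rfl), c'.reg_three]
  refine sup_congr rfl fun z hz => ?_
  rw [(c'.upd 28 (by omega) z).eval_contribution hY hX (by simpa using hx)
    (by simpa using hy) (by simpa using hz)]
  simp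

end entry

end MatchingMulticut

namespace MatchingMulticut

open Finset

/-! ### Correctness of the tables -/

section tables

variable {V : Type*} [DecidableEq V] {G : SimpleGraph V} [DecidableRel G.Adj]

theorem PartialMulticut.congr {U X : Finset V} {f d f' d' : V → ℕ} {m : ℕ}
    (h : PartialMulticut G U X f d m) (hf : ∀ v ∈ X, f v = f' v) (hd : ∀ v ∈ X, d v = d' v) :
    PartialMulticut G U X f' d' m := by
  obtain ⟨a, h1, h2, h3, h4⟩ := h
  exact ⟨a, fun v hv => (h1 v hv).trans (hf v hv), h2, fun v hv => (h3 v hv).trans (hd v hv), h4⟩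

theorem Glues.congr {Y X : Finset V} {fx dx fy dy fz dz fx' dx' fy' dy' fz' dz' : V → ℕ}
    (h : Glues G Y X fx dx fy dy fz dz) (hfx : ∀ v ∈ X, fx v = fx' v) (hdx : ∀ v ∈ X, dx v = dx' v)
    (hfy : ∀ v ∈ Y, fy v = fy' v) (hdy : ∀ v ∈ Y, dy v = dy' v)
    (hfz : ∀ v ∈ X, fz v = fz' v) (hdz : ∀ v ∈ X, dz v = dz' v) :
    Glues G Y X fx' dx' fy' dy' fz' dz' := by
  have hc : ∀ S ⊆ Y, ∀ v ∈ Y, cutDeg G fy S v = cutDeg G fy' S v := fun S hS v hv =>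
    cutDeg_congr fun w hw _ => by rw [hfy v hv, hfy w (hS hw)]
  refine ⟨fun v hv => ?_, fun v hv hvY => ?_, fun v hv hvX => ?_, fun v hv => ?_⟩
  · rw [← hfx v hv, ← hfz v hv, h.colour v hv]
  · rw [← hfx v hv, ← hfy v hvY, h.colour_inter v hv hvY]
  · rw [← hdy v hv, ← hc Y subset_rfl v hv]
    exact h.forgotten v hv hvX
  · rw [← hdx v hv, ← hdz v hv, h.degree v hv]
    split_ifs with hvY
    · rw [hdy v hvY, hc _ sdiff_subset v hvY]
    · rfl

end tables

theorem exists_digits {K : ℕ} (k : ℕ) (g : ℕ → ℕ) (hg : ∀ i < k, g i < K) :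
    ∃ a < K ^ k, ∀ i < k, a / K ^ i % K = g i := by
  induction k generalizing g with
  | zero => exact ⟨0, by simp, by simp⟩
  | succ k ih =>
    obtain ⟨a, ha, h⟩ := ih (fun i => g (i + 1)) fun i hi => hg (i + 1) (by omega)
    have h0 := hg 0 (by omega)
    refine ⟨g 0 + K * a, ?_, fun i hi => ?_⟩
    · calc g 0 + K * a < K + K * a := by omega
        _ = K * (a + 1) := by ring
        _ ≤ K * K ^ k := Nat.mul_le_mul_left _ ha
        _ = K ^ (k + 1) := by ring
    · rcases i with _ | i
      · simp [Nat.mod_eq_of_lt h0]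
      · rw [pow_succ', ← Nat.div_div_eq_div_mul, Nat.add_mul_div_left _ _ (by omega),
          Nat.div_eq_of_lt h0, zero_add, h i (by omega)]

theorem add_mul_div_pow_mod {K k i : ℕ} (hK : 0 < K) (hi : i < k) (a b : ℕ) :
    (a + K ^ k * b) / K ^ i % K = a / K ^ i % K := by
  obtain ⟨j, rfl⟩ := Nat.exists_eq_add_of_lt hi
  rw [show K ^ (i + j + 1) * b = K ^ i * (K * (K ^ j * b)) by ring,
    Nat.add_mul_div_left _ _ (Nat.pow_pos hK), Nat.add_mul_mod_self_left]

section valid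

variable {n : ℕ} {G : SimpleGraph (Fin n)} [DecidableRel G.Adj] {K k : ℕ}

theorem exists_stateColour (hK : 0 < K) {B : List (Fin n)} (hk : B.length ≤ k)
    {f : Fin n → ℕ} (hf : ∀ v ∈ B, f v < K) :
    ∃ a < K ^ k, ∀ v ∈ B, ∀ b, stateColour K B (a + K ^ k * b) v = f v := by
  obtain ⟨a, ha, h⟩ := exists_digits (K := K) k
    (fun i => if h : i < B.length then f B[i] else 0) fun i hi => by
      split_ifs with h
      · exact hf _ (List.getElem_mem _)
      · exact hK
  refine ⟨a, ha, fun v hv b => ?_⟩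
  have h1 := List.idxOf_lt_length_iff.2 hv
  rw [stateColour, add_mul_div_pow_mod hK (by omega), h _ (by omega), dif_pos h1,
    List.getElem_idxOf]

theorem exists_state (hK : 0 < K) {B : List (Fin n)} (hk : B.length ≤ k)
    {f d : Fin n → ℕ} (hf : ∀ v ∈ B, f v < K) (hd : ∀ v ∈ B, d v < K) :
    ∃ x < K ^ k * K ^ k, (∀ v ∈ B, stateColour K B x v = f v) ∧
      ∀ v ∈ B, stateDegree K k B x v = d v := by
  obtain ⟨a, ha, hfa⟩ := exists_stateColour hK hk hf
  obtain ⟨b, hb, hdb⟩ := exists_stateColour hK hk hd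
  refine ⟨a + K ^ k * b, ?_, fun v hv => hfa v hv b, fun v hv => ?_⟩
  · calc a + K ^ k * b < K ^ k + K ^ k * b := by omega
      _ = K ^ k * (b + 1) := by ring
      _ ≤ K ^ k * K ^ k := Nat.mul_le_mul_left _ hb
  · rw [stateDegree, Nat.add_mul_div_left _ _ (Nat.pow_pos hK), Nat.div_eq_of_lt ha, zero_add]
    simpa [stateColour] using hdb v hv 0

variable (G K k)

/-- The table `tab` lists the maximum numbers of interior parts of the partial multicuts of `G[U]`
with boundary `X`, by states: an entry `m + 1` is attained by a partial multicut, and every partial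
multicut with labels and degrees below `K` is accounted for in an entry of its state. -/
structure TableValid (U : Finset (Fin n)) (X : List (Fin n)) (tab : ℕ → ℕ) : Prop where
  sound : ∀ x < K ^ k * K ^ k, ∀ m, tab x = m + 1 →
    PartialMulticut G U X.toFinset (stateColour K X x) (stateDegree K k X x) m
  complete : ∀ (f d : Fin n → ℕ) (m : ℕ), (∀ v ∈ X, f v < K) → (∀ v ∈ X, d v < K) →
    PartialMulticut G U X.toFinset f d m → ∃ x < K ^ k * K ^ k,
      (∀ v ∈ X, stateColour K X x v = f v) ∧ (∀ v ∈ X, stateDegree K k X x v = d v) ∧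
      m + 1 ≤ tab x

variable {G K k}

theorem tableValid_init (hK : 0 < K) {X : List (Fin n)} (hk : X.length ≤ k)
    {tab : ℕ → ℕ} (h : ∀ x < K ^ k * K ^ k, tab x = if x < K ^ k then 1 else 0) :
    TableValid G K k X.toFinset X tab := by
  constructor
  · intro x hx m hm
    rw [h x hx] at hm
    split_ifs at hm with hxk
    exact partialMulticut_self.2 ⟨by omega, fun v _ => by simp [stateDegree, Nat.div_eq_of_lt hxk]⟩
  · intro f d m hf _ hp
    obtain ⟨rfl, hd⟩ := partialMulticut_self.1 hp
    obtain ⟨a, ha, hfa⟩ := exists_stateColour hK hk hf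
    have ha' : a < K ^ k * K ^ k := ha.trans_le (Nat.le_mul_of_pos_left _ (Nat.pow_pos hK))
    exact ⟨a, ha', fun v hv => by simpa using hfa v hv 0, fun v hv => by
      rw [hd v (List.mem_toFinset.2 hv)]; simp [stateDegree, Nat.div_eq_of_lt ha],
      by rw [h a ha', if_pos ha]⟩

/-- The tables of two nodes combine to a valid table. The bound `K` leaves room for `k` labels
on a bag and for the degree `1`. -/
theorem tableValid_glue {Y X : List (Fin n)} (hkY : Y.length ≤ k) (hkX : X.length ≤ k)
    (hkK : k + 2 ≤ K) {A B : Finset (Fin n)}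
    (hs : Separates G A Y.toFinset B X.toFinset)
    {tY tX tab : ℕ → ℕ} (vY : TableValid G K k A Y tY) (vX : TableValid G K k B X tX)
    (h : ∀ x < K ^ k * K ^ k, tab x = glueTable G K k Y X tY tX x) :
    TableValid G K k (A ∪ B) X tab := by
  have hK : 0 < K := by omega
  have hne : (range (K ^ k * K ^ k)).Nonempty :=
    ⟨0, mem_range.2 (Nat.mul_pos (Nat.pow_pos hK) (Nat.pow_pos hK))⟩
  constructor
  · intro x hx m hm
    rw [h x hx, glueTable] at hm
    obtain ⟨y, hy, e⟩ := exists_mem_eq_sup _ hne fun y =>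
      (range (K ^ k * K ^ k)).sup fun z => glueValue G K k Y X tY tX x y z
    rw [e] at hm
    obtain ⟨z, hz, e⟩ := exists_mem_eq_sup _ hne fun z => glueValue G K k Y X tY tX x y z
    rw [e, glueValue] at hm
    split_ifs at hm with hc
    obtain ⟨hg, hy0, hz0⟩ := hc
    obtain ⟨my, hmy⟩ := Nat.exists_eq_succ_of_ne_zero hy0
    obtain ⟨mz, hmz⟩ := Nat.exists_eq_succ_of_ne_zero hz0
    have := (vY.sound y (mem_range.1 hy) my hmy).glue hs (vX.sound z (mem_range.1 hz) mz hmz) hg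
    convert this using 1
    omega
  · intro f d m hf hd hp
    have hYc : #Y.toFinset ≤ K := (List.toFinset_card_le Y).trans (by omega)
    obtain ⟨fy, dy, dz, my, mz, py, pz, hg, hm, hfy, hdy, hdz⟩ := hp.split hs
      (fun v hv => hf v (List.mem_toFinset.1 hv)) hYc
    obtain ⟨y, hy, hy1, hy2, hy3⟩ := vY.complete fy dy my
      (fun v hv => hfy v (List.mem_toFinset.2 hv)) (fun v hv => by
        rcases hdy v (List.mem_toFinset.2 hv) with h1 | ⟨h1, h2⟩
        · omega
        · exact h2.trans_lt (hd v (List.mem_toFinset.1 h1))) py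
    obtain ⟨z, hz, hz1, hz2, hz3⟩ := vX.complete f dz mz hf
      (fun v hv => (hdz v (List.mem_toFinset.2 hv)).trans_lt (hd v hv)) pz
    obtain ⟨x, hx, hx1, hx2⟩ := exists_state hK hkX hf hd
    refine ⟨x, hx, hx1, hx2, ?_⟩
    have hg' : StatesGlue G K k Y X x y z := by
      refine hg.congr ?_ ?_ ?_ ?_ ?_ ?_ <;> intro v hv <;> rw [List.mem_toFinset] at hv
      exacts [(hx1 v hv).symm, (hx2 v hv).symm, (hy1 v hv).symm, (hy2 v hv).symm,
        (hz1 v hv).symm, (hz2 v hv).symm]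
    have hc : closedParts Y.toFinset X.toFinset fy =
        closedParts Y.toFinset X.toFinset (stateColour K Y y) := by
      rw [closedParts, closedParts,
        image_congr (s := Y.toFinset) fun v hv => (hy1 v (List.mem_toFinset.1 hv)).symm,
        image_congr (s := Y.toFinset ∩ X.toFinset) fun v hv =>
          (hy1 v (List.mem_toFinset.1 (mem_inter.1 hv).1)).symm]
    have hv : m + 1 ≤ glueValue G K k Y X tY tX x y z := by
      rw [glueValue, if_pos ⟨hg', by omega, by omega⟩, ← hc]
      omega
    rw [h x hx, glueTable]
    exact hv.trans ((le_sup (f := fun z => glueValue G K k Y X tY tX x y z) (mem_range.2 hz)).trans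
      (le_sup (f := fun y => (range (K ^ k * K ^ k)).sup fun z =>
        glueValue G K k Y X tY tX x y z) (mem_range.2 hy)))

/-- The table of the root determines the maximum number of parts. -/
theorem isGreatest_of_tableValid {tab : ℕ → ℕ} (hn : 0 < n) (h : TableValid G K k univ [] tab) :
    IsGreatest (partCounts G) ((range (K ^ k * K ^ k)).sup tab - 1) := by
  have up : ∀ m ∈ partCounts G, ∃ x < K ^ k * K ^ k, m + 1 ≤ tab x := fun m hm => by
    obtain ⟨x, hx, -, -, h3⟩ := h.complete (fun _ => 0) (fun _ => 0) m (by simp) (by simp)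
      (by simpa using partialMulticut_univ.2 hm)
    exact ⟨x, hx, h3⟩
  have hone : 1 ∈ partCounts G := by
    refine partialMulticut_univ (f := fun _ => 0) (d := fun _ => 0).1
      ⟨fun _ => 0, by simp, fun u _ => by simp [cutDeg], by simp, ?_⟩
    have : Nonempty (Fin n) := ⟨⟨0, hn⟩⟩
    rw [image_const univ_nonempty]
    simp
  obtain ⟨x₁, hx₁, h₁⟩ := up 1 hone
  obtain ⟨x, hx, e⟩ := exists_mem_eq_sup (range (K ^ k * K ^ k)) ⟨x₁, mem_range.2 hx₁⟩ tab
  have hle : ∀ y < K ^ k * K ^ k, tab y ≤ (range (K ^ k * K ^ k)).sup tab := fun y hy =>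
    le_sup (f := tab) (mem_range.2 hy)
  constructor
  · refine partialMulticut_univ.1 (h.sound x (mem_range.1 hx) _ ?_)
    have := hle x₁ hx₁
    omega
  · intro m hm
    obtain ⟨y, hy, h2⟩ := up m hm
    have := hle y hy
    omega

end valid

end MatchingMulticut

namespace MatchingMulticut

open Finset

/-! ### The input in memory -/

theorem getElem?_flatMap {α β : Type*} (f : α → List β) (l : List α) (i j : ℕ) (hi : i < l.length)
    (hj : j < (f l[i]).length) :
    (l.flatMap f)[((l.take i).map fun a => (f a).length).sum + j]? = (f l[i])[j]? := by
  induction l generalizing i with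
  | nil => simp at hi
  | cons a l ih =>
    rw [List.flatMap_cons]
    rcases i with _ | i
    · rw [List.getElem?_append_left (by simpa using hj)]
      simp
    · rw [List.getElem?_append_right (by simp; omega)]
      simp only [List.take_succ_cons, List.map_cons, List.sum_cons, List.getElem_cons_succ]
      rw [← ih i (by simpa using hi) (by simpa using hj)]
      congr 1
      omega

theorem sum_map_take_finRange {N : ℕ} (g : Fin N → ℕ) {t : ℕ} (ht : t ≤ N) :
    (((List.finRange N).take t).map g).sum =
      ∑ i ∈ range t, if h : i < N then g ⟨i, h⟩ else 0 := by
  induction t with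
  | zero => simp
  | succ t ih =>
    rw [sum_range_succ, ← ih (by omega), List.take_add_one, List.map_append, List.sum_append]
    congr 1
    rw [List.getElem?_eq_getElem (by simp; omega)]
    simp [show t < N by omega]

/-- The address of the block of node `t` in the input, for a graph with `m` edges. -/
def blockAddr {n N : ℕ} (m : ℕ) (B : Fin N → List (Fin n)) (t : ℕ) : ℕ :=
  5 + 2 * m + ∑ i ∈ range t, if h : i < N then (B ⟨i, h⟩).length + 2 else 0

theorem blockAddr_succ {n N : ℕ} (m : ℕ) (B : Fin N → List (Fin n)) (t : Fin N) :
    blockAddr m B (t + 1) = blockAddr m B t + 2 + (B t).length := by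
  rw [blockAddr, blockAddr, sum_range_succ, dif_pos t.2]
  ring_nf

theorem blockAddr_mono {n N : ℕ} (m : ℕ) (B : Fin N → List (Fin n)) : Monotone (blockAddr m B) :=
  fun _ _ h => Nat.add_le_add_left (sum_le_sum_of_subset (range_subset_range.2 h)) _

/-- What the memory holds at the addresses of the input. -/
structure InputMem {n N : ℕ} (E : List (Fin n × Fin n)) (r : Fin N) (l : ℕ) (par : Fin N → Fin N)
    (B : Fin N → List (Fin n)) (μ : ℕ → ℕ) : Prop where
  cell_zero : μ 0 = n
  cell_one : μ 1 = N
  cell_two : μ 2 = E.length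
  cell_three : μ 3 = r
  cell_four : μ 4 = l
  edge_fst : ∀ (i : ℕ) (h : i < E.length), μ (5 + 2 * i) = E[i].1
  edge_snd : ∀ (i : ℕ) (h : i < E.length), μ (5 + 2 * i + 1) = E[i].2
  parent : ∀ t : Fin N, μ (blockAddr E.length B t) = par t
  size : ∀ t : Fin N, μ (blockAddr E.length B t + 1) = (B t).length
  bag : ∀ (t : Fin N) (j : ℕ) (h : j < (B t).length),
    μ (blockAddr E.length B t + 2 + j) = (B t)[j]

theorem InputMem.congr {n N : ℕ} {E : List (Fin n × Fin n)} {r : Fin N} {l : ℕ}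
    {par : Fin N → Fin N} {B : Fin N → List (Fin n)} {μ μ' : ℕ → ℕ} (h : InputMem E r l par B μ)
    (e : ∀ a < blockAddr E.length B N, μ' a = μ a) : InputMem E r l par B μ' := by
  have h5 : 5 + 2 * E.length ≤ blockAddr E.length B N := Nat.le_add_right _ _
  have hb : ∀ t : Fin N, blockAddr E.length B t + 2 + (B t).length ≤ blockAddr E.length B N :=
    fun t => by rw [← blockAddr_succ]; exact blockAddr_mono _ _ t.2
  exact ⟨(e 0 (by omega)).trans h.1, (e 1 (by omega)).trans h.2, (e 2 (by omega)).trans h.3,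
    (e 3 (by omega)).trans h.4, (e 4 (by omega)).trans h.5,
    fun i hi => (e _ (by omega)).trans (h.6 i hi), fun i hi => (e _ (by omega)).trans (h.7 i hi),
    fun t => (e _ (by have := hb t; omega)).trans (h.8 t),
    fun t => (e _ (by have := hb t; omega)).trans (h.9 t),
    fun t j hj => (e _ (by have := hb t; omega)).trans (h.10 t j hj)⟩

section input

variable {n N : ℕ} (E : List (Fin n × Fin n)) (r : Fin N) (l : ℕ) (par : Fin N → Fin N)
  (B : Fin N → List (Fin n))

theorem length_input : ([n, N, E.length, (r : ℕ), l] ++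
    E.flatMap (fun e => [(e.1 : ℕ), (e.2 : ℕ)]) ++
    (List.finRange N).flatMap
      (fun t => (par t : ℕ) :: (B t).length :: (B t).map Fin.val)).length =
    blockAddr E.length B N := by
  have h := sum_map_take_finRange (fun t => (B t).length + 2) (le_refl N)
  rw [List.take_of_length_le (by simp)] at h
  rw [blockAddr, ← h]
  simp [List.length_flatMap]
  ring

theorem inputMem_initStore : InputMem E r l par B (initStore ([n, N, E.length, (r : ℕ), l] ++
    E.flatMap (fun e => [(e.1 : ℕ), (e.2 : ℕ)]) ++
    (List.finRange N).flatMap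
      (fun t => (par t : ℕ) :: (B t).length :: (B t).map Fin.val))).mem := by
  set F : Fin n × Fin n → List ℕ := fun e => [(e.1 : ℕ), (e.2 : ℕ)] with hF
  set H : Fin N → List ℕ := fun t => (par t : ℕ) :: (B t).length :: (B t).map Fin.val
    with hH
  have hEl : (E.flatMap F).length = 2 * E.length := by
    simp [hF, List.length_flatMap, mul_comm]
  have hmem : ∀ i, (initStore ([n, N, E.length, (r : ℕ), l] ++ E.flatMap F ++
      (List.finRange N).flatMap H)).mem i = (([n, N, E.length, (r : ℕ), l] ++ E.flatMap F ++
      (List.finRange N).flatMap H)[i]?).getD 0 := fun i => by simp [initStore]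
  have hedge : ∀ (i : ℕ) (h : i < E.length) (j : ℕ) (hj : j < 2),
      (initStore ([n, N, E.length, (r : ℕ), l] ++ E.flatMap F ++
      (List.finRange N).flatMap H)).mem (5 + 2 * i + j) = ((F E[i])[j]?).getD 0 := by
    intro i h j hj
    rw [hmem, List.append_assoc, List.getElem?_append_right (by simp; omega),
      List.getElem?_append_left (by simp [hEl]; omega),
      ← getElem?_flatMap F E i j h (by simp [hF]; omega)]
    congr 2
    simp [hF]
    omega
  have hblock : ∀ (t : Fin N) (j : ℕ), j < (H t).length →
      (initStore ([n, N, E.length, (r : ℕ), l] ++ E.flatMap F ++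
      (List.finRange N).flatMap H)).mem (blockAddr E.length B t + j) = ((H t)[j]?).getD 0 := by
    intro t j hj
    have h1 := getElem?_flatMap H (List.finRange N) t j (by simp) (by simpa using hj)
    rw [List.getElem_finRange] at h1
    have h2 := sum_map_take_finRange (fun t => (H t).length) t.2.le
    have h3 : blockAddr E.length B t = 5 + 2 * E.length +
        (((List.finRange N).take t).map fun t => (H t).length).sum := by
      rw [h2, blockAddr]
      simp [hH]
    rw [hmem, List.getElem?_append_right (by simp [hEl, h3]; omega), ← show _ = (H t)[j]? from h1]
    congr 2
    simp only [List.length_append, hEl, h3, List.length_cons, List.length_nil]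
    omega
  refine ⟨rfl, rfl, rfl, rfl, rfl, fun i h => ?_, fun i h => ?_, fun t => ?_, fun t => ?_,
    fun t j h => ?_⟩
  · simpa [hF] using hedge i h 0 (by omega)
  · simpa [hF] using hedge i h 1 (by omega)
  · simpa [hH] using hblock t 0 (by simp [hH])
  · simpa [hH] using hblock t 1 (by simp [hH])
  · have := hblock t (2 + j) (by simp [hH]; omega)
    rw [← add_assoc] at this
    rw [this, add_comm 2 j]
    simp [hH, h]

end input

end MatchingMulticut

namespace MatchingMulticut

open Finset MatchingMulticut.Expr

/-! ### The program -/

namespace Stmt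

/-- The size of the bag in the block that starts at the address in register `10`. -/
def blockSize : Expr := load (add (var 10) (num 1))

/-- Walks through the blocks of the nodes and computes the largest size of a bag. -/
def scan : Stmt := rep 5 (seq (set 25 (Expr.ite (sub blockSize (var 25)) blockSize (var 25)))
  (set 10 (add (add (var 10) (num 2)) blockSize)))

/-- Computes a power. -/
def power : Stmt := rep 0 (set 25 (Expr.sum 27 1 (var 25)))

/-- Sets up the pointers to the rows of the adjacency matrix. -/
def rows : Stmt := rep 4 (seq (put (add (var 14) (var 26)) (var 15))
  (seq (set 15 (add (var 15) (var 4))) (set 26 (add (var 26) (num 1)))))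

/-- Enters the edges into the adjacency matrix. -/
def edges : Stmt := rep 6
  (seq (put (add (load (add (var 14) (load (var 10)))) (load (add (var 10) (num 1)))) (num 1))
  (seq (put (add (load (add (var 14) (load (add (var 10) (num 1))))) (load (var 10))) (num 1))
  (set 10 (add (var 10) (num 2)))))

/-- Fills the beginning of a table with ones. -/
def fillOnes : Stmt := rep 2 (seq (put (add (var 15) (var 26)) (num 1))
  (set 26 (add (var 26) (num 1))))

/-- Stores the addresses of the blocks, counts children (the root is a child of itself), and sets up
the initial tables. -/
def nodes : Stmt := rep 5 (seq (put (add (var 11) (var 17)) (var 10))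
  (seq (put (add (var 13) (var 17)) (var 15))
  (seq (put (add (var 12) (load (var 10))) (add (load (add (var 12) (load (var 10)))) (num 1)))
  (seq (set 10 (add (add (var 10) (num 2)) blockSize))
  (seq (set 26 (num 0)) (seq fillOnes (seq (set 15 (add (var 15) (var 3)))
  (set 17 (add (var 17) (num 1))))))))))

/-- Loads what is needed to contract the node `16` into its parent. -/
def loadContext : Stmt := seq (set 18 (load (add (var 11) (var 16)))) (seq (set 24 (load (var 18)))
  (seq (set 19 (load (add (var 11) (var 24)))) (seq (set 20 (load (add (var 13) (var 16))))
  (seq (set 21 (load (add (var 13) (var 24)))) (seq (set 22 (load (add (var 18) (num 1))))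
  (seq (set 23 (load (add (var 19) (num 1)))) (set 26 (num 0))))))))

/-- Fills the new table of the parent. -/
def fillTable : Stmt := rep 3 (seq (put (add (var 15) (var 26)) entry)
  (set 26 (add (var 26) (num 1))))

/-- Registers the new table of the parent and proceeds to the parent. The counter of the contracted
node is made nonzero again, so that it is not contracted twice. -/
def finishPush : Stmt := seq (put (add (var 13) (var 24)) (var 15))
  (seq (set 15 (add (var 15) (var 3))) (seq (put (add (var 12) (var 16)) (num 1))
  (seq (set 16 (var 24)) (put (add (var 12) (var 24)) (sub (load (add (var 12) (var 24)))
    (num 1))))))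

/-- One step of the main loop: if all children of the current node `16` have been contracted,
contract it into its parent and proceed to the parent; otherwise proceed to the next node `17`.
If there is no next node, nothing happens. -/
def step : Stmt := ite (sub (var 5) (var 17))
  (ite (load (add (var 12) (var 16)))
    (seq (set 17 (add (var 17) (num 1))) (set 16 (var 17)))
    (seq loadContext (seq fillTable finishPush)))
  (set 17 (var 17))

/-- The main loop. -/
def main : Stmt := rep 7 step

/-- The whole program, as a list of statements.

Registers `0` to `7` hold the loop counts: the largest size `k` of a bag, `K = k + 2`, `K ^ k`, the
number `K ^ k * K ^ k` of states, the numbers `n`, `N` and `m` of vertices, nodes and edges, and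
`2 * N`. Register `8` holds the root, `9` the number `l`, `10` a position in the input; `11` to `14`
hold the addresses of four arrays behind the input (the addresses of the blocks of the nodes, the
counters of uncontracted children, the addresses of the tables, and those of the rows of the
adjacency matrix), and `15` that of the first unused cell. Registers `16` and `17` hold the current
and the next node; `18` to `24` describe the contraction of node `16` (the blocks of node and
parent, their tables, the sizes of their bags, and the parent). -/
def program : List Stmt :=
  [set 4 (load (num 0)), set 5 (load (num 1)), set 6 (load (num 2)), set 7 (add (var 5) (var 5)),
    set 8 (load (num 3)), set 9 (load (num 4)), set 10 (add (add (num 5) (var 6)) (var 6)),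
    set 25 (num 0), scan, set 0 (var 25), set 1 (add (var 0) (num 2)), set 25 (num 1), power,
    set 2 (var 25), set 3 (Expr.sum 27 2 (var 2)),
    set 11 (var 10), set 12 (add (var 11) (var 5)), set 13 (add (var 12) (var 5)),
    set 14 (add (var 13) (var 5)), set 15 (add (var 14) (var 4)), set 26 (num 0), rows,
    set 10 (num 5), edges, set 17 (num 0), nodes, set 16 (num 0), set 17 (num 0), main,
    set 25 (sub (Expr.sup 27 3 (load (add (load (add (var 13) (var 8))) (var 27)))) (num 1)),
    set 1 (Expr.ite (sub (var 9) (var 25)) (num 0) (num 1)), set 0 (var 25)]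

/-- The invariant rule for repetitions. -/
theorem run_rep_inv {c : ℕ} {s : Stmt} (I : ℕ → (ℕ → ℕ) × (ℕ → ℕ) → Prop)
    {st : (ℕ → ℕ) × (ℕ → ℕ)} (h0 : I 0 st)
    (hstep : ∀ k < st.1 c, ∀ ρ μ, I k (ρ, μ) → I (k + 1) (s.run (ρ, μ))) :
    I (st.1 c) ((rep c s).run st) := by
  have : ∀ k ≤ st.1 c, I k (s.run^[k] st) := by
    intro k
    induction k with
    | zero => exact fun _ => h0
    | succ k ih =>
      intro hk
      rw [Function.iterate_succ_apply']
      exact hstep k hk _ _ (ih (by omega))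
  exact this _ le_rfl

end Stmt

/-! ### Preparations -/

open Stmt

section prep

variable {n N : ℕ} {E : List (Fin n × Fin n)} {r : Fin N} {l : ℕ} {par : Fin N → Fin N}
  {B : Fin N → List (Fin n)} {ρ μ : ℕ → ℕ}

theorem run_scan (hμ : InputMem E r l par B μ) (h5 : ρ 5 = N) (h10 : ρ 10 = 5 + 2 * E.length)
    (h25 : ρ 25 = 0) : ∃ ρ', scan.run (ρ, μ) = (ρ', μ) ∧
      (∀ i, i ≠ 10 → i ≠ 25 → ρ' i = ρ i) ∧ ρ' 10 = blockAddr E.length B N ∧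
      (∀ t, (B t).length ≤ ρ' 25) ∧ (ρ' 25 = 0 ∨ ∃ t, ρ' 25 = (B t).length) := by
  have := run_rep_inv (c := 5) (s := seq
    (set 25 (Expr.ite (sub blockSize (var 25)) blockSize (var 25)))
    (set 10 (add (add (var 10) (num 2)) blockSize))) (st := (ρ, μ))
    (fun k st => st.2 = μ ∧ (∀ i, i ≠ 10 → i ≠ 25 → st.1 i = ρ i) ∧
      st.1 10 = blockAddr E.length B k ∧ (∀ t : Fin N, t < k → (B t).length ≤ st.1 25) ∧
      (st.1 25 = 0 ∨ ∃ t, st.1 25 = (B t).length))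
    ⟨rfl, fun _ _ _ => rfl, by simpa [blockAddr] using h10, by simp, Or.inl h25⟩ ?_
  · obtain ⟨a, b, c, d, e⟩ := this
    exact ⟨_, Prod.ext rfl a, b, c.trans (by simp [h5]), fun t => d t (by simp [h5]), e⟩
  · rintro k hk ρ₁ μ₁ ⟨rfl, hf, h₁, h₂, h₃⟩
    simp only [h5] at hk
    have hs := hμ.size ⟨k, hk⟩
    have ha := blockAddr_succ E.length B ⟨k, hk⟩
    dsimp only at hμ hs ha h₁ hf h₂ h₃
    have hm : (Expr.ite (sub blockSize (var 25)) blockSize (var 25)).eval ρ₁ μ₁ =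
        max (B ⟨k, hk⟩).length (ρ₁ 25) := by
      simp only [Expr.eval, blockSize, h₁, hs]
      split <;> omega
    have e : (seq (set 25 (Expr.ite (sub blockSize (var 25)) blockSize (var 25)))
      (set 10 (add (add (var 10) (num 2)) blockSize))).run (ρ₁, μ₁) =
      (Function.update (Function.update ρ₁ 25 (max (B ⟨k, hk⟩).length (ρ₁ 25))) 10
        (blockAddr E.length B (k + 1)), μ₁) := by
      simp only [run, hm]
      simp [Expr.eval, blockSize, h₁, hs, ha]
    rw [e]
    refine ⟨rfl, fun i hi hi' => by simp [hi, hi', hf], by simp, fun t ht => ?_, ?_⟩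
    · simp only [ne_eq, Nat.reduceEqDiff, not_false_eq_true, Function.update_of_ne,
        Function.update_self]
      rcases Nat.lt_succ_iff_lt_or_eq.1 ht with ht | ht
      · exact (h₂ t ht).trans (le_max_right _ _)
      · obtain rfl : t = ⟨k, hk⟩ := Fin.ext ht
        exact le_max_left _ _
    · simp only [ne_eq, Nat.reduceEqDiff, not_false_eq_true, Function.update_of_ne,
        Function.update_self]
      rcases max_choice (B ⟨k, hk⟩).length (ρ₁ 25) with h | h <;> rw [h]
      · exact Or.inr ⟨_, rfl⟩
      · exact h₃

theorem run_power (h25 : ρ 25 = 1) : ∃ ρ', power.run (ρ, μ) = (ρ', μ) ∧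
    (∀ i, i ≠ 25 → ρ' i = ρ i) ∧ ρ' 25 = ρ 1 ^ ρ 0 := by
  have := run_rep_inv (c := 0) (s := set 25 (Expr.sum 27 1 (var 25))) (st := (ρ, μ))
    (fun k st => st.2 = μ ∧ (∀ i, i ≠ 25 → st.1 i = ρ i) ∧ st.1 25 = ρ 1 ^ k)
    ⟨rfl, fun _ _ => rfl, by simpa using h25⟩ ?_
  · obtain ⟨a, b, c⟩ := this
    exact ⟨_, Prod.ext rfl a, b, c⟩
  · rintro k hk ρ₁ μ₁ ⟨rfl, hf, h₁⟩
    dsimp only at h₁ hf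
    refine ⟨rfl, fun i hi => by simp [run, hi, hf i hi], ?_⟩
    simp [run, eval_sum (show fresh 47 (var 25) from rfl), Expr.eval, h₁, hf 1, pow_succ, mul_comm]

theorem run_rows {A : ℕ} (h4 : ρ 4 = n) (h15 : ρ 15 = A) (hA : A = ρ 14 + n) (h26 : ρ 26 = 0) :
    ∃ ρ' μ', rows.run (ρ, μ) = (ρ', μ') ∧ (∀ i, i ≠ 15 → i ≠ 26 → ρ' i = ρ i) ∧
      ρ' 15 = A + n * n ∧ (∀ u < n, μ' (ρ 14 + u) = A + u * n) ∧
      ∀ a, a < ρ 14 ∨ A ≤ a → μ' a = μ a := by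
  have := run_rep_inv (c := 4) (s := seq (put (add (var 14) (var 26)) (var 15))
    (seq (set 15 (add (var 15) (var 4))) (set 26 (add (var 26) (num 1))))) (st := (ρ, μ))
    (fun k st => (∀ i, i ≠ 15 → i ≠ 26 → st.1 i = ρ i) ∧ st.1 15 = A + k * n ∧ st.1 26 = k ∧
      (∀ u < k, st.2 (ρ 14 + u) = A + u * n) ∧ ∀ a, a < ρ 14 ∨ A ≤ a → st.2 a = μ a)
    ⟨fun _ _ _ => rfl, by simpa using h15, h26, by simp, fun _ _ => rfl⟩ ?_
  · obtain ⟨a, b, _, d, e⟩ := this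
    simp only [h4] at b d
    exact ⟨_, _, rfl, a, b, d, e⟩
  · rintro k hk ρ₁ μ₁ ⟨hf, h₁, h₂, h₃, h₄⟩
    dsimp only at hf h₁ h₂ h₃ h₄ hk
    rw [h4] at hk
    simp only [run, Expr.eval, h₁, h₂, hf 14 (by decide) (by decide)]
    refine ⟨fun i hi hi' => by simp [hi, hi', hf], ?_, ?_, fun u hu => ?_, fun a ha => ?_⟩
    · simp [hf, h4]; ring
    · simp [h₂]
    · rcases Nat.lt_succ_iff_lt_or_eq.1 hu with hu | rfl
      · rw [Function.update_of_ne (by omega), h₃ u hu]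
      · simp
    · rw [Function.update_of_ne (by omega), h₄ a ha]

theorem mul_add_inj {n u v u' v' : ℕ} (hv : v < n) (hv' : v' < n) (h : u * n + v = u' * n + v') :
    u = u' ∧ v = v' := by
  have h1 : (u * n + v) / n = u := by
    rw [mul_comm, Nat.mul_add_div (by omega), Nat.div_eq_of_lt hv, add_zero]
  have h2 : (u' * n + v') / n = u' := by
    rw [mul_comm, Nat.mul_add_div (by omega), Nat.div_eq_of_lt hv', add_zero]
  have : u = u' := by rw [← h1, h, h2]
  subst this
  exact ⟨rfl, by omega⟩

/-- `A` is the address of the adjacency matrix, which is initially zero. -/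
theorem run_edges {A : ℕ} (h6 : ρ 6 = E.length) (h10 : ρ 10 = 5) (hμ : InputMem E r l par B μ)
    (hZ : blockAddr E.length B N ≤ ρ 14) (hA : A = ρ 14 + n)
    (hrow : ∀ u < n, μ (ρ 14 + u) = A + u * n)
    (hzero : ∀ a, A ≤ a → μ a = 0) :
    ∃ ρ' μ', edges.run (ρ, μ) = (ρ', μ') ∧ (∀ i, i ≠ 10 → ρ' i = ρ i) ∧
      ρ' 10 = 5 + 2 * E.length ∧
      (∀ u v : Fin n, ((u, v) ∈ E ∨ (v, u) ∈ E) → μ' (A + u * n + v) = 1) ∧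
      (∀ u v : Fin n, ¬ ((u, v) ∈ E ∨ (v, u) ∈ E) → μ' (A + u * n + v) = 0) ∧
      ∀ a, a < A ∨ A + n * n ≤ a → μ' a = μ a := by
  have hlt : ∀ u v : Fin n, (u : ℕ) * n + v < n * n := fun u v => by
    have h1 : ((u : ℕ) + 1) * n ≤ n * n := Nat.mul_le_mul_right n u.2
    rw [Nat.succ_mul] at h1
    have := v.2
    omega
  have hne : ∀ u v u' v' : Fin n, ¬ (u' = u ∧ v' = v) → A + (u : ℕ) * n + v ≠ A + u' * n + v' :=
    fun u v u' v' h h' => h (by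
      obtain ⟨h1, h2⟩ := mul_add_inj v.2 v'.2 (show (u : ℕ) * n + v = u' * n + v' by omega)
      exact ⟨Fin.ext h1.symm, Fin.ext h2.symm⟩)
  have h5Z : 5 + 2 * E.length ≤ blockAddr E.length B N := Nat.le_add_right _ _
  have := run_rep_inv (c := 6) (s :=
    (seq (put (add (load (add (var 14) (load (var 10)))) (load (add (var 10) (num 1)))) (num 1))
    (seq (put (add (load (add (var 14) (load (add (var 10) (num 1))))) (load (var 10))) (num 1))
    (set 10 (add (var 10) (num 2)))))) (st := (ρ, μ))
    (fun k st => (∀ i, i ≠ 10 → st.1 i = ρ i) ∧ st.1 10 = 5 + 2 * k ∧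
      (∀ u v : Fin n, (∃ (i : ℕ) (h : i < E.length), i < k ∧ (E[i] = (u, v) ∨ E[i] = (v, u))) →
        st.2 (A + u * n + v) = 1) ∧
      (∀ u v : Fin n, (¬ ∃ (i : ℕ) (h : i < E.length), i < k ∧ (E[i] = (u, v) ∨ E[i] = (v, u))) →
        st.2 (A + u * n + v) = 0) ∧
      ∀ a, a < A ∨ A + n * n ≤ a → st.2 a = μ a)
    ⟨fun _ _ => rfl, by simpa using h10, by simp, fun u v _ => hzero _ (by omega),
      fun _ _ => rfl⟩ ?_
  · obtain ⟨a, b, c, d, e⟩ := this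
    simp only [h6] at b c d
    have hex : ∀ u v : Fin n, (∃ (i : ℕ) (h : i < E.length), i < E.length ∧
        (E[i] = (u, v) ∨ E[i] = (v, u))) ↔ ((u, v) ∈ E ∨ (v, u) ∈ E) := fun u v => by
      simp only [List.mem_iff_getElem]
      constructor
      · rintro ⟨i, h, -, h1 | h1⟩
        · exact Or.inl ⟨i, h, h1⟩
        · exact Or.inr ⟨i, h, h1⟩
      · rintro (⟨i, h, h1⟩ | ⟨i, h, h1⟩)
        · exact ⟨i, h, h, Or.inl h1⟩
        · exact ⟨i, h, h, Or.inr h1⟩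
    exact ⟨_, _, rfl, a, b, fun u v h => c u v ((hex u v).2 h),
      fun u v h => d u v (fun h' => h ((hex u v).1 h')), e⟩
  · rintro k hk ρ₁ μ₁ ⟨hf, h₁, h₂, h₃, h₄⟩
    dsimp only at hf h₁ h₂ h₃ h₄ hk
    rw [h6] at hk
    have e1 : μ₁ (5 + 2 * k) = E[k].1 := by
      rw [h₄ _ (by omega), hμ.edge_fst k hk]
    have e2 : μ₁ (5 + 2 * k + 1) = E[k].2 := by
      rw [h₄ _ (by omega), hμ.edge_snd k hk]
    have e3 : ∀ u : Fin n, μ₁ (ρ 14 + u) = A + u * n := fun u => by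
      rw [h₄ _ (by have := u.2; omega), hrow u u.2]
    have f3 : ∀ (u v w : Fin n), A + (v : ℕ) * n + w ≠ ρ 14 + u := fun u v w => by
      have := u.2; omega
    have f1 : ∀ (v w : Fin n), A + (v : ℕ) * n + w ≠ 5 + 2 * k := fun v w => by omega
    have f2 : ∀ (v w : Fin n), A + (v : ℕ) * n + w ≠ 5 + 2 * k + 1 := fun v w => by omega
    simp only [run, Expr.eval, h₁, hf 14 (by decide), e1, e2, e3,
      Function.update_of_ne (f1 _ _).symm, Function.update_of_ne (f2 _ _).symm,
      Function.update_of_ne (f3 _ _ _).symm]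
    refine ⟨fun i hi => by simp [hi, hf], by simp; ring, fun u v => ?_, fun u v h => ?_,
      fun a ha => ?_⟩
    · rintro ⟨i, hi, hik, hE⟩
      simp only [Function.update_apply]
      split
      · rfl
      split
      · rfl
      rename_i g1 g2
      refine h₂ u v ⟨i, hi, ?_, hE⟩
      rcases Nat.lt_succ_iff_lt_or_eq.1 hik with hik | rfl
      · exact hik
      · exfalso
        rcases hE with hE | hE <;> simp [hE] at g1 g2
    · rw [Function.update_of_ne, Function.update_of_ne]
      · exact h₃ u v fun ⟨i, hi, hik, hE⟩ => h ⟨i, hi, by omega, hE⟩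
      · exact hne u v _ _ fun hh => h ⟨k, hk, by omega, Or.inl (Prod.ext hh.1 hh.2)⟩
      · exact hne u v _ _ fun hh => h ⟨k, hk, by omega, Or.inr (Prod.ext hh.2 hh.1)⟩
    · have := hlt E[k].1 E[k].2
      have := hlt E[k].2 E[k].1
      rw [Function.update_of_ne (by omega), Function.update_of_ne (by omega), h₄ a ha]

theorem run_fillOnes (h26 : ρ 26 = 0) : ∃ ρ' μ', fillOnes.run (ρ, μ) = (ρ', μ') ∧
    (∀ i, i ≠ 26 → ρ' i = ρ i) ∧ (∀ x < ρ 2, μ' (ρ 15 + x) = 1) ∧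
    ∀ a, a < ρ 15 ∨ ρ 15 + ρ 2 ≤ a → μ' a = μ a := by
  have := run_rep_inv (c := 2) (s := seq (put (add (var 15) (var 26)) (num 1))
    (set 26 (add (var 26) (num 1)))) (st := (ρ, μ))
    (fun k st => (∀ i, i ≠ 26 → st.1 i = ρ i) ∧ st.1 26 = k ∧ (∀ x < k, st.2 (ρ 15 + x) = 1) ∧
      ∀ a, a < ρ 15 ∨ ρ 15 + ρ 2 ≤ a → st.2 a = μ a)
    ⟨fun _ _ => rfl, h26, by simp, fun _ _ => rfl⟩ ?_
  · obtain ⟨a, _, c, d⟩ := this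
    exact ⟨_, _, rfl, a, c, d⟩
  · rintro k hk ρ₁ μ₁ ⟨hf, h₁, h₂, h₃⟩
    dsimp only at hf h₁ h₂ h₃ hk
    simp only [run, Expr.eval, h₁, hf 15 (by decide)]
    refine ⟨fun i hi => by simp [hi, hf], by simp, fun x hx => ?_, fun a ha => ?_⟩
    · rcases Nat.lt_succ_iff_lt_or_eq.1 hx with hx | rfl
      · rw [Function.update_of_ne (by omega), h₂ x hx]
      · simp
    · rw [Function.update_of_ne (by omega), h₃ a ha]

/-- `O` is the address of the arrays for the nodes and `A` that of the first table. -/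
theorem run_nodes {O A S : ℕ} (hμ : InputMem E r l par B μ) (h2 : ρ 2 ≤ S) (h3 : ρ 3 = S)
    (h5 : ρ 5 = N) (h10 : ρ 10 = 5 + 2 * E.length) (h11 : ρ 11 = O) (h12 : ρ 12 = O + N)
    (h13 : ρ 13 = O + 2 * N) (h15 : ρ 15 = A) (h17 : ρ 17 = 0)
    (hO : blockAddr E.length B N ≤ O) (hA : O + 3 * N ≤ A)
    (hzero : ∀ a, O ≤ a ∧ a < O + 3 * N ∨ A ≤ a → μ a = 0) :
    ∃ ρ' μ', nodes.run (ρ, μ) = (ρ', μ') ∧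
      (∀ i, i ≠ 10 → i ≠ 15 → i ≠ 17 → i ≠ 26 → ρ' i = ρ i) ∧ ρ' 15 = A + N * S ∧
      (∀ t : Fin N, μ' (O + t) = blockAddr E.length B t) ∧
      (∀ t : Fin N, μ' (O + 2 * N + t) = A + t * S) ∧
      (∀ q : Fin N, μ' (O + N + q) = #{t : Fin N | par t = q}) ∧
      (∀ t : Fin N, ∀ x < S, μ' (A + t * S + x) = if x < ρ 2 then 1 else 0) ∧
      ∀ a, a < O ∨ O + 3 * N ≤ a ∧ a < A ∨ A + N * S ≤ a → μ' a = μ a := by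
  have := run_rep_inv (c := 5) (s := (seq (put (add (var 11) (var 17)) (var 10))
    (seq (put (add (var 13) (var 17)) (var 15))
    (seq (put (add (var 12) (load (var 10))) (add (load (add (var 12) (load (var 10)))) (num 1)))
    (seq (set 10 (add (add (var 10) (num 2)) blockSize))
    (seq (set 26 (num 0)) (seq fillOnes (seq (set 15 (add (var 15) (var 3)))
    (set 17 (add (var 17) (num 1))))))))))) (st := (ρ, μ))
    (fun k st => (∀ i, i ≠ 10 → i ≠ 15 → i ≠ 17 → i ≠ 26 → st.1 i = ρ i) ∧ st.1 15 = A + k * S ∧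
      st.1 10 = blockAddr E.length B k ∧ st.1 17 = k ∧
      (∀ t : Fin N, t < k → st.2 (O + t) = blockAddr E.length B t) ∧
      (∀ t : Fin N, t < k → st.2 (O + 2 * N + t) = A + t * S) ∧
      (∀ q : Fin N, st.2 (O + N + q) = #{t : Fin N | t < k ∧ par t = q}) ∧
      (∀ t : Fin N, t < k → ∀ x < S, st.2 (A + t * S + x) = if x < ρ 2 then 1 else 0) ∧
      ∀ a, a < O ∨ O + 3 * N ≤ a ∧ a < A ∨ A + k * S ≤ a → st.2 a = μ a)
    ⟨fun _ _ _ _ _ => rfl, by simpa using h15, by simpa [blockAddr] using h10, h17, by simp,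
      by simp, fun q => by simpa using hzero _ (by omega), by simp, fun _ _ => rfl⟩ ?_
  · obtain ⟨a, b, -, -, c, d, e, f, g⟩ := this
    dsimp only at b c d e f g
    simp only [h5] at b c d e f g
    exact ⟨_, _, rfl, a, b, fun t => c t t.2, fun t => d t t.2, fun q => (e q).trans (by simp),
      fun t => f t t.2, g⟩
  · rintro k hk ρ₁ μ₁ ⟨hf, i1, i2, i3, i4, i5, i6, i7, i8⟩
    dsimp only at hf i1 i2 i3 i4 i5 i6 i7 i8 hk
    rw [h5] at hk
    have ha := blockAddr_succ E.length B ⟨k, hk⟩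
    have hm := blockAddr_mono E.length B (show k + 1 ≤ N from hk)
    dsimp only at ha
    have hp : μ₁ (blockAddr E.length B k) = par ⟨k, hk⟩ := by
      rw [i8 _ (by omega)]; exact hμ.parent ⟨k, hk⟩
    have hs : μ₁ (blockAddr E.length B k + 1) = (B ⟨k, hk⟩).length := by
      rw [i8 _ (by omega)]; exact hμ.size ⟨k, hk⟩
    have hpl := (par ⟨k, hk⟩).2
    set ρ₂ := Function.update (Function.update ρ₁ 10 (blockAddr E.length B (k + 1))) 26 0 with hρ₂
    set μ₂ := Function.update (Function.update (Function.update μ₁ (O + k)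
      (blockAddr E.length B k)) (O + 2 * N + k) (A + k * S)) (O + N + par ⟨k, hk⟩)
      (μ₁ (O + N + par ⟨k, hk⟩) + 1) with hμ₂
    obtain ⟨ρ₃, μ₃, e₃, g1, g2, g3⟩ := run_fillOnes (ρ := ρ₂) (μ := μ₂) (by simp [hρ₂])
    have e₂ : ρ₂ 2 = ρ 2 := by simp [hρ₂, hf]
    have e₄ : ρ₂ 15 = A + k * S := by simp [hρ₂, i1]
    rw [e₂, e₄] at g2 g3
    have e : (seq (put (add (var 11) (var 17)) (var 10))
      (seq (put (add (var 13) (var 17)) (var 15))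
      (seq (put (add (var 12) (load (var 10))) (add (load (add (var 12) (load (var 10)))) (num 1)))
      (seq (set 10 (add (add (var 10) (num 2)) blockSize))
      (seq (set 26 (num 0)) (seq fillOnes (seq (set 15 (add (var 15) (var 3)))
      (set 17 (add (var 17) (num 1)))))))))).run (ρ₁, μ₁) =
      (Function.update (Function.update ρ₃ 15 (ρ₃ 15 + ρ₃ 3)) 17 (ρ₃ 17 + 1), μ₃) := by
      have f1 : ∀ x y : ℕ → ℕ, (seq fillOnes (seq (set 15 (add (var 15) (var 3)))
        (set 17 (add (var 17) (num 1))))).run (x, y) =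
        (Function.update (Function.update (fillOnes.run (x, y)).1 15 ((fillOnes.run (x, y)).1 15 +
          (fillOnes.run (x, y)).1 3)) 17 ((fillOnes.run (x, y)).1 17 + 1),
          (fillOnes.run (x, y)).2) := fun x y => by simp [run, Expr.eval]
      rw [← show (fillOnes.run (ρ₂, μ₂)).1 = ρ₃ by rw [e₃],
        ← show (fillOnes.run (ρ₂, μ₂)).2 = μ₃ by rw [e₃], ← f1]
      have n1 : blockAddr E.length B k ≠ O + k := by omega
      have n2 : blockAddr E.length B k ≠ O + 2 * N + k := by omega
      have n3 : O + N + par ⟨k, hk⟩ ≠ O + k := by omega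
      have n4 : O + N + par ⟨k, hk⟩ ≠ O + 2 * N + k := by omega
      have n5 : blockAddr E.length B k + 1 ≠ O + k := by omega
      have n6 : blockAddr E.length B k + 1 ≠ O + 2 * N + k := by omega
      have n7 : blockAddr E.length B k + 1 ≠ O + N + par ⟨k, hk⟩ := by omega
      have hstep : ∀ (s t : Stmt) (st), (seq s t).run st = t.run (s.run st) := fun _ _ _ => rfl
      rw [hstep, hstep, hstep, hstep, hstep]
      congr 1
      simp only [run, Expr.eval, blockSize, i1, i2, i3, hf 11, hf 12, hf 13, h11, h12, h13, ne_eq,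
        Nat.reduceEqDiff, not_false_eq_true, Function.update_of_ne n1, Function.update_of_ne n2,
        hp, Function.update_of_ne n3, Function.update_of_ne n4, Function.update_of_ne n5,
        Function.update_of_ne n6, Function.update_of_ne n7, hs, ← ha]
      rfl
    rw [e]
    have hmul : ∀ t : Fin N, t < k → (t : ℕ) * S + S ≤ k * S := fun t ht => by
      rw [← Nat.succ_mul]; exact Nat.mul_le_mul_right S ht
    have hmulN : k * S + S ≤ N * S := by
      rw [← Nat.succ_mul]; exact Nat.mul_le_mul_right S hk
    have hk1 : (k + 1) * S = k * S + S := Nat.succ_mul _ _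
    have hlow : ∀ a < A + k * S, μ₃ a = μ₂ a := fun a ha => g3 a (Or.inl ha)
    refine ⟨fun i q1 q2 q3 q4 => ?_, ?_, ?_, ?_, fun t ht => ?_, fun t ht => ?_, fun q => ?_,
      fun t ht x hx => ?_, fun a ha => ?_⟩
    · simp [q2, q3, g1 i q4, hρ₂, q4, q1, hf]
    · simp [g1, hρ₂, hf, h3, hk1, add_assoc, i1]
    · simp [g1, hρ₂]
    · simp [g1, hρ₂, i3]
    · dsimp only
      rw [hlow _ (by omega), hμ₂, Function.update_of_ne (by omega),
        Function.update_of_ne (by omega)]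
      rcases Nat.lt_succ_iff_lt_or_eq.1 ht with ht | ht
      · rw [Function.update_of_ne (by omega), i4 t ht]
      · rw [ht, Function.update_self]
    · dsimp only
      rw [hlow _ (by omega), hμ₂, Function.update_of_ne (by omega)]
      rcases Nat.lt_succ_iff_lt_or_eq.1 ht with ht | ht
      · rw [Function.update_of_ne (by omega), Function.update_of_ne (by omega), i5 t ht]
      · rw [ht, Function.update_self]
    · dsimp only
      have hq := q.2
      have hset : (univ.filter fun t : Fin N => (t : ℕ) < k + 1 ∧ par t = q) =
          (univ.filter fun t : Fin N => (t : ℕ) < k ∧ par t = q) ∪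
            ({⟨k, hk⟩} : Finset (Fin N)).filter (par · = q) := by
        ext t
        simp only [mem_filter, mem_univ, true_and, mem_union, mem_singleton, Fin.ext_iff]
        rw [← or_and_right, Nat.lt_succ_iff_lt_or_eq]
      have hdis : Disjoint (univ.filter fun t : Fin N => (t : ℕ) < k ∧ par t = q)
          (({⟨k, hk⟩} : Finset (Fin N)).filter (par · = q)) := by
        rw [disjoint_left]
        simp only [mem_filter, mem_univ, true_and, mem_singleton, Fin.ext_iff]
        omega
      rw [hlow _ (by omega), hμ₂, hset, card_union_of_disjoint hdis, filter_singleton, ← i6 q]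
      by_cases hpq : par ⟨k, hk⟩ = q
      · simp [hpq]
      · rw [Function.update_of_ne (fun h => hpq (Fin.ext (by omega))),
          Function.update_of_ne (by omega), Function.update_of_ne (by omega)]
        simp [hpq]
    · dsimp only
      rcases Nat.lt_succ_iff_lt_or_eq.1 ht with ht | ht
      · have := hmul t ht
        rw [hlow _ (by omega), hμ₂, Function.update_of_ne (by omega),
          Function.update_of_ne (by omega), Function.update_of_ne (by omega), i7 t ht x hx]
      · rw [ht]
        split_ifs with hx'
        · exact g2 x hx'
        · rw [g3 _ (by omega), hμ₂, Function.update_of_ne (by omega),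
            Function.update_of_ne (by omega), Function.update_of_ne (by omega), i8 _ (by omega),
            hzero _ (by omega)]
    · dsimp only
      rw [hk1] at ha
      rw [g3 _ (by omega), hμ₂, Function.update_of_ne (by omega), Function.update_of_ne (by omega),
        Function.update_of_ne (by omega), i8 _ (by omega)]

end prep

end MatchingMulticut

namespace MatchingMulticut

open Finset MatchingMulticut.Expr Stmt

/-! ### The main loop -/

theorem TableValid.congr {n K k : ℕ} {G : SimpleGraph (Fin n)} [DecidableRel G.Adj]
    {U : Finset (Fin n)}
    {X : List (Fin n)} {tab tab' : ℕ → ℕ} (h : TableValid G K k U X tab)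
    (e : ∀ x < K ^ k * K ^ k, tab' x = tab x) : TableValid G K k U X tab' := by
  refine ⟨fun x hx m hm => h.sound x hx m (by rw [← e x hx, hm]), fun f d m hf hd hp => ?_⟩
  obtain ⟨x, hx, h1, h2, h3⟩ := h.complete f d m hf hd hp
  exact ⟨x, hx, h1, h2, by rwa [e x hx]⟩

theorem run_fillTable {n : ℕ} {G : SimpleGraph (Fin n)} [DecidableRel G.Adj] {K k : ℕ}
    {Y X : List (Fin n)} {tY tX ρ μ : ℕ → ℕ} (hY : Y.Nodup) (hX : X.Nodup) (h26 : ρ 26 = 0)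
    (hc : ∀ μ', (∀ a < ρ 15, μ' a = μ a) → PushContext G K k Y X tY tX ρ μ') :
    ∃ ρ' μ', fillTable.run (ρ, μ) = (ρ', μ') ∧ (∀ i, i ≠ 26 → ρ' i = ρ i) ∧
      (∀ a < ρ 15, μ' a = μ a) ∧
      ∀ x < K ^ k * K ^ k, μ' (ρ 15 + x) = glueTable G K k Y X tY tX x := by
  have h3 := (hc μ fun _ _ => rfl).reg_three
  have := run_rep_inv (c := 3) (s := seq (put (add (var 15) (var 26)) entry)
    (set 26 (add (var 26) (num 1)))) (st := (ρ, μ))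
    (fun j st => (∀ i, i ≠ 26 → st.1 i = ρ i) ∧ st.1 26 = j ∧ (∀ a < ρ 15, st.2 a = μ a) ∧
      ∀ x < j, st.2 (ρ 15 + x) = glueTable G K k Y X tY tX x)
    ⟨fun _ _ => rfl, h26, fun _ _ => rfl, by simp⟩ ?_
  · obtain ⟨a, _, c, d⟩ := this
    dsimp only at d
    rw [h3] at d
    exact ⟨_, _, rfl, a, c, d⟩
  · rintro j hj ρ₁ μ₁ ⟨hf, i1, i2, i3⟩
    dsimp only at hf i1 i2 i3 hj
    have hρ : ρ₁ = Function.update ρ 26 j := by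
      funext i
      by_cases hi : i = 26
      · simp [hi, i1]
      · simp [hi, hf i hi]
    have he := ((hc μ₁ i2).upd 26 le_rfl j).eval_entry hY hX (by simpa [← h3] using hj)
    rw [← hρ, i1] at he
    have e : (seq (put (add (var 15) (var 26)) entry) (set 26 (add (var 26) (num 1)))).run
        (ρ₁, μ₁) = (Function.update ρ₁ 26 (j + 1),
          Function.update μ₁ (ρ 15 + j) (entry.eval ρ₁ μ₁)) := by
      simp [run, Expr.eval, i1, hf 15]
    rw [e, he]
    refine ⟨fun i hi => by simp [hi, hf i hi], by simp, fun a ha => ?_, fun x hx => ?_⟩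
    · dsimp only
      rw [Function.update_of_ne (by omega), i2 a ha]
    · dsimp only
      rcases Nat.lt_succ_iff_lt_or_eq.1 hx with hx | rfl
      · rw [Function.update_of_ne (by omega), i3 x hx]
      · simp

section loop

variable {n N : ℕ} (G : SimpleGraph (Fin n)) [DecidableRel G.Adj] (E : List (Fin n × Fin n))
  (r : Fin N) (l : ℕ) (par : Fin N → Fin N) (B : Fin N → List (Fin n)) (k O A : ℕ)

/-- The part of registers and memory that the main loop does not change: the parameters, the input,
the addresses of the blocks of the nodes (from `O` on) and the adjacency matrix. The tables start at
address `A` or later, and bags have at most `k` elements. -/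
structure Prepared (ρ μ : ℕ → ℕ) : Prop where
  input : InputMem E r l par B μ
  reg_zero : ρ 0 = k
  reg_one : ρ 1 = k + 2
  reg_two : ρ 2 = (k + 2) ^ k
  reg_three : ρ 3 = (k + 2) ^ k * (k + 2) ^ k
  nodes : ρ 5 = N
  steps : ρ 7 = N + N
  root : ρ 8 = r
  goal : ρ 9 = l
  blocks : ρ 11 = O
  counters : ρ 12 = O + N
  tables : ρ 13 = O + 2 * N
  rows : ρ 14 = O + 3 * N
  size_le : ∀ t, (B t).length ≤ k
  input_le : blockAddr E.length B N ≤ O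
  le : O + 3 * N + n + n * n ≤ A
  block : ∀ t : Fin N, μ (O + t) = blockAddr E.length B t
  row : ∀ u : Fin n, μ (O + 3 * N + u) = O + 3 * N + n + u * n
  adj : ∀ u v : Fin n, μ (O + 3 * N + n + u * n + v) = if G.Adj u v then 1 else 0

/-- The state of the main loop when the nodes in `P` have been contracted into their parents. Nodes
that are ready for contraction (with counter zero) are the current node `ρ 16` or still to come
after `ρ 17`; the tables of the uncontracted nodes lie between `A` and the first unused cell
`ρ 15`. -/
structure Progress (P : Finset (Fin N)) (ρ μ : ℕ → ℕ) : Prop where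
  root : r ∉ P
  closed : ∀ w, par w ∈ P → w ∈ P
  current : ρ 17 < N ∧ ρ 16 < N ∨ ρ 17 = N ∧ ρ 16 = N
  counter : ∀ q : Fin N, μ (O + N + q) = if q ∈ P then 1 else #{t : Fin N | t ∉ P ∧ par t = q}
  ready : ∀ q : Fin N, μ (O + N + q) = 0 → (q : ℕ) = ρ 16 ∨ ρ 17 < q
  table : ∀ q : Fin N, q ∉ P → A ≤ μ (O + 2 * N + q) ∧
    μ (O + 2 * N + q) + (k + 2) ^ k * (k + 2) ^ k ≤ ρ 15 ∧
    TableValid G (k + 2) k (contractedBag (fun t => (B t).toFinset) par P q) (B q)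
      fun x => μ (μ (O + 2 * N + q) + x)

variable {G E r l par B k O A} {ρ μ : ℕ → ℕ}

theorem lt_sq (u v : Fin n) : (u : ℕ) * n + v < n * n := by
  have h1 : ((u : ℕ) + 1) * n ≤ n * n := Nat.mul_le_mul_right n u.2
  rw [Nat.succ_mul] at h1
  have := v.2
  omega

theorem Prepared.congr {ρ' μ' : ℕ → ℕ} (h : Prepared G E r l par B k O A ρ μ)
    (hρ : ∀ i < 15, i ≠ 10 → ρ' i = ρ i)
    (hμ : ∀ a < A, a < O + N ∨ O + 3 * N ≤ a → μ' a = μ a) :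
    Prepared G E r l par B k O A ρ' μ' := by
  have h1 := h.input_le
  have h2 := h.le
  refine ⟨h.input.congr fun a ha => hμ a (by omega) (by omega), ?_, ?_, ?_, ?_, ?_, ?_, ?_, ?_, ?_,
    ?_, ?_, ?_, h.size_le, h.input_le, h.le, fun t => ?_, fun u => ?_, fun u v => ?_⟩
  any_goals rw [hρ _ (by omega) (by omega)]
  exacts [h.reg_zero, h.reg_one, h.reg_two, h.reg_three, h.nodes, h.steps, h.root, h.goal,
    h.blocks, h.counters, h.tables, h.rows,
    (hμ _ (by have := t.2; omega) (by have := t.2; omega)).trans (h.block t),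
    (hμ _ (by have := u.2; omega) (by omega)).trans (h.row u),
    (hμ _ (by have := lt_sq u v; omega) (by omega)).trans (h.adj u v)]

theorem Prepared.pushContext (h : Prepared G E r l par B k O A ρ μ) {u p : Fin N} {tu tp : ℕ}
    {μ' : ℕ → ℕ} (hA : A ≤ ρ 15) (h18 : ρ 18 = blockAddr E.length B u)
    (h19 : ρ 19 = blockAddr E.length B p) (h20 : ρ 20 = tu) (h21 : ρ 21 = tp)
    (h22 : ρ 22 = (B u).length) (h23 : ρ 23 = (B p).length)
    (htu : tu + (k + 2) ^ k * (k + 2) ^ k ≤ ρ 15) (htp : tp + (k + 2) ^ k * (k + 2) ^ k ≤ ρ 15)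
    (hμ : ∀ a < ρ 15, μ' a = μ a) :
    PushContext G (k + 2) k (B u) (B p) (fun x => μ (tu + x)) (fun x => μ (tp + x)) ρ μ' := by
  have h' := h.congr (μ' := μ') (ρ' := ρ) (fun _ _ _ => rfl) fun a ha _ => hμ a (by omega)
  exact ⟨h.reg_zero, h.reg_one, h.reg_two, h.reg_three, h22, h23, h.size_le u, h.size_le p,
    by omega, fun j hj => by rw [h18, h'.input.bag u j hj],
    fun j hj => by rw [h19, h'.input.bag p j hj],
    fun u v => by rw [h.rows, h'.row u, h'.adj u v], fun y hy => by rw [h20, hμ _ (by omega)],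
    fun y hy => by rw [h21, hμ _ (by omega)]⟩

/-- Contracting the current node, all of whose children have been contracted, into its parent. -/
theorem Progress.contract {T : SimpleGraph (Fin N)}
    (hX : IsTreeDecomposition G T fun t => (B t).toFinset) (hB : ∀ t, (B t).Nodup)
    (hpar : ∀ t, t ≠ r → IsChild T r (par t) t) (hr : par r = r) {P : Finset (Fin N)}
    (hp : Prepared G E r l par B k O A ρ μ) (h : Progress G r par B k O A P ρ μ) {u : Fin N}
    (hu : ρ 16 = u) (h17 : ρ 17 < N) (h0 : μ (O + N + u) = 0) :
    ∃ ρ' μ', (seq loadContext (seq fillTable finishPush)).run (ρ, μ) = (ρ', μ') ∧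
      u ∉ P ∧ ρ' 17 = ρ 17 ∧ Prepared G E r l par B k O A ρ' μ' ∧
      Progress G r par B k O A (insert u P) ρ' μ' := by
  have huP : u ∉ P := fun hu => by
    have := h.counter u
    rw [if_pos hu, h0] at this
    omega
  have hch : ∀ w, par w = u → w ∈ P := fun w hw => by
    have := h.counter u
    rw [if_neg huP, h0, eq_comm, card_eq_zero, filter_eq_empty_iff] at this
    by_contra hw'
    exact this (mem_univ w) ⟨hw', hw⟩
  have hur : u ≠ r := fun hur => h.root (hch r (by rw [hr, hur]))
  set p := par u with hpu
  have hpuP : p ∉ insert u P := by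
    rw [mem_insert, not_or]
    exact ⟨(hpar u hur).1.ne, fun hpP => huP (h.closed u hpP)⟩
  have hpne : p ≠ u := fun e => hpuP (by simp [e])
  have hpP : p ∉ P := fun hpP => hpuP (mem_insert_of_mem hpP)
  obtain ⟨hAu, htu, vu⟩ := h.table u huP
  obtain ⟨hAp, htp, vp⟩ := h.table p hpP
  set tu := μ (O + 2 * N + u) with htu_def
  set tp := μ (O + 2 * N + p) with htp_def
  have hle := hp.le
  have hin := hp.input_le
  have hu2 := u.2
  have hp2 := p.2
  obtain ⟨ρ₁, e₁, hρ₁, q18, q19, q20, q21, q22, q23, q24, q26⟩ : ∃ ρ₁,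
      loadContext.run (ρ, μ) = (ρ₁, μ) ∧ (∀ i < 18, ρ₁ i = ρ i) ∧
      ρ₁ 18 = blockAddr E.length B u ∧ ρ₁ 19 = blockAddr E.length B p ∧ ρ₁ 20 = tu ∧ ρ₁ 21 = tp ∧
      ρ₁ 22 = (B u).length ∧ ρ₁ 23 = (B p).length ∧ ρ₁ 24 = p ∧ ρ₁ 26 = 0 := by
    refine ⟨_, rfl, fun i hi => ?_, ?_⟩
    · simp [run, Function.update_of_ne (show i ≠ 18 by omega),
        Function.update_of_ne (show i ≠ 19 by omega), Function.update_of_ne (show i ≠ 20 by omega),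
        Function.update_of_ne (show i ≠ 21 by omega), Function.update_of_ne (show i ≠ 22 by omega),
        Function.update_of_ne (show i ≠ 23 by omega), Function.update_of_ne (show i ≠ 24 by omega),
        Function.update_of_ne (show i ≠ 26 by omega)]
    · simp [run, Expr.eval, hp.blocks, hp.tables, hu, hp.block, hp.input.parent, hp.input.size,
        ← hpu, htu_def, htp_def]
  have e15 := hρ₁ 15 (by omega)
  have hp₁ : Prepared G E r l par B k O A ρ₁ μ :=
    hp.congr (fun i hi _ => hρ₁ i (by omega)) fun _ _ _ => rfl
  obtain ⟨ρ₂, μ₂, e₂, hρ₂, hμ₂, htab⟩ := run_fillTable (hB u) (hB p) q26 fun μ' hμ' =>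
    hp₁.pushContext (by omega) q18 q19 q20 q21 q22 q23 (by omega) (by omega) hμ'
  rw [e15] at hμ₂ htab
  have e15' : ρ₂ 15 = ρ 15 := by rw [hρ₂ 15 (by omega), e15]
  set c := μ (O + N + p) with hc
  obtain ⟨ρ₃, μ₃, e₃, hρ₃, hμ₃, q15, q16, qtab, qcu, qcp⟩ : ∃ ρ₃ μ₃,
      finishPush.run (ρ₂, μ₂) = (ρ₃, μ₃) ∧ (∀ i, i ≠ 15 → i ≠ 16 → ρ₃ i = ρ₂ i) ∧
      (∀ a, a ≠ O + 2 * N + p → a ≠ O + N + u → a ≠ O + N + p → μ₃ a = μ₂ a) ∧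
      ρ₃ 15 = ρ 15 + (k + 2) ^ k * (k + 2) ^ k ∧ ρ₃ 16 = p ∧ μ₃ (O + 2 * N + p) = ρ 15 ∧
      μ₃ (O + N + u) = 1 ∧ μ₃ (O + N + p) = c - 1 := by
    have n1 : O + N + (p : ℕ) ≠ O + N + u := fun e => hpne (Fin.ext (by omega))
    have n2 : O + N + (p : ℕ) ≠ O + 2 * N + p := by omega
    have n3 : O + N + (u : ℕ) ≠ O + 2 * N + p := by omega
    have r3 : ρ₂ 3 = (k + 2) ^ k * (k + 2) ^ k := by
      rw [hρ₂ 3 (by omega), hρ₁ 3 (by omega), hp.reg_three]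
    have r12 : ρ₂ 12 = O + N := by
      rw [hρ₂ 12 (by omega), hρ₁ 12 (by omega), hp.counters]
    have r13 : ρ₂ 13 = O + 2 * N := by
      rw [hρ₂ 13 (by omega), hρ₁ 13 (by omega), hp.tables]
    have r16 : ρ₂ 16 = u := by
      rw [hρ₂ 16 (by omega), hρ₁ 16 (by omega), hu]
    have r24 : ρ₂ 24 = p := by rw [hρ₂ 24 (by omega), q24]
    have hcp : μ₂ (O + N + p) = c := hμ₂ _ (by omega)
    have e : finishPush.run (ρ₂, μ₂) = (Function.update (Function.update ρ₂ 15
        (ρ 15 + (k + 2) ^ k * (k + 2) ^ k)) 16 p, Function.update (Function.update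
          (Function.update μ₂ (O + 2 * N + p) (ρ 15)) (O + N + u) 1) (O + N + p) (c - 1)) := by
      simp [finishPush, run, Expr.eval, r3, r12, r13, r16, r24, e15', Function.update_of_ne n1,
        Function.update_of_ne n2, hcp]
    refine ⟨_, _, e, fun i h1 h2 => by simp [h1, h2], fun a h1 h2 h3 => by simp [h1, h2, h3],
      by simp, by simp, ?_, ?_, by simp⟩
    · rw [Function.update_of_ne n2.symm, Function.update_of_ne n3.symm, Function.update_self]
    · rw [Function.update_of_ne n1.symm, Function.update_self]
  have hμ' : ∀ a < ρ 15, a ≠ O + 2 * N + p → a ≠ O + N + u → a ≠ O + N + p → μ₃ a = μ a :=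
    fun a h1 h2 h3 h4 => by rw [hμ₃ a h2 h3 h4, hμ₂ a h1]
  have hcount : ∀ q : Fin N, q ≠ u → q ≠ p → μ₃ (O + N + q) = μ (O + N + q) := fun q h1 h2 =>
    hμ' _ (by have := q.2; omega) (by have := q.2; omega) (fun e => h1 (Fin.ext (by omega)))
      fun e => h2 (Fin.ext (by omega))
  refine ⟨ρ₃, μ₃, ?_, huP, ?_, ?_, ?_⟩
  · show finishPush.run (fillTable.run (loadContext.run (ρ, μ))) = _
    rw [e₁, e₂, e₃]
  · rw [hρ₃ 17 (by omega) (by omega), hρ₂ 17 (by omega), hρ₁ 17 (by omega)]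
  · refine hp₁.congr (fun i hi _ => ?_) fun a h1 h2 => ?_
    · rw [hρ₃ i (by omega) (by omega), hρ₂ i (by omega)]
    · exact hμ' a (by omega) (by omega) (by omega) (by omega)
  · have e17 : ρ₃ 17 = ρ 17 := by
      rw [hρ₃ 17 (by omega) (by omega), hρ₂ 17 (by omega), hρ₁ 17 (by omega)]
    refine ⟨?_, fun w hw => ?_, ?_, fun q => ?_, fun q hq => ?_, fun q hq => ?_⟩
    · rw [mem_insert, not_or]
      exact ⟨fun e => hur e.symm, h.root⟩
    · rcases mem_insert.1 hw with hw | hw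
      · exact mem_insert_of_mem (hch w hw)
      · exact mem_insert_of_mem (h.closed w hw)
    · rw [e17, q16]
      exact Or.inl ⟨h17, hp2⟩
    · by_cases hqu : q = u
      · rw [hqu, qcu, if_pos (mem_insert_self _ _)]
      have hqP : q ∈ insert u P ↔ q ∈ P := by simp [hqu]
      rw [if_congr hqP rfl rfl]
      by_cases hqp : q = p
      · rw [hqp, qcp, hc, h.counter, if_neg hpP, if_neg hpP]
        rw [← card_erase_of_mem (a := u) (by simp [huP, hpu])]
        congr 1
        ext t
        simp only [mem_erase, mem_filter, mem_univ, true_and, mem_insert, not_or, and_assoc]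
      · rw [hcount q hqu hqp, h.counter q]
        congr 2
        ext t
        simp only [mem_filter, mem_univ, true_and, mem_insert, not_or]
        constructor
        · rintro ⟨h1, h2⟩
          exact ⟨⟨fun e => hqp (by rw [← h2, e]), h1⟩, h2⟩
        · rintro ⟨⟨-, h1⟩, h2⟩
          exact ⟨h1, h2⟩
    · rw [q16, e17]
      by_cases hqu : q = u
      · rw [hqu, qcu] at hq
        omega
      by_cases hqp : q = p
      · exact Or.inl (by rw [hqp])
      · rw [hcount q hqu hqp] at hq
        rcases h.ready q hq with h1 | h1
        · exact absurd (Fin.ext (h1.trans hu)) hqu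
        · exact Or.inr h1
    · rw [q15]
      by_cases hqp : q = p
      · subst hqp
        rw [qtab]
        refine ⟨by omega, le_rfl, ?_⟩
        rw [contractedBag_insert_par hpuP]
        refine tableValid_glue (hp.size_le u) (hp.size_le _) le_rfl
          (separates_contractedBag hX hpar hr huP hur) vu vp fun x hx => ?_
        rw [← htab x hx, hμ₃ _ (by omega) (by omega) (by omega)]
      · have hq2 := q.2
        have hqP : q ∉ P := fun h => hq (mem_insert_of_mem h)
        obtain ⟨g1, g2, g3⟩ := h.table q hqP
        rw [hμ' (O + 2 * N + q) (by omega) (fun e => hqp (Fin.ext (by omega))) (by omega)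
          (by omega), contractedBag_insert_of_ne hpuP hqp]
        refine ⟨g1, by omega, g3.congr fun x hx => ?_⟩
        exact hμ' _ (by omega) (by omega) (by omega) (by omega)

theorem run_main {T : SimpleGraph (Fin N)}
    (hX : IsTreeDecomposition G T fun t => (B t).toFinset) (hB : ∀ t, (B t).Nodup)
    (hpar : ∀ t, t ≠ r → IsChild T r (par t) t) (hr : par r = r)
    (hp : Prepared G E r l par B k O A ρ μ) (h : Progress G r par B k O A ∅ ρ μ)
    (h17 : ρ 17 = 0) : ∃ ρ' μ', main.run (ρ, μ) = (ρ', μ') ∧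
      Prepared G E r l par B k O A ρ' μ' ∧
      TableValid G (k + 2) k univ (B r) fun x => μ' (μ' (O + 2 * N + r) + x) := by
  -- until the nodes are exhausted, a round contracts a node or advances the pointer
  have := run_rep_inv (c := 7) (s := step) (st := (ρ, μ)) (fun j st => ∃ P,
    Prepared G E r l par B k O A st.1 st.2 ∧ Progress G r par B k O A P st.1 st.2 ∧
      (st.1 17 = N ∨ j = st.1 17 + #P)) ⟨∅, hp, h, Or.inr (by simp [h17])⟩ ?_
  · obtain ⟨P, hp', h', hN⟩ := this
    have h17 : ((rep 7 step).run (ρ, μ)).1 17 = N := by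
      rcases hN with hN | hN
      · exact hN
      · have h7 : N + N = _ + #P := hp.steps.symm.trans hN
        have := card_le_univ P
        rw [Fintype.card_fin] at this
        rcases h'.current with ⟨h1, -⟩ | ⟨h1, -⟩
        · omega
        · exact h1
    refine ⟨_, _, rfl, hp', ?_⟩
    have hall : ∀ t, t ≠ r → t ∈ P := mem_of_forall_children hpar fun t ht hch => by
      by_contra htP
      -- a node that is neither contracted nor ready has an uncontracted child
      have h0 : ((rep 7 step).run (ρ, μ)).2 (O + N + t) = 0 := by
        rw [h'.counter t, if_neg htP, card_eq_zero, filter_eq_empty_iff]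
        rintro s - ⟨hs, hst⟩
        exact hs (hch s (fun e => ht (by rw [← hst, e, hr])) hst)
      have := t.2
      rcases h'.ready t h0 with h1 | h1
      · rcases h'.current with ⟨h2, -⟩ | ⟨-, h2⟩ <;> omega
      · omega
    have := (h'.table r h'.root).2.2
    rwa [contractedBag_root hX hpar hall] at this
  · rintro j hj ρ₁ μ₁ ⟨P, hp₁, h₁, hN⟩
    dsimp only at hp₁ h₁ hN
    have e : step.run (ρ₁, μ₁) = if ρ₁ 5 - ρ₁ 17 = 0 then (Function.update ρ₁ 17 (ρ₁ 17), μ₁) else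
        if μ₁ (ρ₁ 12 + ρ₁ 16) = 0 then
          (seq loadContext (seq fillTable finishPush)).run (ρ₁, μ₁) else
          (Function.update (Function.update ρ₁ 17 (ρ₁ 17 + 1)) 16
            (Function.update ρ₁ 17 (ρ₁ 17 + 1) 17), μ₁) := rfl
    rw [e, hp₁.nodes, hp₁.counters]
    rcases h₁.current with ⟨h17, h16⟩ | ⟨h17, h16⟩
    · rw [if_neg (by omega)]
      have hj' : j = ρ₁ 17 + #P := by omega
      by_cases h0 : μ₁ (O + N + ρ₁ 16) = 0
      · rw [if_pos h0]
        obtain ⟨ρ', μ', e', huP, e17, hp', h'⟩ :=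
          h₁.contract hX hB hpar hr hp₁ (u := ⟨ρ₁ 16, h16⟩) rfl h17 h0
        rw [e']
        refine ⟨_, hp', h', Or.inr ?_⟩
        dsimp only
        rw [card_insert_of_notMem huP, e17]
        omega
      · rw [if_neg h0]
        refine ⟨P, hp₁.congr (fun i hi _ => ?_) (fun _ _ _ => rfl), ⟨h₁.root, h₁.closed, ?_,
          h₁.counter, fun q hq => ?_, ?_⟩, Or.inr ?_⟩
        · dsimp only
          rw [Function.update_of_ne (by omega), Function.update_of_ne (by omega)]
        · simp
          omega
        · have hne : (q : ℕ) ≠ ρ₁ 16 := fun e => h0 (by rw [← e]; exact hq)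
          have := h₁.ready q hq
          simp
          omega
        · exact h₁.table
        · simp
          omega
    · rw [if_pos (by omega), Function.update_eq_self]
      exact ⟨P, hp₁, h₁, Or.inl h17⟩

end loop

end MatchingMulticut

namespace MatchingMulticut

open Finset MatchingMulticut.Expr

/-! ### Running the whole program -/

theorem Expr.time_mono {g d : ℕ} (e : Expr) (he : e.wf g d = true) {ρ ρ' : ℕ → ℕ}
    (h : ∀ i < g, ρ i ≤ ρ' i) : e.time ρ ≤ e.time ρ' := by
  induction e with
  | var i | num c => exact le_rfl
  | add a b iha ihb | sub a b iha ihb =>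
    simp only [wf, Bool.and_eq_true] at he
    have := iha he.1
    have := ihb he.2
    simp only [time]
    omega
  | load a iha => exact Nat.add_le_add_right (iha he) 1
  | ite c a b ihc iha ihb =>
    simp only [wf, Bool.and_eq_true] at he
    have := ihc he.1.1
    have := iha he.1.2
    have := ihb he.2
    simp only [time]
    omega
  | letE v a b iha ihb =>
    simp only [wf, Bool.and_eq_true] at he
    have := iha he.1.2
    have := ihb he.2
    simp only [time]
    omega
  | fold i a c init body ihi ihb =>
    simp only [wf, Bool.and_eq_true, decide_eq_true_eq] at he
    have := ihi he.1.2
    have := Nat.mul_le_mul (h c he.1.1.1.1.1.1.1) (Nat.add_le_add_right (ihb he.2) 5)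
    simp only [time]
    omega

namespace Stmt

theorem time_mono {g d : ℕ} (s : Stmt) (hs : s.wf g d = true) {ρ ρ' : ℕ → ℕ}
    (h : ∀ i < g, ρ i ≤ ρ' i) : s.time ρ ≤ s.time ρ' := by
  induction s with
  | set r e =>
    simp only [wf, Bool.and_eq_true] at hs
    exact Nat.add_le_add_right (e.time_mono hs.2 h) 1
  | put a e =>
    simp only [wf, Bool.and_eq_true] at hs
    exact Nat.add_le_add_right (Nat.add_le_add (a.time_mono hs.1 h) (e.time_mono hs.2 h)) 1
  | seq s t ihs iht =>
    simp only [wf, Bool.and_eq_true] at hs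
    exact Nat.add_le_add (ihs hs.1) (iht hs.2)
  | ite c s t ihs iht =>
    simp only [wf, Bool.and_eq_true] at hs
    exact Nat.add_le_add_right (Nat.add_le_add (Nat.add_le_add (c.time_mono hs.1.1 h)
      (ihs hs.1.2)) (iht hs.2)) 1
  | rep c s ih =>
    simp only [wf, Bool.and_eq_true, decide_eq_true_eq] at hs
    exact Nat.add_le_add_right (Nat.mul_le_mul (h c hs.1) (Nat.add_le_add_right (ih hs.2) 3)) 2

/-- Compilation of a list of statements, with registers below `90` available to the statements. The
empty list becomes an instruction on a scratch register. -/
def compAll : List Stmt → Prog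
  | [] => .const 90 0
  | s :: L => .seq (s.comp 90) (compAll L)

/-- A statement is admissible if it is well-formed or a single assignment, which may then also
change one of the registers that hold loop counts. -/
def admissible : Stmt → Bool
  | set r e => decide (r < 90) && e.wf 8 90
  | s => s.wf 8 90

/-- Running the statements of a list one after the other leads to a state that satisfies `Q`, and
before every statement the loop counts are bounded by `b`. -/
def Reaches (b : ℕ → ℕ) (Q : (ℕ → ℕ) × (ℕ → ℕ) → Prop) :
    List Stmt → (ℕ → ℕ) × (ℕ → ℕ) → Prop
  | [], st => Q st
  | s :: L, st => (∀ i < 8, st.1 i ≤ b i) ∧ Reaches b Q L (s.run st)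

theorem comp_runs_of_admissible {s : Stmt} (hs : s.admissible = true) {b : ℕ → ℕ} {σ : Store}
    {st : (ℕ → ℕ) × (ℕ → ℕ)} (hb : ∀ i < 8, st.1 i ≤ b i) (h : σ.Represents 90 st) :
    ∃ m τ, Runs (s.comp 90) σ m τ ∧ m ≤ s.time b ∧ τ.Represents 90 (s.run st) := by
  by_cases hw : s.wf 8 90 = true
  · obtain ⟨m, τ, h1, h2, h3, -⟩ := s.comp_runs (by omega) 90 le_rfl hw σ st h
    exact ⟨m, τ, h1, h2.trans (s.time_mono hw hb), h3⟩
  · cases s with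
    | set r e =>
      simp only [admissible, Bool.and_eq_true, decide_eq_true_eq] at hs
      obtain ⟨m, τ, h1, h2, h3, -⟩ := comp_set_runs r e (g := 8) (by omega) le_rfl hs.1 hs.2 h
      exact ⟨m, τ, h1, h2.trans (Nat.add_le_add_right (e.time_mono hs.2 hb) 1), h3⟩
    | _ => exact absurd hs hw

theorem compAll_runs {L : List Stmt} (hL : ∀ s ∈ L, s.admissible = true) {b : ℕ → ℕ}
    {Q : (ℕ → ℕ) × (ℕ → ℕ) → Prop} {σ : Store} {st : (ℕ → ℕ) × (ℕ → ℕ)}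
    (h : Reaches b Q L st) (hσ : σ.Represents 90 st) :
    ∃ m τ st', Runs (compAll L) σ m τ ∧ m ≤ (L.map fun s => s.time b).sum + 1 ∧
      τ.Represents 90 st' ∧ Q st' := by
  induction L generalizing σ st with
  | nil =>
    refine ⟨1, _, st, .const _ _ _, by simp, ⟨fun i hi => ?_, hσ.2⟩, h⟩
    simp [hi.ne, hσ.1 i hi]
  | cons s L ih =>
    obtain ⟨m₁, τ₁, r₁, t₁, e₁⟩ := comp_runs_of_admissible (hL s (by simp)) h.1 hσ
    obtain ⟨m₂, τ₂, st', r₂, t₂, e₂, q⟩ := ih (fun s hs => hL s (by simp [hs])) h.2 e₁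
    exact ⟨_, τ₂, st', .seq r₁ r₂, by simp only [List.map_cons, List.sum_cons]; omega, e₂, q⟩

theorem admissible_program : ∀ s ∈ program, s.admissible = true := by
  decide

theorem reaches_set {b ρ μ : ℕ → ℕ} {Q : (ℕ → ℕ) × (ℕ → ℕ) → Prop} {L : List Stmt} {r : ℕ}
    {e : Expr} (hb : ∀ i < 8, ρ i ≤ b i) (x : ℕ) (hx : e.eval ρ μ = x) (hr : r < 8 → x ≤ b r)
    (h : ∀ ρ', ρ' = Function.update ρ r x → (∀ i < 8, ρ' i ≤ b i) → Reaches b Q L (ρ', μ)) :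
    Reaches b Q (set r e :: L) (ρ, μ) := by
  refine ⟨hb, ?_⟩
  rw [run]
  dsimp only
  rw [hx]
  refine h _ rfl fun i hi => ?_
  rw [Function.update_apply]
  split_ifs with hir
  · subst hir; exact hr hi
  · exact hb i hi

theorem reaches_of_run_eq {b ρ μ ρ' μ' : ℕ → ℕ} {Q : (ℕ → ℕ) × (ℕ → ℕ) → Prop} {L : List Stmt}
    {s : Stmt} (hb : ∀ i < 8, ρ i ≤ b i) (e : s.run (ρ, μ) = (ρ', μ'))
    (hs : ∀ i < 8, ρ' i = ρ i)
    (h : (∀ i < 8, ρ' i ≤ b i) → Reaches b Q L (ρ', μ')) : Reaches b Q (s :: L) (ρ, μ) :=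
  ⟨hb, by rw [e]; exact h fun i hi => by rw [hs i hi]; exact hb i hi⟩

end Stmt

open Stmt

/-- Bounds for the registers that hold loop counts, for a graph with `n` vertices and `m` edges and
a decomposition with `N` nodes and bags of size at most `k`. -/
def countBound (k n N m : ℕ) : ℕ → ℕ
  | 0 => k
  | 1 => k + 2
  | 2 => (k + 2) ^ k
  | 3 => (k + 2) ^ k * (k + 2) ^ k
  | 4 => n
  | 5 => N
  | 6 => m
  | _ => N + N

theorem reaches_program {n N : ℕ} {G : SimpleGraph (Fin n)} {T : SimpleGraph (Fin N)}
    {E : List (Fin n × Fin n)} {r : Fin N} {l : ℕ} {par : Fin N → Fin N}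
    {B : Fin N → List (Fin n)} {k : ℕ} {μ : ℕ → ℕ} (hn : 0 < n)
    (hX : IsTreeDecomposition G T fun t => (B t).toFinset) (hB : ∀ t, (B t).Nodup)
    (hBr : B r = []) (hpar : ∀ t, t ≠ r → IsChild T r (par t) t) (hr : par r = r)
    (hE : ∀ u v, G.Adj u v ↔ (u, v) ∈ E ∨ (v, u) ∈ E) (hk : ∀ t, (B t).length ≤ k)
    (hk' : ∃ t, k = (B t).length) (hμ : InputMem E r l par B μ)
    (h0 : ∀ a, blockAddr E.length B N ≤ a → μ a = 0) :
    Reaches (countBound k n N E.length) (fun st => IsGreatest (partCounts G) (st.1 0) ∧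
      st.1 1 = if l ≤ st.1 0 then 1 else 0) program (fun _ => 0, μ) := by
  classical
  have hZ0 : blockAddr E.length B 0 = 5 + 2 * E.length := by simp [blockAddr]
  set Z := blockAddr E.length B N with hZ
  rw [program]
  refine reaches_set (fun _ _ => Nat.zero_le _) n hμ.cell_zero (fun _ => le_rfl) fun ρ₁ e₁ hb => ?_
  refine reaches_set hb N hμ.cell_one (fun _ => le_rfl) fun ρ₂ e₂ hb => ?_
  refine reaches_set hb E.length hμ.cell_two (fun _ => le_rfl) fun ρ₃ e₃ hb => ?_
  refine reaches_set hb (N + N) (by simp [Expr.eval, e₃, e₂]) (fun _ => le_rfl) fun ρ₄ e₄ hb => ?_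
  refine reaches_set hb r hμ.cell_three (by omega) fun ρ₅ e₅ hb => ?_
  refine reaches_set hb l hμ.cell_four (by omega) fun ρ₆ e₆ hb => ?_
  refine reaches_set hb (5 + 2 * E.length) (by simp [Expr.eval, e₆, e₅, e₄, e₃]; ring) (by omega)
    fun ρ₇ e₇ hb => ?_
  refine reaches_set hb 0 rfl (by omega) fun ρ₈ e₈ hb => ?_
  have a4 : ρ₈ 4 = n := by simp [e₁, e₂, e₃, e₄, e₅, e₆, e₇, e₈]
  have a5 : ρ₈ 5 = N := by simp [e₂, e₃, e₄, e₅, e₆, e₇, e₈]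
  have a6 : ρ₈ 6 = E.length := by simp [e₃, e₄, e₅, e₆, e₇, e₈]
  have a7 : ρ₈ 7 = N + N := by simp [e₄, e₅, e₆, e₇, e₈]
  have a8 : ρ₈ 8 = r := by simp [e₅, e₆, e₇, e₈]
  have a9 : ρ₈ 9 = l := by simp [e₆, e₇, e₈]
  have a10 : ρ₈ 10 = 5 + 2 * E.length := by simp [e₇, e₈]
  have a25 : ρ₈ 25 = 0 := by simp [e₈]
  clear e₁ e₂ e₃ e₄ e₅ e₆ e₇ e₈
  -- the parameter `k`
  obtain ⟨ρ₁, e₁, f₁, q10, q25, q25'⟩ := run_scan hμ a5 a10 a25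
  have hk₁ : ρ₁ 25 = k := by
    obtain ⟨t₀, ht₀⟩ := hk'
    have h1 := q25 t₀
    rcases q25' with h2 | ⟨t, h2⟩
    · omega
    · have := hk t
      omega
  refine reaches_of_run_eq hb e₁ (fun i hi => f₁ i (by omega) (by omega)) fun hb => ?_
  refine reaches_set hb k hk₁ (fun _ => le_rfl) fun ρ₂ e₂ hb => ?_
  refine reaches_set hb (k + 2) (by simp [Expr.eval, e₂]) (fun _ => le_rfl) fun ρ₃ e₃ hb => ?_
  refine reaches_set hb 1 rfl (by omega) fun ρ₄ e₄ hb => ?_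
  obtain ⟨ρ₅, e₅, f₅, q25⟩ := run_power (ρ := ρ₄) (μ := μ) (by simp [e₄])
  refine reaches_of_run_eq hb e₅ (fun i hi => f₅ i (by omega)) fun hb => ?_
  have b0 : ρ₅ 0 = k := by simp [f₅, e₄, e₃, e₂]
  have b1 : ρ₅ 1 = k + 2 := by simp [f₅, e₄, e₃]
  have b25 : ρ₅ 25 = (k + 2) ^ k := by rw [q25]; simp [e₄, e₃, e₂]
  have old : ∀ i, 4 ≤ i → i ≠ 10 → i ≠ 25 → ρ₅ i = ρ₈ i := fun i h1 h2 h3 => by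
    rw [f₅ i h3, e₄, Function.update_of_ne h3, e₃, Function.update_of_ne (by omega), e₂,
      Function.update_of_ne (by omega), f₁ i h2 h3]
  have b10 : ρ₅ 10 = Z := by simp [f₅, e₄, e₃, e₂, q10, ← hZ]
  have b4 := (old 4 (by omega) (by omega) (by omega)).trans a4
  have b5 := (old 5 (by omega) (by omega) (by omega)).trans a5
  have b6 := (old 6 (by omega) (by omega) (by omega)).trans a6
  have b7 := (old 7 (by omega) (by omega) (by omega)).trans a7
  have b8 := (old 8 (by omega) (by omega) (by omega)).trans a8
  have b9 := (old 9 (by omega) (by omega) (by omega)).trans a9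
  clear old e₁ e₂ e₃ e₄ e₅ f₁ f₅ q10 q25 q25' hk₁ a4 a5 a6 a7 a8 a9 a10 a25
  -- the memory layout
  refine reaches_set hb _ b25 (fun _ => le_rfl) fun ρ₁ e₁ hb => ?_
  refine reaches_set hb ((k + 2) ^ k * (k + 2) ^ k)
    (by rw [eval_sum (by rfl)]; simp [e₁, Expr.eval]) (fun _ => le_rfl) fun ρ₂ e₂ hb => ?_
  refine reaches_set hb Z (by simp [e₂, e₁, Expr.eval, b10]) (by omega) fun ρ₃ e₃ hb => ?_
  refine reaches_set hb (Z + N) (by simp [e₃, e₂, e₁, Expr.eval, b5]) (by omega) fun ρ₄ e₄ hb => ?_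
  refine reaches_set hb (Z + 2 * N) (by simp [e₄, e₃, e₂, e₁, Expr.eval, b5]; ring) (by omega)
    fun ρ₅ e₅ hb => ?_
  refine reaches_set hb (Z + 3 * N) (by simp [e₅, e₄, e₃, e₂, e₁, Expr.eval, b5]; ring) (by omega)
    fun ρ₆ e₆ hb => ?_
  refine reaches_set hb (Z + 3 * N + n) (by simp [e₆, e₅, e₄, e₃, e₂, e₁, Expr.eval, b4])
    (by omega) fun ρ₇ e₇ hb => ?_
  refine reaches_set hb 0 rfl (by omega) fun ρ₈ e₈ hb => ?_
  have c0 : ρ₈ 0 = k := by simp [e₁, e₂, e₃, e₄, e₅, e₆, e₇, e₈, b0]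
  have c1 : ρ₈ 1 = k + 2 := by simp [e₁, e₂, e₃, e₄, e₅, e₆, e₇, e₈, b1]
  have c2 : ρ₈ 2 = (k + 2) ^ k := by simp [e₁, e₂, e₃, e₄, e₅, e₆, e₇, e₈]
  have c3 : ρ₈ 3 = (k + 2) ^ k * (k + 2) ^ k := by simp [e₂, e₃, e₄, e₅, e₆, e₇, e₈]
  have c4 : ρ₈ 4 = n := by simp [e₁, e₂, e₃, e₄, e₅, e₆, e₇, e₈, b4]
  have c5 : ρ₈ 5 = N := by simp [e₁, e₂, e₃, e₄, e₅, e₆, e₇, e₈, b5]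
  have c6 : ρ₈ 6 = E.length := by simp [e₁, e₂, e₃, e₄, e₅, e₆, e₇, e₈, b6]
  have c7 : ρ₈ 7 = N + N := by simp [e₁, e₂, e₃, e₄, e₅, e₆, e₇, e₈, b7]
  have c8 : ρ₈ 8 = r := by simp [e₁, e₂, e₃, e₄, e₅, e₆, e₇, e₈, b8]
  have c9 : ρ₈ 9 = l := by simp [e₁, e₂, e₃, e₄, e₅, e₆, e₇, e₈, b9]
  have c11 : ρ₈ 11 = Z := by simp [e₃, e₄, e₅, e₆, e₇, e₈]
  have c12 : ρ₈ 12 = Z + N := by simp [e₄, e₅, e₆, e₇, e₈]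
  have c13 : ρ₈ 13 = Z + 2 * N := by simp [e₅, e₆, e₇, e₈]
  have c14 : ρ₈ 14 = Z + 3 * N := by simp [e₆, e₇, e₈]
  have c15 : ρ₈ 15 = Z + 3 * N + n := by simp [e₇, e₈]
  have c26 : ρ₈ 26 = 0 := by simp [e₈]
  clear e₁ e₂ e₃ e₄ e₅ e₆ e₇ e₈ b0 b1 b4 b5 b6 b7 b8 b9 b10 b25
  -- the adjacency matrix
  obtain ⟨ρ₁, μ₁, e₁, f₁, d15, row, keep₁⟩ := run_rows (μ := μ) c4 c15 (by omega) c26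
  rw [c14] at row keep₁
  refine reaches_of_run_eq hb e₁ (fun i hi => f₁ i (by omega) (by omega)) fun hb => ?_
  refine reaches_set hb 5 rfl (by omega) fun ρ₂ e₂ hb => ?_
  have d14 : ρ₂ 14 = Z + 3 * N := by simp [e₂, f₁, c14]
  obtain ⟨ρ₃, μ₃, e₃, f₃, d10, adj₁, adj₀, keep₃⟩ := run_edges (ρ := ρ₂) (μ := μ₁)
    (A := Z + 3 * N + n) (by simp [e₂, f₁, c6]) (by simp [e₂])
    (hμ.congr fun a ha => keep₁ a (by omega)) (by omega) (by omega) (by rw [d14]; exact row)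
    fun a ha => by rw [keep₁ a (by omega), h0 a (by omega)]
  refine reaches_of_run_eq hb e₃ (fun i hi => f₃ i (by omega)) fun hb => ?_
  -- the initial tables
  refine reaches_set hb 0 rfl (by omega) fun ρ₄ e₄ hb => ?_
  have old : ∀ i, i ≠ 10 → i ≠ 15 → i ≠ 17 → i ≠ 26 → ρ₄ i = ρ₈ i := fun i h1 h2 h3 h4 => by
    rw [e₄, Function.update_of_ne h3, f₃ i h1, e₂, Function.update_of_ne h1, f₁ i h2 h4]
  have g10 : ρ₄ 10 = 5 + 2 * E.length := by rw [e₄, Function.update_of_ne (by omega), d10]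
  have hS : 0 < (k + 2) ^ k := Nat.pow_pos (by omega)
  obtain ⟨ρ₅, μ₅, e₅, f₅, g15, blk, tabs, cnt, init, keep₅⟩ := run_nodes (ρ := ρ₄) (μ := μ₃)
    (O := Z) (A := Z + 3 * N + n + n * n) (S := (k + 2) ^ k * (k + 2) ^ k) (par := par) (r := r)
    (l := l) (hμ.congr fun a ha => by rw [keep₃ a (by omega), keep₁ a (by omega)])
    (by rw [old 2 (by omega) (by omega) (by omega) (by omega), c2]
        exact Nat.le_mul_of_pos_left _ hS)
    (by rw [old 3 (by omega) (by omega) (by omega) (by omega), c3])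
    (by rw [old 5 (by omega) (by omega) (by omega) (by omega), c5]) g10
    (by rw [old 11 (by omega) (by omega) (by omega) (by omega), c11])
    (by rw [old 12 (by omega) (by omega) (by omega) (by omega), c12])
    (by rw [old 13 (by omega) (by omega) (by omega) (by omega), c13])
    (by simp [e₄, f₃, e₂, d15]) (by simp [e₄]) le_rfl (by omega) fun a ha => by
      rw [keep₃ a (by omega), keep₁ a (by omega), h0 a (by omega)]
  rw [old 2 (by omega) (by omega) (by omega) (by omega), c2] at init
  refine reaches_of_run_eq hb e₅ (fun i hi => f₅ i (by omega) (by omega) (by omega) (by omega))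
    fun hb => ?_
  refine reaches_set hb 0 rfl (by omega) fun ρ₆ e₆ hb => ?_
  refine reaches_set hb 0 rfl (by omega) fun ρ₇ e₇ hb => ?_
  have old' : ∀ i < 15, i ≠ 10 → ρ₇ i = ρ₈ i := fun i h1 h2 => by
    rw [e₇, Function.update_of_ne (by omega), e₆, Function.update_of_ne (by omega),
      f₅ i h2 (by omega) (by omega) (by omega), old i h2 (by omega) (by omega) (by omega)]
  have hp : Prepared G E r l par B k Z (Z + 3 * N + n + n * n) ρ₇ μ₅ := by
    refine ⟨hμ.congr fun a ha => ?_, ?_, ?_, ?_, ?_, ?_, ?_, ?_, ?_, ?_, ?_, ?_, ?_, hk, le_rfl,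
      le_rfl, blk, fun u => ?_, fun u v => ?_⟩
    · rw [keep₅ a (by omega), keep₃ a (by omega), keep₁ a (by omega)]
    any_goals rw [old' _ (by omega) (by omega)]; assumption
    · rw [keep₅ _ (by have := u.2; omega), keep₃ _ (by have := u.2; omega), row u u.2]
    · rw [keep₅ _ (by have := lt_sq u v; omega)]
      split_ifs with h
      · exact adj₁ u v ((hE u v).1 h)
      · exact adj₀ u v fun h' => h ((hE u v).2 h')
  have hN : 0 < N := by have := r.2; omega
  have hq : Progress G r par B k Z (Z + 3 * N + n + n * n) ∅ ρ₇ μ₅ := by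
    refine ⟨by simp, by simp, Or.inl (by simp [e₇, e₆, hN]), fun q => by simpa using cnt q,
      fun q _ => ?_, fun q _ => ?_⟩
    · simp only [e₇, e₆, Function.update_self, ne_eq, Nat.reduceEqDiff, not_false_eq_true,
        Function.update_of_ne]
      omega
    · have h1 : ((q : ℕ) + 1) * ((k + 2) ^ k * (k + 2) ^ k) ≤ N * ((k + 2) ^ k * (k + 2) ^ k) :=
        Nat.mul_le_mul_right _ q.2
      rw [Nat.succ_mul] at h1
      have h15 : ρ₇ 15 = ρ₅ 15 := by simp [e₇, e₆]
      rw [tabs q, h15, g15]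
      refine ⟨by omega, by omega, ?_⟩
      rw [contractedBag_empty]
      exact tableValid_init (by omega) (hk q) (init q)
  obtain ⟨ρ₉, μ₉, e₉, hp₉, hv⟩ := run_main hX hB hpar hr hp hq (by simp [e₇])
  refine reaches_of_run_eq hb e₉ (fun i hi => (congrArg (fun st => st.1 i) e₉).symm.trans
    (main.run_of_lt (g := 8) (d := 90) (by decide) _ hi)) fun hb => ?_
  -- the answer
  rw [hBr] at hv
  have hG := isGreatest_of_tableValid hn hv
  refine reaches_set hb (((range ((k + 2) ^ k * (k + 2) ^ k)).sup fun x =>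
    μ₉ (μ₉ (Z + 2 * N + r) + x)) - 1) ?_ (by omega) fun ρ₁₀ e₁₀ hb => ?_
  · have : ∀ e : Expr, (sub e (num 1)).eval ρ₉ μ₉ = e.eval ρ₉ μ₉ - 1 := fun _ => rfl
    rw [this, eval_sup (by rfl), hp₉.reg_three]
    simp [Expr.eval, hp₉.tables, hp₉.root]
  refine reaches_set hb (if l ≤ ρ₁₀ 25 then 1 else 0) ?_ ?_ fun ρ₁₁ e₁₁ hb => ?_
  · have : ρ₁₀ 9 = l := by simp [e₁₀, hp₉.goal]
    simp only [Expr.eval, this, Nat.sub_eq_zero_iff_le]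
  · intro _
    simp only [countBound]
    split_ifs <;> omega
  have h25 : ρ₁₁ 25 = (range ((k + 2) ^ k * (k + 2) ^ k)).sup (fun x =>
    μ₉ (μ₉ (Z + 2 * N + r) + x)) - 1 := by simp [e₁₁, e₁₀]
  refine ⟨hb, ?_⟩
  simp only [Reaches, run, Expr.eval]
  refine ⟨?_, ?_⟩
  · rw [Function.update_self, h25]
    exact hG
  · simp [e₁₁]

end MatchingMulticut

namespace MatchingMulticut

open Finset MatchingMulticut.Expr

/-! ### Running time -/

namespace Stmt

/-- All loop counts of the statement sit in registers below `b`. -/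
def countsLT (b : ℕ) : Stmt → Bool
  | set _ e => e.countsLT b
  | put a e => a.countsLT b && e.countsLT b
  | seq s t => s.countsLT b && t.countsLT b
  | ite c s t => c.countsLT b && s.countsLT b && t.countsLT b
  | rep c s => decide (c < b) && s.countsLT b

/-- If all loop counts are at most `M`, the running time is polynomial in `M`. -/
theorem exists_time_le {b : ℕ} (s : Stmt) (hs : s.countsLT b = true) :
    ∃ c d : ℕ, ∀ (ρ : ℕ → ℕ) (M : ℕ), 1 ≤ M → (∀ i < b, ρ i ≤ M) → s.time ρ ≤ c * M ^ d := by
  have const : ∀ {M : ℕ} (a : ℕ), 1 ≤ M → a ≤ a * M ^ 0 := fun a _ => by simp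
  induction s with
  | set r e =>
    obtain ⟨c₁, d₁, h₁⟩ := e.exists_time_le hs
    exact ⟨_, _, fun ρ M hM h => add_le_mul_pow hM (h₁ ρ M hM h) (const 1 hM)⟩
  | put a e =>
    simp only [countsLT, Bool.and_eq_true] at hs
    obtain ⟨c₁, d₁, h₁⟩ := a.exists_time_le hs.1
    obtain ⟨c₂, d₂, h₂⟩ := e.exists_time_le hs.2
    exact ⟨_, _, fun ρ M hM h => add_le_mul_pow hM (add_le_mul_pow hM (h₁ ρ M hM h)
      (h₂ ρ M hM h)) (const 1 hM)⟩
  | seq s t ihs iht =>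
    simp only [countsLT, Bool.and_eq_true] at hs
    obtain ⟨c₁, d₁, h₁⟩ := ihs hs.1
    obtain ⟨c₂, d₂, h₂⟩ := iht hs.2
    exact ⟨_, _, fun ρ M hM h => add_le_mul_pow hM (h₁ ρ M hM h) (h₂ ρ M hM h)⟩
  | ite c s t ihs iht =>
    simp only [countsLT, Bool.and_eq_true] at hs
    obtain ⟨c₀, d₀, h₀⟩ := c.exists_time_le hs.1.1
    obtain ⟨c₁, d₁, h₁⟩ := ihs hs.1.2
    obtain ⟨c₂, d₂, h₂⟩ := iht hs.2
    exact ⟨_, _, fun ρ M hM h => add_le_mul_pow hM (add_le_mul_pow hM (add_le_mul_pow hM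
      (h₀ ρ M hM h) (h₁ ρ M hM h)) (h₂ ρ M hM h)) (const 1 hM)⟩
  | rep c s ih =>
    simp only [countsLT, Bool.and_eq_true, decide_eq_true_eq] at hs
    obtain ⟨c₁, d₁, h₁⟩ := ih hs.2
    refine ⟨_, _, fun ρ M hM h => add_le_mul_pow hM (c₁ := c₁ + 3) (d₁ := d₁ + 0 + 1) ?_
      (const 2 hM)⟩
    rw [pow_succ, ← mul_assoc, mul_comm]
    exact Nat.mul_le_mul (add_le_mul_pow hM (h₁ ρ M hM h) (const 3 hM)) (h c hs.1)

/-- All loop counts sit in registers below `4`, with the possible exception of one outermost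
repetition. -/
def linear : Stmt → Bool
  | rep c s => decide (c < 8) && s.countsLT 4
  | s => s.countsLT 4

/-- If the loop counts in registers below `4` are at most `M` and all others are at most
`N * M ^ 2`, then a statement with only one loop of the latter kind runs in time linear in `N`. -/
theorem exists_time_le_of_linear (s : Stmt) (hs : s.linear = true) :
    ∃ c d : ℕ, ∀ (ρ : ℕ → ℕ) (N M : ℕ), 1 ≤ N → 1 ≤ M → (∀ i < 4, ρ i ≤ M) →
      (∀ i < 8, ρ i ≤ N * M ^ 2) → s.time ρ ≤ c * M ^ d * N := by
  have key : ∀ s : Stmt, s.countsLT 4 = true → ∃ c d : ℕ, ∀ (ρ : ℕ → ℕ) (N M : ℕ), 1 ≤ N → 1 ≤ M →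
      (∀ i < 4, ρ i ≤ M) → (∀ i < 8, ρ i ≤ N * M ^ 2) → s.time ρ ≤ c * M ^ d * N := fun s hs => by
    obtain ⟨c, d, h⟩ := s.exists_time_le hs
    exact ⟨c, d, fun ρ N M hN hM h4 _ => (h ρ M hM h4).trans (Nat.le_mul_of_pos_right _ hN)⟩
  cases s with
  | rep c s =>
    simp only [linear, Bool.and_eq_true, decide_eq_true_eq] at hs
    obtain ⟨c₁, d₁, h₁⟩ := s.exists_time_le hs.2
    refine ⟨c₁ + 3 + 2, d₁ + 0 + 2 + 0, fun ρ N M hN hM h4 h8 => ?_⟩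
    have h2 : s.time ρ + 3 ≤ (c₁ + 3) * M ^ (d₁ + 0) :=
      add_le_mul_pow hM (h₁ ρ M hM h4) (by simp)
    have h3 : ρ c * (s.time ρ + 3) ≤ (c₁ + 3) * (M ^ (d₁ + 0 + 2)) * N := by
      refine (Nat.mul_le_mul (h8 c hs.1) h2).trans (le_of_eq ?_)
      rw [pow_add M (d₁ + 0) 2]
      ring
    have h4 : 1 ≤ M ^ (d₁ + 0 + 2) * N := Nat.mul_pos (Nat.pow_pos hM) hN
    simp only [time]
    calc _ ≤ (c₁ + 3) * (M ^ (d₁ + 0 + 2)) * N + 2 * (M ^ (d₁ + 0 + 2) * N) := by omega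
      _ = _ := by ring
  | _ => exact key _ hs

theorem exists_sum_time_le (L : List Stmt) (hL : ∀ s ∈ L, s.linear = true) :
    ∃ c d : ℕ, ∀ (ρ : ℕ → ℕ) (N M : ℕ), 1 ≤ N → 1 ≤ M → (∀ i < 4, ρ i ≤ M) →
      (∀ i < 8, ρ i ≤ N * M ^ 2) → (L.map fun s => s.time ρ).sum + 1 ≤ c * M ^ d * N := by
  induction L with
  | nil => exact ⟨1, 0, fun ρ N M hN _ _ _ => by simpa using hN⟩
  | cons s L ih =>
    obtain ⟨c₁, d₁, h₁⟩ := s.exists_time_le_of_linear (hL s (by simp))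
    obtain ⟨c₂, d₂, h₂⟩ := ih fun s hs => hL s (by simp [hs])
    refine ⟨c₁ + c₂, d₁ + d₂, fun ρ N M hN hM h4 h8 => ?_⟩
    have := Nat.mul_le_mul_right N
      (add_le_mul_pow (c₁ := c₁) (d₁ := d₁) (c₂ := c₂) (d₂ := d₂) hM le_rfl le_rfl)
    have h1 := h₁ ρ N M hN hM h4 h8
    have h2 := h₂ ρ N M hN hM h4 h8
    rw [Nat.add_mul] at this
    simp only [List.map_cons, List.sum_cons]
    omega

theorem linear_program : ∀ s ∈ program, s.linear = true := by decide

end Stmt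

open Stmt

/-- The number of states of a bag of a decomposition of width `k`. -/
def stateCount (k : ℕ) : ℕ := (k + 3) ^ (k + 1) * (k + 3) ^ (k + 1)

theorem exists_program_time_le : ∃ c d : ℕ, ∀ k n N m : ℕ, 0 < N → n ≤ N * (k + 1) →
    m ≤ N * ((k + 1) * (k + 1)) →
    (program.map fun s => s.time (countBound (k + 1) n N m)).sum + 1 ≤
      c * stateCount k ^ d * N := by
  obtain ⟨c, d, h⟩ := exists_sum_time_le program linear_program
  refine ⟨c, d, fun k n N m hN hn hm => ?_⟩
  have h1 : k + 3 ≤ (k + 3) ^ (k + 1) := Nat.le_self_pow (by omega) _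
  have h2 : (k + 3) ^ (k + 1) ≤ stateCount k := Nat.le_mul_of_pos_left _ (by omega)
  have h3 : N * (k + 1) ≤ N * stateCount k ^ 2 :=
    Nat.mul_le_mul_left N ((by omega : k + 1 ≤ stateCount k).trans (Nat.le_self_pow (by omega) _))
  have h4 : N * ((k + 1) * (k + 1)) ≤ N * stateCount k ^ 2 := by
    rw [sq]
    exact Nat.mul_le_mul_left N (Nat.mul_le_mul (by omega) (by omega))
  have h5 : N * 1 ≤ N * (k + 1) := Nat.mul_le_mul_left N (by omega)
  have h6 : N * 3 ≤ N * stateCount k ^ 2 :=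
    Nat.mul_le_mul_left N ((by omega : 3 ≤ stateCount k).trans (Nat.le_self_pow (by omega) _))
  have h7 : 1 * stateCount k ^ 2 ≤ N * stateCount k ^ 2 := Nat.mul_le_mul_right _ hN
  have h8 : stateCount k ≤ stateCount k ^ 2 := Nat.le_self_pow (by omega) _
  have e0 : countBound (k + 1) n N m 0 = k + 1 := rfl
  have e1 : countBound (k + 1) n N m 1 = k + 3 := rfl
  have e2 : countBound (k + 1) n N m 2 = (k + 3) ^ (k + 1) := rfl
  have e3 : countBound (k + 1) n N m 3 = stateCount k := rfl
  have e4 : countBound (k + 1) n N m 4 = n := rfl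
  have e5 : countBound (k + 1) n N m 5 = N := rfl
  have e6 : countBound (k + 1) n N m 6 = m := rfl
  have e7 : countBound (k + 1) n N m 7 = N + N := rfl
  refine h _ N (stateCount k) hN (by omega) (fun i hi => ?_) fun i hi => ?_
  · interval_cases i <;> omega
  · interval_cases i <;> omega

/-! ### Correctness -/

theorem card_le_of_bags {n N : ℕ} {G : SimpleGraph (Fin n)} {T : SimpleGraph (Fin N)}
    {X : Fin N → Finset (Fin n)} (hX : IsTreeDecomposition G T X) {k : ℕ}
    (hk : ∀ t, #(X t) ≤ k) : n ≤ N * k := by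
  have h : (univ : Finset (Fin n)) ⊆ univ.biUnion X := fun v _ => by
    obtain ⟨⟨t, ht⟩⟩ := (hX.subtree v).nonempty
    exact mem_biUnion.2 ⟨t, mem_univ t, ht⟩
  have h1 := (card_le_card h).trans (card_biUnion_le_card_mul univ X k fun t _ => hk t)
  simpa using h1

theorem length_le_of_bags {n N : ℕ} {G : SimpleGraph (Fin n)} {T : SimpleGraph (Fin N)}
    {X : Fin N → Finset (Fin n)} (hX : IsTreeDecomposition G T X) {k : ℕ}
    (hk : ∀ t, #(X t) ≤ k) {E : List (Fin n × Fin n)} (hE : E.Nodup)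
    (hG : ∀ u v, (u, v) ∈ E → G.Adj u v) : E.length ≤ N * (k * k) := by
  have h : E.toFinset ⊆ univ.biUnion fun t => X t ×ˢ X t := fun e he => by
    obtain ⟨t, h1, h2⟩ := hX.edge_mem e.1 e.2 (hG _ _ (List.mem_toFinset.1 he))
    exact mem_biUnion.2 ⟨t, mem_univ t, mem_product.2 ⟨h1, h2⟩⟩
  rw [← List.toFinset_card_of_nodup hE]
  have h1 := (card_le_card h).trans (card_biUnion_le_card_mul univ _ (k * k) fun t _ => by
    rw [card_product]; exact Nat.mul_le_mul (hk t) (hk t))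
  simpa using h1

theorem hasMatchingMulticut_iff {n : ℕ} {G : SimpleGraph (Fin n)} {m l : ℕ}
    (h : IsGreatest (partCounts G) m) : HasMatchingMulticut G l ↔ l ≤ m := by
  constructor
  · rintro ⟨P, hP, hl⟩
    exact hl.trans (h.2 ⟨P, hP, rfl⟩)
  · intro hl
    obtain ⟨P, hP, e⟩ := h.1
    exact ⟨P, hP, hl.trans e.ge⟩

/-- The compiled program solves all instances, in time linear in the number of nodes and polynomial
in the number of states of a bag. -/
theorem exists_solvesWithin : ∃ (p : Prog) (c d : ℕ), ∀ (n N : ℕ) (G : SimpleGraph (Fin n))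
    (T : SimpleGraph (Fin N)) (r : Fin N) (X : Fin N → Finset (Fin n)) (l : ℕ) (input : List ℕ),
    0 < n → IsNiceTreeDecomposition G T r X → Encodes G T r X l input →
    N ≤ input.length ∧
      SolvesWithin p input G l ((c * stateCount (width X) ^ d * N : ℕ) : ℝ) := by
  obtain ⟨c, d, htime⟩ := exists_program_time_le
  refine ⟨compAll program, c, d, fun n N G T r X l input hn hnice henc => ?_⟩
  obtain ⟨E, par, B, hEn, hEm, hr, hpar, hB, rfl⟩ := henc
  have hmap : ∀ L : List (Fin n),
      List.map (fun v : ℕ => v) (do let a ← L; pure (a : ℕ)) = L.map Fin.val := by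
    simp [List.map_eq_flatMap]
  simp only [hmap]
  obtain rfl : (fun t => (B t).toFinset) = X := funext fun t => (hB t).2
  have hX := hnice.isTreeDecomposition
  have hN : 0 < N := by have := r.2; omega
  have hcard : ∀ t, #((B t).toFinset) = (B t).length := fun t =>
    List.toFinset_card_of_nodup (hB t).1
  have hsup : ∀ t, #((B t).toFinset) ≤ univ.sup fun t => #((B t).toFinset) := fun t =>
    le_sup (f := fun t => #((B t).toFinset)) (mem_univ t)
  set k := width fun t => (B t).toFinset with hk
  have hk1 : (univ.sup fun t => #((B t).toFinset)) = k + 1 := by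
    have : 0 < univ.sup fun t => #((B t).toFinset) := by
      obtain ⟨⟨t, ht⟩⟩ := (hX.subtree ⟨0, hn⟩).nonempty
      exact (card_pos.2 ⟨_, ht⟩).trans_le (hsup t)
    rw [hk, width]
    omega
  rw [hk1] at hsup
  have hadj : ∀ u v, G.Adj u v ↔ (u, v) ∈ E ∨ (v, u) ∈ E := fun u v => by
    rw [← SimpleGraph.mem_edgeSet, ← hEm, List.mem_map]
    constructor
    · rintro ⟨⟨a, b⟩, hab, e⟩
      rcases Sym2.eq_iff.1 e with ⟨rfl, rfl⟩ | ⟨rfl, rfl⟩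
      · exact Or.inl hab
      · exact Or.inr hab
    · rintro (h | h)
      · exact ⟨_, h, rfl⟩
      · exact ⟨_, h, Sym2.eq_swap⟩
  have hlen := length_input E r l par B
  have hmem := inputMem_initStore E r l par B
  set input := [n, N, E.length, (r : ℕ), l] ++ E.flatMap (fun e => [(e.1 : ℕ), (e.2 : ℕ)]) ++
    (List.finRange N).flatMap (fun t => (par t : ℕ) :: (B t).length :: (B t).map Fin.val)
  refine ⟨?_, ?_⟩
  · rw [hlen, blockAddr]
    have : ∑ i ∈ range N, 1 ≤ ∑ i ∈ range N, if h : i < N then (B ⟨i, h⟩).length + 2 else 0 :=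
      sum_le_sum fun i hi => by rw [dif_pos (mem_range.1 hi)]; omega
    simp only [sum_const, card_range, smul_eq_mul, mul_one] at this
    omega
  · have hBr : B r = [] := by
      have := hnice.root_bag
      simpa using this
    obtain ⟨t₀, -, ht₀⟩ := exists_mem_eq_sup univ ⟨r, mem_univ r⟩ fun t => #((B t).toFinset)
    have hreach := reaches_program (k := k + 1) hn hX (fun t => (hB t).1) hBr hpar hr hadj
      (fun t => (hcard t).symm.trans_le (hsup t)) ⟨t₀, by rw [← hk1, ht₀, hcard]⟩ hmem
      fun a ha => by
        rw [← hlen] at ha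
        exact List.getD_eq_default _ _ ha
    obtain ⟨m, τ, st, hrun, hm, hτ, hQ⟩ := compAll_runs admissible_program hreach
      (σ := initStore input) ⟨fun _ _ => rfl, rfl⟩
    rw [← hτ.1 0 (by omega), ← hτ.1 1 (by omega)] at hQ
    have hl := hasMatchingMulticut_iff (l := l) hQ.1
    refine ⟨m, τ, hrun, ?_, hQ.1, fun h => by rw [hQ.2, if_pos (hl.1 h)],
      fun h => by rw [hQ.2, if_neg fun h' => h (hl.2 h')]⟩
    exact_mod_cast hm.trans (htime k n N E.length hN (card_le_of_bags hX hsup)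
      (length_le_of_bags hX hsup (hEn.of_map _) fun u v h => (hadj u v).2 (Or.inl h)))

/-! ### Estimates -/

theorem stateCount_mono : Monotone stateCount := fun a b h => by
  have : (a + 3) ^ (a + 1) ≤ (b + 3) ^ (b + 1) :=
    (Nat.pow_le_pow_left (by omega) _).trans (Nat.pow_le_pow_right (by omega) (by omega))
  exact Nat.mul_le_mul this this

theorem le_stateCount (k : ℕ) : k + 1 ≤ stateCount k := by
  have h1 : k + 3 ≤ (k + 3) ^ (k + 1) := Nat.le_self_pow (by omega) _
  have h2 : (k + 3) ^ (k + 1) ≤ stateCount k := Nat.le_mul_of_pos_left _ (by omega)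
  omega

theorem primrec_stateCount : Primrec stateCount := by
  have h : Primrec fun k => (k + 3) ^ (k + 1) :=
    (Primrec₂.unpaired'.1 Nat.Primrec.pow).comp
      (Primrec.nat_add.comp Primrec.id (Primrec.const 3)) Primrec.succ
  exact Primrec.nat_mul.comp h h

/-- For `k ≥ 2`, the base `k + 3` is at most `k ^ 3` and the exponent `2 * (k + 1)` at most `3 * k`;
the constant `256` covers `k = 0` and `k = 1`. -/
theorem stateCount_le (k : ℕ) :
    (stateCount k : ℝ) ≤ 256 * (2 : ℝ) ^ (9 * (k * Real.logb 2 k)) := by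
  rcases Nat.lt_or_ge k 2 with hk | hk
  · interval_cases k <;> norm_num [stateCount]
  · have h1 : k + 3 ≤ k ^ 3 := by nlinarith [Nat.mul_le_mul hk hk, Nat.mul_le_mul_right k hk]
    have h2 : stateCount k ≤ k ^ (9 * k) := by
      calc stateCount k ≤ (k ^ 3) ^ (k + 1) * (k ^ 3) ^ (k + 1) :=
            Nat.mul_le_mul (Nat.pow_le_pow_left h1 _) (Nat.pow_le_pow_left h1 _)
        _ = k ^ (6 * k + 6) := by rw [← pow_mul, ← pow_add]; congr 1; ring
        _ ≤ k ^ (9 * k) := Nat.pow_le_pow_right (by omega) (by omega)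
    have hk0 : (0 : ℝ) < k := by positivity
    have h3 : (2 : ℝ) ^ (9 * (k * Real.logb 2 k)) = (k : ℝ) ^ (9 * k) := by
      rw [show 9 * (k * Real.logb 2 k) = Real.logb 2 k * ((9 * k : ℕ) : ℝ) by push_cast; ring,
        Real.rpow_mul (by norm_num), Real.rpow_logb (by norm_num) (by norm_num) hk0,
        Real.rpow_natCast]
    rw [h3]
    have h4 : (stateCount k : ℝ) ≤ (k : ℝ) ^ (9 * k) := by exact_mod_cast h2
    have h5 : (0 : ℝ) ≤ (k : ℝ) ^ (9 * k) := by positivity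
    linarith

theorem SolvesWithin.mono {p : Prog} {input : List ℕ} {n : ℕ} {G : SimpleGraph (Fin n)} {l : ℕ}
    {b b' : ℝ} (h : SolvesWithin p input G l b) (hb : b ≤ b') : SolvesWithin p input G l b' := by
  obtain ⟨m, τ, h1, h2, h3⟩ := h
  exact ⟨m, τ, h1, h2.trans hb, h3⟩

end MatchingMulticut

theorem mainTheorem4 :
    ∃ p : MatchingMulticut.Prog,
      -- time `2 ^ O(k log k) * n`, for decompositions with `O(k n)` nodes
      (∀ c : ℕ, ∃ C : ℕ, ∀ (n N : ℕ) (G : SimpleGraph (Fin n)) (T : SimpleGraph (Fin N))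
        (r : Fin N) (X : Fin N → Finset (Fin n)) (l k : ℕ) (input : List ℕ),
        0 < n → MatchingMulticut.IsNiceTreeDecomposition G T r X →
        MatchingMulticut.width X = k → N ≤ c * (k + 1) * n →
        MatchingMulticut.Encodes G T r X l input →
        MatchingMulticut.SolvesWithin p input G l
          (C * (2 : ℝ) ^ ((C : ℝ) * (k * Real.logb 2 k)) * n)) ∧
      -- fixed-parameter tractability with respect to the width of the given decomposition
      (∃ (f : ℕ → ℕ) (d : ℕ), Computable f ∧
        ∀ (n N : ℕ) (G : SimpleGraph (Fin n)) (T : SimpleGraph (Fin N))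
          (r : Fin N) (X : Fin N → Finset (Fin n)) (l k : ℕ) (input : List ℕ),
          0 < n → MatchingMulticut.IsNiceTreeDecomposition G T r X →
          MatchingMulticut.width X = k → MatchingMulticut.Encodes G T r X l input →
          MatchingMulticut.SolvesWithin p input G l ((f k : ℝ) * (input.length : ℝ) ^ d)) ∧
      -- fixed-parameter tractability with respect to the treewidth of the graph
      (∀ g : ℕ → ℕ, Computable g → ∃ (f : ℕ → ℕ) (d : ℕ), Computable f ∧
        ∀ (n N : ℕ) (G : SimpleGraph (Fin n)) (T : SimpleGraph (Fin N))
          (r : Fin N) (X : Fin N → Finset (Fin n)) (l : ℕ) (input : List ℕ),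
          0 < n → MatchingMulticut.IsNiceTreeDecomposition G T r X →
          MatchingMulticut.width X ≤ g (MatchingMulticut.treewidth G) →
          MatchingMulticut.Encodes G T r X l input →
          MatchingMulticut.SolvesWithin p input G l
            ((f (MatchingMulticut.treewidth G) : ℝ) * (input.length : ℝ) ^ d)) := by
  open MatchingMulticut in
  obtain ⟨p, c₀, d₀, hp⟩ := exists_solvesWithin
  have hmono : ∀ {k k' : ℕ}, k ≤ k' → c₀ * stateCount k ^ d₀ ≤ c₀ * stateCount k' ^ d₀ := fun h =>
    Nat.mul_le_mul_left _ (Nat.pow_le_pow_left (stateCount_mono h) _)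
  have hcomp : Computable fun k => c₀ * stateCount k ^ d₀ :=
    (Primrec.nat_mul.comp (Primrec.const c₀) ((Primrec₂.unpaired'.1 Nat.Primrec.pow).comp
      primrec_stateCount (Primrec.const d₀))).to_comp
  refine ⟨p, fun c => ?_, ⟨fun k => c₀ * stateCount k ^ d₀, 1, hcomp, ?_⟩, fun g hg =>
    ⟨fun w => c₀ * stateCount (g w) ^ d₀, 1, hcomp.comp hg, ?_⟩⟩
  · refine ⟨c₀ * c * 256 ^ (d₀ + 1) + 9 * (d₀ + 1), ?_⟩
    rintro n N G T r X l k input hn hT rfl hN hE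
    refine (hp n N G T r X l input hn hT hE).2.mono ?_
    set k := width X
    set x : ℝ := k * Real.logb 2 k with hx
    have hx0 : 0 ≤ x := by
      rcases Nat.eq_zero_or_pos k with h | h
      · simp [hx, h]
      · exact mul_nonneg (Nat.cast_nonneg _)
          (Real.logb_nonneg (by norm_num) (by exact_mod_cast h))
    have h1 : c₀ * stateCount k ^ d₀ * N ≤ c₀ * c * stateCount k ^ (d₀ + 1) * n := by
      calc c₀ * stateCount k ^ d₀ * N ≤ c₀ * stateCount k ^ d₀ * (c * stateCount k * n) :=
            Nat.mul_le_mul_left _ (hN.trans (Nat.mul_le_mul_right _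
              (Nat.mul_le_mul_left _ (le_stateCount k))))
        _ = _ := by ring
    have h2 : (stateCount k : ℝ) ^ (d₀ + 1) ≤
        256 ^ (d₀ + 1) * (2 : ℝ) ^ (((9 * (d₀ + 1) : ℕ) : ℝ) * x) := by
      refine (pow_le_pow_left₀ (Nat.cast_nonneg _) (stateCount_le k) (d₀ + 1)).trans (le_of_eq ?_)
      rw [mul_pow, ← Real.rpow_natCast ((2 : ℝ) ^ _), ← Real.rpow_mul (by norm_num)]
      congr 2
      push_cast
      ring
    have h3 : (2 : ℝ) ^ (((9 * (d₀ + 1) : ℕ) : ℝ) * x) ≤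
        (2 : ℝ) ^ (((c₀ * c * 256 ^ (d₀ + 1) + 9 * (d₀ + 1) : ℕ) : ℝ) * x) :=
      Real.rpow_le_rpow_of_exponent_le (by norm_num)
        (mul_le_mul_of_nonneg_right (by exact_mod_cast Nat.le_add_left _ _) hx0)
    calc ((c₀ * stateCount k ^ d₀ * N : ℕ) : ℝ)
        ≤ c₀ * c * (stateCount k : ℝ) ^ (d₀ + 1) * n := by exact_mod_cast h1
      _ ≤ c₀ * c * (256 ^ (d₀ + 1) *
            (2 : ℝ) ^ (((c₀ * c * 256 ^ (d₀ + 1) + 9 * (d₀ + 1) : ℕ) : ℝ) * x)) * n := by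
          gcongr
          exact h2.trans (mul_le_mul_of_nonneg_left h3 (by positivity))
      _ = ((c₀ * c * 256 ^ (d₀ + 1) : ℕ) : ℝ) *
            (2 : ℝ) ^ (((c₀ * c * 256 ^ (d₀ + 1) + 9 * (d₀ + 1) : ℕ) : ℝ) * x) * n := by
          push_cast
          ring
      _ ≤ _ := by
          gcongr
          exact Nat.le_add_right _ _
  · rintro n N G T r X l k input hn hT rfl hE
    obtain ⟨hN, hs⟩ := hp n N G T r X l input hn hT hE
    refine hs.mono ?_
    rw [pow_one]
    exact_mod_cast Nat.mul_le_mul_left _ hN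
  · intro n N G T r X l input hn hT hk hE
    obtain ⟨hN, hs⟩ := hp n N G T r X l input hn hT hE
    refine hs.mono ?_
    rw [pow_one]
    exact_mod_cast Nat.mul_le_mul (hmono hk) hN
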